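/- Let $g\ge 0$ and $k\ge 2$ be integers with $2-2g-k<0$, let $S_{g,k}$ be the surface obtained from the closed orientable surface of genus $g$ by removing $k$ distinct points, and let $\Pi=\pi_1(S_{g,k})$, acting on the universal cover $\widetilde S_{g,k}$ by deck transformations. Let $\mathrm{Aff}(\mathbb C)=\{z\mapsto az+b : a\in\mathbb C^*,\ b\in\mathbb C\}$. A complex affine structure on $S_{g,k}$ is an atlas of charts to $\mathbb C$ whose transition maps are locally restrictions of elements of $\mathrm{Aff}(\mathbb C)$. A homomorphism $\rho:\Pi\to\mathrm{Aff}(\mathbb C)$ is the monodromy of such a structure if the structure has a developing map $f:\widetilde S_{g,k}\to\mathbb C$ (a map that is locally the composition of the covering projection with an affine chart) with $f(\gamma\cdot x)=\rho(\gamma)(f(x))$ for all $\gamma\in\Pi$ and $x\in\widetilde S_{g,k}$. Then every non-trivial homomorphism $\rho:\Pi\to\mathrm{Aff}(\mathbb C)$ is the monodromy of some complex affine structure on $S_{g,k}$. If $k\ge 3$, then every homomorphism $\rho:\Pi\to\mathrm{Aff}(\mathbb C)$, including the trivial one, is the monodromy of some complex affine structure on $S_{g,k}$. -/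

import Mathlib

open Topology Set

noncomputable section

/-! ### Surfaces -/

/-- The closed unit disc in `ℂ`, regarded as a polygon whose sides are arcs of the unit circle. -/
abbrev UnitDisc : Type := Metric.closedBall (0 : ℂ) 1

/-- The point at parameter `t` of the boundary of the disc, which is divided into `4 * g` equal
arcs: the `n`-th arc (`n = 0, …, 4 * g - 1`) consists of the points with `t ∈ [n, n + 1]`. -/
def boundaryPoint (g : ℕ) (t : ℝ) : UnitDisc :=
  ⟨Complex.exp ((2 * Real.pi * t / (4 * g) : ℝ) * Complex.I), by
    rw [mem_closedBall_zero_iff, Complex.norm_exp_ofReal_mul_I]⟩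

/-- The side identifications of the standard polygon of genus `g`.  For `g ≥ 1` it is the `4g`-gon
with boundary word `a₁ b₁ a₁⁻¹ b₁⁻¹ ⋯ a_g b_g a_g⁻¹ b_g⁻¹`: each of the sides `4j` and `4j + 1` is
glued to the second next side with its direction reversed.
For `g = 0` it is the bigon with boundary word `c c⁻¹`: the upper half of the circle is glued to
the lower half by complex conjugation. -/
inductive SideGluing (g : ℕ) : UnitDisc → UnitDisc → Prop
  | sphere (hg : g = 0) (z w : UnitDisc) (hz : ‖(z : ℂ)‖ = 1)
      (hw : (w : ℂ) = (starRingEnd ℂ) (z : ℂ)) : SideGluing g z w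
  | handle (j : ℕ) (hj : j < g) (i : ℕ) (hi : i < 2) (s : ℝ) (hs : s ∈ Icc (0 : ℝ) 1) :
      SideGluing g (boundaryPoint g (4 * j + i + s)) (boundaryPoint g (4 * j + i + 2 + (1 - s)))

/-- The closed orientable surface of genus `g`, as the quotient of the standard polygon. -/
def ClosedSurface (g : ℕ) : Type := Quot (SideGluing g)

instance (g : ℕ) : TopologicalSpace (ClosedSurface g) :=
  inferInstanceAs (TopologicalSpace (Quot (SideGluing g)))

/-- `S` is a surface `S_{g,k}` of genus `g` with `k` punctures: it is homeomorphic to the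
complement of `k` distinct points in the closed orientable surface of genus `g`. -/
def IsPuncturedSurface (g k : ℕ) (S : Type*) [TopologicalSpace S] : Prop :=
  ∃ P : Set (ClosedSurface g), P.encard = k ∧ Nonempty (S ≃ₜ ↥Pᶜ)

/-! ### Complex affine structures -/

/-- The group `Aff(ℂ)` of the maps `z ↦ a z + b` with `a ≠ 0`, under composition. -/
abbrev AffC : Type := ℂ ≃ᵃ[ℂ] ℂ

/-- `f` agrees near each point of `u` with an element of `Aff(ℂ)`. -/
def IsLocallyAffineOn (f : ℂ → ℂ) (u : Set ℂ) : Prop :=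
  ∀ x ∈ u, ∃ A : AffC, ∀ᶠ y in 𝓝[u] x, f y = A y

/-- The locally affine maps between open subsets of `ℂ`. -/
def affinePregroupoid : Pregroupoid ℂ where
  property := IsLocallyAffineOn
  comp := by
    intro f g u v hf hg hu hv huv x hx
    obtain ⟨A, hA⟩ := hf x hx.1
    obtain ⟨B, hB⟩ := hg (f x) hx.2
    refine ⟨B * A, ?_⟩
    rw [hu.nhdsWithin_eq hx.1] at hA
    rw [hv.nhdsWithin_eq hx.2] at hB
    rw [huv.nhdsWithin_eq hx]
    have hc : ContinuousAt f x :=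
      (A.toContinuousAffineEquiv.continuous.continuousAt).congr
        (hA.mono fun y hy => by simp [hy])
    filter_upwards [hA, hc.eventually hB] with y h1 h2
    simp only [Function.comp_apply, h2, AffineEquiv.mul_def, AffineEquiv.trans_apply]
    rw [h1]
  id_mem := fun x _ => ⟨1, by simp⟩
  locality := by
    intro f u hu h x hx
    obtain ⟨v, hv, hxv, hf⟩ := h x hx
    obtain ⟨A, hA⟩ := hf x ⟨hx, hxv⟩
    refine ⟨A, ?_⟩
    rwa [nhdsWithin_inter_of_mem' (mem_nhdsWithin_of_mem_nhds (hv.mem_nhds hxv))] at hA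
  congr := by
    intro f g u hu hfg hf x hx
    obtain ⟨A, hA⟩ := hf x hx
    refine ⟨A, ?_⟩
    filter_upwards [hA, self_mem_nhdsWithin] with y h1 h2
    rw [hfg y h2, h1]

/-- The homeomorphisms between open subsets of `ℂ` that are locally restrictions of elements
of `Aff(ℂ)`. -/
def affineGroupoid : StructureGroupoid ℂ := affinePregroupoid.groupoid

/-- A complex affine structure on `S`: an atlas of charts to open subsets of `ℂ` whose transition
maps are locally restrictions of elements of `Aff(ℂ)`. -/
structure ComplexAffineStructure (S : Type*) [TopologicalSpace S] where
  /-- The charts. -/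
  charts : ChartedSpace ℂ S
  /-- The transition maps are affine. -/
  affine : HasGroupoid S affineGroupoid

/-- The affine charts of a complex affine structure: all charts of its maximal atlas. -/
def ComplexAffineStructure.maximalAtlas {S : Type*} [TopologicalSpace S]
    (σ : ComplexAffineStructure S) : Set (OpenPartialHomeomorph S ℂ) :=
  letI := σ.charts
  StructureGroupoid.maximalAtlas S affineGroupoid

/-! ### Developing maps and monodromy -/

/-- The fundamental group of `S` at `x`, in which the product `α * β` is the class of the loop
that runs first through `α` and then through `β`.  (The product of Mathlib's `FundamentalGroup`
is in the opposite order.) -/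
abbrev LoopGroup (S : Type*) [TopologicalSpace S] (x : S) : Type _ :=
  (FundamentalGroup S x)ᵐᵒᵖ

section

variable {S E : Type*} [TopologicalSpace S] [TopologicalSpace E] {p : E → S}

/-- The homeomorphism `φ` of the covering space `E` is the deck transformation by which the class
`γ` acts: it covers the identity, and it takes the base point `e₀` to the end point of the lift
of `γ` that starts at `e₀`. -/
def IsDeckTransformationOf (hp : IsCoveringMap p) {x₀ : S} (e₀ : p ⁻¹' {x₀})
    (γ : LoopGroup S x₀) (φ : E ≃ₜ E) : Prop :=
  (∀ e : E, p (φ e) = p e) ∧ φ e₀ = hp.monodromy γ.unop.toPath e₀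

/-- `dev` is a developing map of the affine structure `σ` on `S`: a map on the universal cover
that is locally the composition of the covering projection with an affine chart. -/
def IsDevelopingMap (p : E → S) (σ : ComplexAffineStructure S) (dev : E → ℂ) : Prop :=
  ∀ e : E, ∃ c ∈ σ.maximalAtlas, p e ∈ c.source ∧ ∀ᶠ e' in 𝓝 e, dev e' = c (p e')

/-- `ρ` is the monodromy of the affine structure `σ` on `S`, for the universal cover `p : E → S`
with base point `e₀` over `x₀`: there is a developing map `dev` with
`dev (γ · e) = ρ γ (dev e)` for all `γ` in the fundamental group and all `e` in `E`. -/
def IsMonodromy (hp : IsCoveringMap p) {x₀ : S} (e₀ : p ⁻¹' {x₀})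
    (σ : ComplexAffineStructure S) (ρ : LoopGroup S x₀ →* AffC) : Prop :=
  ∃ dev : E → ℂ, IsDevelopingMap p σ dev ∧
    ∀ (γ : LoopGroup S x₀) (φ : E ≃ₜ E), IsDeckTransformationOf hp e₀ γ φ →
      ∀ e : E, dev (φ e) = ρ γ (dev e)

end

end

/-! Since k is at least 2, there are enough punctures to place one at every vertex of the standard
polygon: its vertices give at most two points of the sphere, and at most one point in positive
genus. Finite subsets of equal size in a closed surface are exchanged by a homeomorphism, so all
punctures may be assumed to lie on the boundary of the polygon and to include the vertices
(`IsPolygonGluing.exists_isOpenEmbedding`). What is left of the polygon is an open disc with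
finitely many open boundary arcs, glued in pairs, and no holonomy condition at a vertex remains.

This polygon is modelled on a strip in the upper half plane and lifted to the universal cover
(`IsPolygonGluing.exists_lift`); the lift meets every fibre. A developing map is then determined by
an immersion `F` of the strip for which the germs at two paired arcs differ by `ρ` of the class that
pairs them. On one arc of each pair the germ is required to be the identity, on the other the affine
germ forced by `ρ` (`IsPolygonGluing.exists_immersion`).

The geometric heart is that an immersion of the half plane can have arbitrary affine germs on
finitely many disjoint boundary intervals. Each interval carries a small tab, outside of which the
map is the identity (`exists_tab`). Within the tab the map runs through a path of affine maps from
the prescribed one to the identity. It is an immersion if the origin of the moving frame advances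
upwards, as seen from the frame, faster than the frame turns or scales. Such a path joins any two
affine maps, because during a full turn of the frame a nonnegative speed produces any desired
displacement (`exists_affine_path`).

The immersion extends equivariantly (`exists_equivariant_extension`) and is a local homeomorphism
also across the edges, where the two half-disc germs fit into one affine germ
(`IsPolygonGluing.exists_isMonodromy`). An equivariant local homeomorphism to the plane is a
developing map (`exists_isMonodromy`). The argument is the same for every homomorphism, trivial or
not. -/

noncomputable section

/-! ### Deck classes between points of a fibre, and equivariant maps as developing maps -/

section

variable {S E : Type*} [TopologicalSpace S] [TopologicalSpace E] {p : E → S}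

/-- The class of the projections to the base of the paths from `e₀` to `e` in a simply connected
covering space. -/
def projectedClass [SimplyConnectedSpace E] (hp : IsCoveringMap p) {x₀ : S} (e₀ : p ⁻¹' {x₀})
    (e : E) : Path.Homotopic.Quotient x₀ (p e) :=
  ((Path.Homotopic.Quotient.mk (PathConnectedSpace.somePath e₀.1 e)).map
    ⟨p, hp.continuous⟩).cast e₀.2.symm rfl

/-- The class in the fundamental group whose deck transformation takes `e` to `e'`. -/
def loopOf [SimplyConnectedSpace E] (hp : IsCoveringMap p) {x₀ : S} (e₀ : p ⁻¹' {x₀})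
    (e e' : E) (h : p e = p e') : LoopGroup S x₀ :=
  MulOpposite.op (FundamentalGroup.fromPath ((projectedClass hp e₀ e').trans
    ((projectedClass hp e₀ e).cast rfl h.symm).symm))

variable [SimplyConnectedSpace E] (hp : IsCoveringMap p) {x₀ : S} (e₀ : p ⁻¹' {x₀})

theorem unop_loopOf (e e' : E) (h : p e = p e') : (loopOf hp e₀ e e' h).unop =
    (projectedClass hp e₀ e').trans ((projectedClass hp e₀ e).cast rfl h.symm).symm := rfl

/-- The cocycle rule: in c b⁻¹ · b a⁻¹ the middle factors cancel. The opposite group makes the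
product read in path order. Working with pairs in a fibre avoids constructing deck transformations.
-/
theorem loopOf_mul (e e' e'' : E) (h : p e = p e') (h' : p e' = p e'') :
    loopOf hp e₀ e' e'' h' * loopOf hp e₀ e e' h = loopOf hp e₀ e e'' (h.trans h') := by
  apply MulOpposite.unop_injective
  rw [MulOpposite.unop_mul, FundamentalGroup.mul_def, unop_loopOf, unop_loopOf, unop_loopOf]
  generalize projectedClass hp e₀ e = a
  generalize projectedClass hp e₀ e' = b
  generalize projectedClass hp e₀ e'' = c
  revert a b c
  generalize p e = x at *
  generalize p e' = y at *
  generalize p e'' = z at *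
  subst h h'
  intro a b c
  simp only [Path.Homotopic.Quotient.cast_rfl_rfl]
  rw [Path.Homotopic.Quotient.trans_assoc, ← Path.Homotopic.Quotient.trans_assoc b.symm,
    Path.Homotopic.Quotient.symm_trans, Path.Homotopic.Quotient.refl_trans]

theorem loopOf_self (e : E) (h : p e = p e) : loopOf hp e₀ e e h = 1 := by
  have := loopOf_mul hp e₀ e e e h h
  simpa using this

theorem projectedClass_trans (e e' : E) (Γ : Path e e') :
    projectedClass hp e₀ e' = (projectedClass hp e₀ e).trans
      ((Path.Homotopic.Quotient.mk Γ).map ⟨p, hp.continuous⟩) := by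
  have h : Path.Homotopic.Quotient.mk (PathConnectedSpace.somePath e₀.1 e') =
      (Path.Homotopic.Quotient.mk (PathConnectedSpace.somePath e₀.1 e)).trans
        (Path.Homotopic.Quotient.mk Γ) := Subsingleton.elim _ _
  obtain ⟨e₀, rfl⟩ := e₀
  simp only [projectedClass, Path.Homotopic.Quotient.cast_rfl_rfl]
  rw [h, ← Path.Homotopic.Quotient.mk_trans, ← Path.Homotopic.Quotient.mk_map, Path.map_trans,
    Path.Homotopic.Quotient.mk_trans]
  rfl

/-- Moving both end points along paths with the same projection multiplies both projected classes on
the right by the same factor, which cancels in the quotient. -/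
theorem loopOf_eq_of_paths {e e' d d' : E} (h : p e = p d) (h' : p e' = p d')
    (Γ : Path e e') (Δ : Path d d') (hΓ : ∀ t, p (Γ t) = p (Δ t)) :
    loopOf hp e₀ e d h = loopOf hp e₀ e' d' h' := by
  apply MulOpposite.unop_injective
  rw [unop_loopOf, unop_loopOf, projectedClass_trans hp e₀ e e' Γ, projectedClass_trans hp e₀ d d' Δ]
  have hmap : ((Path.Homotopic.Quotient.mk Γ).map ⟨p, hp.continuous⟩) =
      ((Path.Homotopic.Quotient.mk Δ).map ⟨p, hp.continuous⟩).cast h h' := by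
    rw [← Path.Homotopic.Quotient.mk_map, ← Path.Homotopic.Quotient.mk_map,
      ← Path.Homotopic.Quotient.mk_cast]
    congr 1
    ext t
    exact hΓ t
  rw [hmap]
  clear hmap
  generalize projectedClass hp e₀ e = a
  generalize projectedClass hp e₀ d = b
  generalize (Path.Homotopic.Quotient.mk Δ).map ⟨p, hp.continuous⟩ = c
  revert a b c
  simp only [ContinuousMap.coe_mk]
  generalize p e = x at *
  generalize p e' = y at *
  generalize p d = z at *
  generalize p d' = w at *
  subst h h'
  intro a b c
  simp only [Path.Homotopic.Quotient.cast_rfl_rfl]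
  induction a using Path.Homotopic.Quotient.ind with | _ a
  induction b using Path.Homotopic.Quotient.ind with | _ b
  induction c using Path.Homotopic.Quotient.ind with | _ c
  have hs : ((Path.Homotopic.Quotient.mk a).trans (Path.Homotopic.Quotient.mk c)).symm =
      (Path.Homotopic.Quotient.mk c).symm.trans (Path.Homotopic.Quotient.mk a).symm := by
    rw [← Path.Homotopic.Quotient.mk_trans, ← Path.Homotopic.Quotient.mk_symm, Path.trans_symm,
      Path.Homotopic.Quotient.mk_trans, Path.Homotopic.Quotient.mk_symm,
      Path.Homotopic.Quotient.mk_symm]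
  rw [hs, Path.Homotopic.Quotient.trans_assoc, ← Path.Homotopic.Quotient.trans_assoc _ _
    (Path.Homotopic.Quotient.symm _), Path.Homotopic.Quotient.trans_symm,
    Path.Homotopic.Quotient.refl_trans]

theorem projectedClass_eq_map (e : E) (Γ : Path.Homotopic.Quotient e₀.1 e) :
    projectedClass hp e₀ e = (Γ.map ⟨p, hp.continuous⟩).cast e₀.2.symm rfl := by
  rw [Subsingleton.elim Γ]
  rfl

/-- The class of the deck transformation between two lifts of one map is constant along path
connected sets. -/
theorem loopOf_eq_of_continuousOn {Y : Type*} [TopologicalSpace Y] {U : Set Y}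
    (hU : IsPathConnected U) {f f' : Y → E} (hf : ContinuousOn f U) (hf' : ContinuousOn f' U)
    (h : ∀ y ∈ U, p (f y) = p (f' y)) {y y' : Y} (hy : y ∈ U) (hy' : y' ∈ U) :
    loopOf hp e₀ (f y) (f' y) (h y hy) = loopOf hp e₀ (f y') (f' y') (h y' hy') := by
  obtain ⟨γ, hγ⟩ := hU.joinedIn y hy y' hy'
  refine loopOf_eq_of_paths hp e₀ _ _
    (γ.map' (hf.mono (range_subset_iff.2 hγ))) (γ.map' (hf'.mono (range_subset_iff.2 hγ))) ?_
  intro t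
  exact h _ (hγ t)

/-- The projected class may be computed from any path in `E`, by simple connectedness. The lift of
`γ` itself leads from `e₀` to `e`, and the constant path from `e₀` to `e₀`. -/
theorem loopOf_monodromy (γ : LoopGroup S x₀) {e : E} (h : p e₀ = p e)
    (he : e = (hp.monodromy γ.unop.toPath e₀).1) : loopOf hp e₀ e₀ e h = γ := by
  have key : ∀ (x y : S) (g : Path.Homotopic.Quotient x₀ x₀) (hy : y = x₀)
      (hyx : y = x) (h3 : x₀ = x), ((g.cast h3.symm hy).cast h3 rfl).trans
      ((Path.Homotopic.Quotient.refl x).cast h3 hyx).symm = g := by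
    rintro x y g hy rfl rfl
    simp only [Path.Homotopic.Quotient.cast_rfl_rfl]
    exact Path.Homotopic.Quotient.trans_refl g
  subst he
  apply MulOpposite.unop_injective
  rw [unop_loopOf, projectedClass_eq_map hp e₀ _ (hp.liftPathQuotient γ.unop.toPath e₀),
    projectedClass_eq_map hp e₀ _ (Path.Homotopic.Quotient.refl _), hp.map_liftPathQuotient,
    Path.Homotopic.Quotient.cast_cast]
  exact key _ _ _ (hp.monodromy γ.unop.toPath e₀).2 h.symm e₀.2.symm

/-- The class between `e` and `φ e` is constant on the path connected space `E`, and at `e₀` it is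
`γ` by definition. -/
theorem loopOf_deckTransformation {γ : LoopGroup S x₀} {φ : E ≃ₜ E}
    (hφ : IsDeckTransformationOf hp e₀ γ φ) (e : E) :
    loopOf hp e₀ e (φ e) (hφ.1 e).symm = γ := by
  exact (loopOf_eq_of_continuousOn hp e₀ (U := univ) isPathConnected_univ continuousOn_id
      φ.continuous.continuousOn (fun y _ => (hφ.1 y).symm) (mem_univ e) (mem_univ e₀.1)).trans
    (loopOf_monodromy hp e₀ γ _ hφ.2)

/-- A locally homeomorphic map on the universal cover that is equivariant under a homomorphism
to the affine group is a developing map. -/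
theorem exists_isMonodromy (hs : Function.Surjective p) {dev : E → ℂ}
    (hdev : IsLocalHomeomorph dev) (ρ : LoopGroup S x₀ →* AffC)
    (heq : ∀ e e' (h : p e = p e'), dev e' = ρ (loopOf hp e₀ e e' h) (dev e)) :
    ∃ σ : ComplexAffineStructure S, IsMonodromy hp e₀ σ ρ := by
  choose d hd hde using hdev
  let u : E → OpenPartialHomeomorph S E := hp.isLocalHomeomorph.localInverseAt
  have hus : ∀ e, p e ∈ (u e).source := fun e =>
    hp.isLocalHomeomorph.apply_self_mem_localInverseAt_source
  have hue : ∀ e, u e (p e) = e := fun e => hp.isLocalHomeomorph.localInverseAt_apply_self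
  have hup : ∀ e s, s ∈ (u e).source → p (u e s) = s := fun e s h =>
    hp.isLocalHomeomorph.apply_localInverseAt_of_mem h
  have hsymm : ∀ e, ((u e).symm : E → S) = p := fun e =>
    hp.isLocalHomeomorph.localInverseAt_symm e
  -- The local inverses of `dev` serve as charts, so `E` inherits local path connectedness from the
  -- plane.
  have hlpc : LocallyPathConnectedSpace E := by
    let _ : ChartedSpace ℂ E :=
      { atlas := range d
        chartAt := d
        mem_chart_source := hd
        chart_mem_atlas := fun e => mem_range_self e }
    exact ChartedSpace.locallyPathConnectedSpace ℂ E
  let c : E → OpenPartialHomeomorph S ℂ := fun e => (u e).trans (d e)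
  have hcs : ∀ e, p e ∈ (c e).source := fun e => by
    simp only [c, OpenPartialHomeomorph.trans_source, mem_inter_iff, mem_preimage]
    exact ⟨hus e, by rw [hue]; exact hd e⟩
  have hceq : ∀ e s, c e s = dev (u e s) := fun e s => congrFun (hde e).symm (u e s)
  have hdev_symm : ∀ e, ∀ w ∈ (d e).target, dev ((d e).symm w) = w := fun e w hw => by
    have h := (d e).right_inv hw
    rwa [← hde] at h
  have haff : ∀ e e', IsLocallyAffineOn ((c e).symm.trans (c e'))
      ((c e).symm.trans (c e')).source := by
    intro e e' z hz
    simp only [OpenPartialHomeomorph.trans_source, OpenPartialHomeomorph.symm_source, mem_inter_iff,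
      mem_preimage] at hz
    obtain ⟨hz1, hz2⟩ := hz
    have hct : z ∈ (d e).target ∧ (d e).symm z ∈ (u e).target := by
      simpa only [c, OpenPartialHomeomorph.trans_target, mem_inter_iff, mem_preimage] using hz1
    have hcsymm : ∀ w, (c e).symm w = p ((d e).symm w) := fun w => by
      rw [← hsymm e]; rfl
    rw [hcsymm] at hz2
    have hN : p ⁻¹' (c e').source ∈ 𝓝 ((d e).symm z) :=
      hp.continuous.continuousAt.preimage_mem_nhds ((c e').open_source.mem_nhds hz2)
    -- Over a path connected neighbourhood `W` the identity and the section `u e'` of `p` differ by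
    -- a single class, so the transition map agrees near `z` with the image of this class under `ρ`.
    obtain ⟨W, ⟨hW, hWc⟩, hWN⟩ := (path_connected_basis ((d e).symm z)).mem_iff.1 hN
    have hcu : (c e').source ⊆ (u e').source := by
      simp only [c, OpenPartialHomeomorph.trans_source]; exact inter_subset_left
    have hcont : ContinuousOn (fun n => u e' (p n)) W :=
      (u e').continuousOn.comp hp.continuous.continuousOn fun n hn => hcu (hWN hn)
    have hcov : ∀ n ∈ W, p n = p (u e' (p n)) := fun n hn => (hup _ _ (hcu (hWN hn))).symm
    refine ⟨ρ (loopOf hp e₀ _ _ (hcov _ (mem_of_mem_nhds hW))), ?_⟩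
    have h1 : ∀ᶠ w in 𝓝 z, (d e).symm w ∈ W :=
      ((d e).continuousAt_symm hct.1).eventually hW
    apply Filter.Eventually.filter_mono nhdsWithin_le_nhds
    filter_upwards [h1, (d e).open_target.mem_nhds hct.1] with w hw hwt
    rw [OpenPartialHomeomorph.coe_trans, Function.comp_apply, hcsymm, hceq,
      heq _ _ (hcov _ hw), hdev_symm e w hwt]
    exact congrArg (fun γ => ρ γ w) (loopOf_eq_of_continuousOn hp e₀ hWc continuousOn_id hcont hcov
      hw (mem_of_mem_nhds hW))
  let C : ChartedSpace ℂ S :=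
    { atlas := range c
      chartAt := fun s => c (hs s).choose
      mem_chart_source := fun s => by
        have h := hcs (hs s).choose
        rwa [(hs s).choose_spec] at h
      chart_mem_atlas := fun s => mem_range_self _ }
  have hG : HasGroupoid S affineGroupoid := by
    constructor
    rintro _ _ ⟨e, rfl⟩ ⟨e', rfl⟩
    refine ⟨haff e e', ?_⟩
    have h := haff e' e
    have h1 : ((c e).symm.trans (c e')).symm = (c e').symm.trans (c e) := rfl
    rw [← h1] at h
    exact h
  refine ⟨⟨C, hG⟩, dev, fun e => ⟨c e, ?_, hcs e, ?_⟩, fun γ φ hφ e => ?_⟩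
  · exact StructureGroupoid.subset_maximalAtlas _ (mem_range_self e)
  · have h1 : (u e).target ∈ 𝓝 e := (u e).open_target.mem_nhds
      hp.isLocalHomeomorph.self_mem_localInverseAt_target
    filter_upwards [h1] with e' he'
    rw [hceq]
    have h2 := (u e).right_inv he'
    rw [hsymm] at h2
    rw [h2]
  · rw [heq e (φ e) (hφ.1 e).symm, loopOf_deckTransformation hp e₀ hφ]

/-- A partial developing map, defined on a set of points that meets every fibre, extends
equivariantly to the whole covering space. -/
theorem exists_equivariant_extension {X : Type*} {f : X → E}
    (hf : Function.Surjective (p ∘ f)) {F : X → ℂ} (ρ : LoopGroup S x₀ →* AffC)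
    (hF : ∀ x x' (h : p (f x) = p (f x')), F x' = ρ (loopOf hp e₀ _ _ h) (F x)) :
    ∃ dev : E → ℂ, (∀ e x (h : p (f x) = p e), dev e = ρ (loopOf hp e₀ _ _ h) (F x)) ∧
      ∀ e e' (h : p e = p e'), dev e' = ρ (loopOf hp e₀ e e' h) (dev e) := by
  choose r hr using hf
  -- Independence of the chosen point over the fibre: `hF` relates two choices, and the cocycle rule
  -- absorbs the difference.
  have key : ∀ e x (h : p (f x) = p e), ρ (loopOf hp e₀ _ _ (hr (p e))) (F (r (p e))) =
      ρ (loopOf hp e₀ _ _ h) (F x) := by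
    intro e x h
    have h1 : p (f x) = p (f (r (p e))) := h.trans (hr (p e)).symm
    rw [hF _ _ h1, ← loopOf_mul hp e₀ _ _ _ h1 (hr (p e)), map_mul]
    rfl
  refine ⟨fun e => ρ (loopOf hp e₀ _ _ (hr (p e))) (F (r (p e))), key, fun e e' h => ?_⟩
  beta_reduce
  rw [key e' (r (p e)) ((hr (p e)).trans h), ← loopOf_mul hp e₀ _ _ _ (hr (p e)) h, map_mul]
  rfl

end

/-! ### Paths of affine maps and the tab over an interval -/

section

open Complex

/-- A regular path of complex affine maps `z ↦ c s + a s * z` that starts and ends at prescribed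
maps and along which the origin moves fast in the direction `I`, as seen by the moving frame. -/
theorem exists_affine_path {a₀ : ℂ} (ha₀ : a₀ ≠ 0) (c₀ c₁ : ℂ) {R : ℝ} (hR : 0 ≤ R) :
    ∃ (a c κ : ℝ → ℂ) (β : ℝ → ℝ), Continuous κ ∧ Continuous β ∧
      (∀ s, HasDerivAt a (κ s * a s) s) ∧ (∀ s, HasDerivAt c (I * β s * a s) s) ∧
      (∀ s, a s ≠ 0) ∧ (∀ s ∈ Icc (0 : ℝ) 1, R * ‖κ s‖ ≤ β s) ∧
      a 0 = a₀ ∧ c 0 = c₀ ∧ a 1 = 1 ∧ c 1 = c₁ := by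
  obtain ⟨ℓ, rfl⟩ : ∃ ℓ, exp ℓ = a₀ := ⟨log a₀, exp_log ha₀⟩
  -- On `[0, 1/2]` only `τ` moves and the frame `a` makes one full turn at constant modulus; on
  -- `[1/2, 1]` only `σ` moves and takes `a` from `exp ℓ` to `1`.
  let σ : ℝ → ℝ := fun s => 1 - Real.smoothTransition (2 * s - 1)
  let τ : ℝ → ℝ := fun s => 1 - Real.smoothTransition (2 * s)
  have hST : ContDiff ℝ 1 Real.smoothTransition := Real.smoothTransition.contDiff
  have hσ : ContDiff ℝ 1 σ :=
    contDiff_const.sub (hST.comp ((contDiff_const.mul contDiff_id).sub contDiff_const))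
  have hτ : ContDiff ℝ 1 τ := contDiff_const.sub (hST.comp (contDiff_const.mul contDiff_id))
  have hσd : ∀ s, HasDerivAt σ (deriv σ s) s := fun s =>
    (hσ.differentiable one_ne_zero s).hasDerivAt
  have hτd : ∀ s, HasDerivAt τ (deriv τ s) s := fun s =>
    (hτ.differentiable one_ne_zero s).hasDerivAt
  have hσc : Continuous (deriv σ) := hσ.continuous_deriv le_rfl
  have hτc : Continuous (deriv τ) := hτ.continuous_deriv le_rfl
  have hτ0 : ∀ s, deriv τ s ≤ 0 := fun s => by
    have : Antitone τ := fun x y hxy =>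
      sub_le_sub_left (Real.smoothTransition.monotone (by linarith)) 1
    exact this.deriv_nonpos
  have hτ1 : ∀ s, s ≤ 1 / 2 → σ s = 1 := fun s hs => by
    simp only [σ]; rw [Real.smoothTransition.zero_of_nonpos (by linarith)]; simp
  have hτ2 : ∀ s, 1 / 2 < s → deriv τ s = 0 := fun s hs => by
    have : τ =ᶠ[𝓝 s] fun _ => 0 := by
      filter_upwards [lt_mem_nhds hs] with t ht
      simp only [τ]; rw [Real.smoothTransition.one_of_one_le (by linarith)]; simp
    rw [this.deriv_eq]; simp
  let κ : ℝ → ℂ := fun s => ℓ * ((deriv σ s : ℝ) : ℂ) + 2 * Real.pi * I * ((deriv τ s : ℝ) : ℂ)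
  have hκ : Continuous κ := by fun_prop
  let a : ℝ → ℂ := fun s => exp (ℓ * (σ s : ℂ) + 2 * Real.pi * I * (τ s : ℂ))
  have had : ∀ s, HasDerivAt a (κ s * a s) s := fun s => by
    have h := (((hσd s).ofReal_comp.const_mul ℓ).add
      ((hτd s).ofReal_comp.const_mul (2 * Real.pi * I : ℂ))).cexp
    exact h.congr_deriv (mul_comm _ _)
  have hac : Continuous a := continuous_iff_continuousAt.2 fun s => (had s).continuousAt
  obtain ⟨D, hD⟩ : ∃ D : ℝ, ∀ s ∈ Icc (0 : ℝ) 1, ‖κ s‖ ≤ D :=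
    isCompact_Icc.exists_bound_of_continuousOn hκ.continuousOn
  let J : ℝ → ℂ := fun s => ∫ t in (0 : ℝ)..s, a t
  have hJ : ∀ s, HasDerivAt J (a s) s := fun s =>
    intervalIntegral.integral_hasDerivAt_right (hac.intervalIntegrable _ _)
      (hac.stronglyMeasurableAtFilter _ _) hac.continuousAt
  -- The full turn contributes `I * exp ℓ * (w / 2)` to the displacement of `c`, the uniform drift
  -- contributes `I * R * D * J 1`; `w` makes them add up to `c₁ - c₀`. The speed `φ` below is a
  -- nonnegative trigonometric polynomial for which the integral of `φ u * exp (2πiu)` over a period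
  -- is `w / 2`, and `G` is the explicit antiderivative.
  let w : ℂ := 2 * exp (-ℓ) * (-I * (c₁ - c₀) - R * D * J 1)
  let G : ℝ → ℂ := fun u => ‖w‖ * exp (2 * Real.pi * I * u) / (2 * Real.pi * I) + w * u / 2 +
    (starRingEnd ℂ) w * exp (4 * Real.pi * I * u) / (8 * Real.pi * I)
  let φ : ℝ → ℝ := fun u => ‖w‖ + (w * exp (-(2 * Real.pi * I * u))).re
  have hφc : Continuous φ := by fun_prop
  have hφ0 : ∀ u, 0 ≤ φ u := fun u => by
    have h1 : ‖w * exp (-(2 * Real.pi * I * u))‖ = ‖w‖ := by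
      rw [norm_mul, Complex.norm_exp]; simp
    have h2 := (abs_le.1 (Complex.abs_re_le_norm (w * exp (-(2 * Real.pi * I * u))))).1
    simp only [φ]; linarith
  have hG : ∀ u, HasDerivAt G (φ u * exp (2 * Real.pi * I * u)) u := fun u => by
    have hu : HasDerivAt (fun u : ℝ => (u : ℂ)) 1 u := by
      simpa using (hasDerivAt_id u).ofReal_comp
    have h := ((((hu.const_mul (2 * Real.pi * I : ℂ)).cexp.const_mul (‖w‖ : ℂ)).div_const
      (2 * Real.pi * I)).add ((hu.const_mul w).div_const 2)).add
      (((hu.const_mul (4 * Real.pi * I : ℂ)).cexp.const_mul ((starRingEnd ℂ) w)).div_const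
        (8 * Real.pi * I))
    refine h.congr_deriv (Eq.symm ?_)
    have hre : ((w * exp (-(2 * Real.pi * I * u))).re : ℂ) =
        (w * exp (-(2 * Real.pi * I * u)) + (starRingEnd ℂ) w * exp (2 * Real.pi * I * u)) / 2 := by
      rw [Complex.re_eq_add_conj, map_mul, ← Complex.exp_conj]
      simp [Complex.conj_ofNat]
    have h1 : exp (-(2 * Real.pi * I * u)) * exp (2 * Real.pi * I * u) = 1 := by
      rw [← Complex.exp_add]; simp
    have h2 : exp (4 * Real.pi * I * u) = exp (2 * Real.pi * I * u) * exp (2 * Real.pi * I * u) := by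
      rw [← Complex.exp_add]; congr 1; ring
    rw [show φ u = ‖w‖ + (w * exp (-(2 * Real.pi * I * u))).re from rfl]
    push_cast
    rw [hre, h2]
    have hpi : (Real.pi : ℂ) ≠ 0 := by exact_mod_cast Real.pi_ne_zero
    have hI : I ≠ 0 := I_ne_zero
    field_simp
    linear_combination (8 * w) * h1
  -- The constant `R * D` dominates `R * ‖κ‖` on `[0, 1]`; the second term only adds to it, since
  -- `τ` is antitone and `φ` is nonnegative.
  let β : ℝ → ℝ := fun s => R * D + -deriv τ s * φ (τ s)
  let c : ℝ → ℂ := fun s => c₀ + I * R * D * J s + -(I * exp ℓ) * (G (τ s) - G (τ 0))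
  have hτs0 : τ 0 = 1 := by simp [τ]
  have hτs1 : τ 1 = 0 := by
    simp only [τ]; rw [Real.smoothTransition.one_of_one_le (by norm_num)]; simp
  have hσs0 : σ 0 = 1 := hτ1 0 (by norm_num)
  have hσs1 : σ 1 = 0 := by
    simp only [σ]; rw [Real.smoothTransition.one_of_one_le (by norm_num)]; simp
  refine ⟨a, c, κ, β, hκ, ?_, had, fun s => ?_, fun s => exp_ne_zero _, fun s hs => ?_, ?_, ?_, ?_,
    ?_⟩
  · have : Continuous τ := hτ.continuous
    fun_prop
  · have h := (((hJ s).const_mul (I * R * D)).const_add c₀).add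
      ((((hG (τ s)).scomp s (hτd s)).sub_const (G (τ 0))).const_mul (-(I * exp ℓ)))
    refine h.congr_deriv (Eq.symm ?_)
    rw [show β s = R * D + -deriv τ s * φ (τ s) from rfl, show a s = exp (ℓ * (σ s : ℂ) +
      2 * Real.pi * I * (τ s : ℂ)) from rfl]
    rcases le_or_gt s (1 / 2) with hs | hs
    · rw [hτ1 s hs, Complex.exp_add]
      simp only [Complex.real_smul]
      push_cast
      ring_nf
    · rw [hτ2 s hs]
      simp [mul_assoc]
  · have h1 := mul_le_mul_of_nonneg_left (hD s hs) hR
    have h2 := mul_nonneg (neg_nonneg.2 (hτ0 s)) (hφ0 (τ s))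
    simp only [β]
    linarith
  · simp only [a, hτs0, hσs0]
    push_cast
    rw [mul_one, mul_one, Complex.exp_add, Complex.exp_two_pi_mul_I, mul_one]
  · simp [c, J]
  · simp [a, hτs1, hσs1]
  · simp only [c, hτs0, hτs1, G, w]
    have h1 : exp (-ℓ) * exp ℓ = 1 := by rw [← Complex.exp_add]; simp
    have h2 : exp (2 * Real.pi * I * ((1 : ℝ) : ℂ)) = 1 := by simp
    have h4 : exp (4 * Real.pi * I * ((1 : ℝ) : ℂ)) = 1 := by
      rw [Complex.exp_eq_one_iff]; exact ⟨2, by push_cast; ring⟩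
    rw [h2, h4]
    simp only [ofReal_zero, mul_zero, Complex.exp_zero, ofReal_one]
    linear_combination (I * (-I * (c₁ - c₀) - R * D * J 1)) * h1 - (c₁ - c₀) * I_sq

theorem affine_apply (B : AffC) : ∃ a b : ℂ, a ≠ 0 ∧ ∀ z, B z = a * z + b := by
  have h : ∀ z, B z = B.linear 1 * z + B 0 := fun z => by
    have h1 := B.map_vadd 0 z
    have h2 : B.linear z = B.linear 1 * z := by
      have := B.linear.map_smul z 1
      simp only [smul_eq_mul, mul_one] at this
      rw [this, mul_comm]
    simp only [vadd_eq_add, add_zero] at h1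
    rw [h1, h2]
  refine ⟨_, _, ?_, h⟩
  intro h0
  exact one_ne_zero (B.linear.map_eq_zero_iff.1 h0)

/-- Up to the factor `a` the map is a rank-one perturbation of the identity, with determinant `1 + d
V > 0`. -/
theorem injective_of_transverse {V : ℂ} {a : ℂ} (ha : a ≠ 0) {d : ℂ →L[ℝ] ℝ} (hd : 0 ≤ d V)
    {L : ℂ →L[ℝ] ℂ} (hL : ∀ v, L v = a * (v + V * d v)) : Function.Injective L := by
  rw [injective_iff_map_eq_zero]
  intro v hv
  rw [hL] at hv
  have h1 : v + V * d v = 0 := (mul_eq_zero.1 hv).resolve_left ha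
  have h2 : v = -(d v) • V := by
    rw [Complex.real_smul]; push_cast; linear_combination h1
  have h3 : d v * (1 + d V) = 0 := by
    have h := congrArg d h2
    rw [map_smul, smul_eq_mul] at h
    linarith
  have h4 : d v = 0 := by
    rcases mul_eq_zero.1 h3 with h | h
    · exact h
    · linarith
  rw [h2, h4]; simp

/-- A map of the closed upper half plane that is the identity outside a small region above the
interval `(l, r)`, is a prescribed affine map near `(l, r)` and is locally homeomorphic in between. -/
theorem exists_tab {l r : ℝ} (hlr : l < r) (B : AffC) : ∃ F : ℂ → ℂ,
    (∀ z : ℂ, l < z.re → z.re < r → min (z.re - l) (r - z.re) ≤ z.im → F z = z) ∧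
    (∀ x : ℝ, l < x → x < r → ∀ᶠ z in 𝓝 (x : ℂ), F z = B z) ∧
    (∀ z : ℂ, l < z.re → z.re < r → 0 < z.im →
      ∃ L : ℂ →L[ℝ] ℂ, Function.Injective L ∧ HasStrictFDerivAt F L z) := by
  obtain ⟨a₀, b₀, ha₀, hB⟩ := affine_apply B
  set m : ℂ := (((l + r) / 2 : ℝ) : ℂ) with hm
  -- The part of the tab where the map varies lies within distance `r - l` of the midpoint `m`; the
  -- factor 2 in `R` leaves half of `β` to spare.
  obtain ⟨a, c, κ, β, hκ, hβ, ha, hc, ha0, hR, has, hcs, hae, hce⟩ :=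
    exists_affine_path ha₀ (B m) m (R := 2 * (r - l)) (by linarith)
  -- The height of the tab: a parabola that vanishes at the ends, lies below the distance to either
  -- end and has slope at most 1 in absolute value.
  let δ : ℝ → ℝ := fun x => (x - l) * (r - x) / (r - l)
  have hrl : 0 < r - l := by linarith
  have hδ : ∀ x, l < x → x < r → 0 < δ x := fun x h1 h2 =>
    div_pos (mul_pos (by linarith) (by linarith)) hrl
  have hδm : ∀ x, l < x → x < r → δ x ≤ min (x - l) (r - x) := fun x h1 h2 => by
    simp only [δ]
    rw [div_le_iff₀ hrl]
    rcases min_cases (x - l) (r - x) with ⟨h, _⟩ | ⟨h, _⟩ <;> rw [h] <;> nlinarith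
  -- The parameter `s` is 0 below height `δ / 3` and 1 above `2 * δ / 3`, so `F` is affine in a
  -- neighbourhood of the interval and the identity in a neighbourhood of the top of the tab.
  let g : ℂ → ℝ := fun z => 3 * (z.im / δ z.re) - 1
  let s : ℂ → ℝ := fun z => Real.smoothTransition (g z)
  let F : ℂ → ℂ := fun z => c (s z) + a (s z) * (z - m)
  have hF1 : ∀ z, s z = 1 → F z = z := fun z hz => by simp [F, hz, hae, hce]
  have hF0 : ∀ z, s z = 0 → F z = B z := fun z hz => by
    simp only [F, hz, has, hcs, hB]; ring
  have hδc : Continuous δ := by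
    have : r - l ≠ 0 := hrl.ne'
    fun_prop
  refine ⟨F, fun z h1 h2 h3 => hF1 z ?_, fun x h1 h2 => ?_, fun z h1 h2 h3 => ?_⟩
  · apply Real.smoothTransition.one_of_one_le
    have h4 : 1 ≤ z.im / δ z.re := by
      rw [le_div_iff₀ (hδ _ h1 h2), one_mul]; exact (hδm _ h1 h2).trans h3
    simp only [g]; linarith
  · have h3 : ∀ᶠ z : ℂ in 𝓝 (x : ℂ), 3 * z.im < δ z.re ∧ 0 < δ z.re := by
      have h4 : 3 * (x : ℂ).im < δ (x : ℂ).re := by simpa using hδ x h1 h2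
      have h5 : 0 < δ (x : ℂ).re := by simpa using hδ x h1 h2
      exact ((continuous_const.mul continuous_im).continuousAt.eventually_lt
        (hδc.comp continuous_re).continuousAt h4).and
        (continuousAt_const.eventually_lt (hδc.comp continuous_re).continuousAt h5)
    filter_upwards [h3] with z hz
    apply hF0
    apply Real.smoothTransition.zero_of_nonpos
    have : z.im / δ z.re < 1 / 3 := by rw [div_lt_iff₀ hz.2]; linarith [hz.1]
    simp only [g]; linarith
  · have hδ0 := hδ _ h1 h2
    rcases lt_or_ge z.im (δ z.re) with h4 | h4
    · have hg : ContDiffAt ℝ 1 g z := by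
        have h5 : ContDiffAt ℝ 1 (fun z : ℂ => z.re) z := reCLM.contDiff.contDiffAt
        have h6 : ContDiffAt ℝ 1 (fun z : ℂ => z.im) z := imCLM.contDiff.contDiffAt
        have h7 : ContDiffAt ℝ 1 (fun z : ℂ => δ z.re) z :=
          ((h5.sub contDiffAt_const).mul (contDiffAt_const.sub h5)).div_const _
        exact (contDiffAt_const.mul (h6.div h7 hδ0.ne')).sub contDiffAt_const
      have hs : ContDiffAt ℝ 1 s z := Real.smoothTransition.contDiffAt.comp z hg
      have hsd : HasStrictFDerivAt s (fderiv ℝ s z) z := hs.hasStrictFDerivAt one_ne_zero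
      have hcd : HasStrictDerivAt c (I * β (s z) * a (s z)) (s z) :=
        hasStrictDerivAt_of_hasDerivAt_of_continuousAt (Filter.Eventually.of_forall hc) (by
          have hac : Continuous a := continuous_iff_continuousAt.2 fun s => (ha s).continuousAt
          fun_prop)
      have had : HasStrictDerivAt a (κ (s z) * a (s z)) (s z) :=
        hasStrictDerivAt_of_hasDerivAt_of_continuousAt (Filter.Eventually.of_forall ha) (by
          have hac : Continuous a := continuous_iff_continuousAt.2 fun s => (ha s).continuousAt
          fun_prop)
      have hFd := (hcd.hasStrictFDerivAt.comp z hsd).add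
        ((had.hasStrictFDerivAt.comp z hsd).mul ((hasStrictFDerivAt_id (𝕜 := ℝ) z).sub_const m))
      -- By the equations for `a` and `c` the derivative of `F` is `a * (v + V * ds v)`, so it is
      -- enough that `s` does not decrease in the direction `V`.
      set V : ℂ := I * β (s z) + κ (s z) * (z - m) with hV
      refine ⟨_, injective_of_transverse (V := V) (ha0 (s z)) (d := fderiv ℝ s z) ?_ ?_, hFd⟩
      · have hδd : HasDerivAt δ ((l + r - 2 * z.re) / (r - l)) z.re := by
          have h := (((hasDerivAt_id z.re).sub_const l).mul
            ((hasDerivAt_id z.re).const_sub r)).div_const (r - l)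
          refine h.congr_deriv ?_
          simp only [id]; ring
        have hgd := (((imCLM.hasFDerivAt (x := z)).mul
          ((hasDerivAt_inv hδ0.ne').comp_hasFDerivAt z
            (hδd.comp_hasFDerivAt z (reCLM.hasFDerivAt (x := z))))).const_mul 3).sub_const 1
        have hsm : HasDerivAt Real.smoothTransition (deriv Real.smoothTransition (g z)) (g z) :=
          (Real.smoothTransition.contDiff.differentiable one_ne_zero _ ).hasDerivAt
        have hsd' : HasFDerivAt s _ z := hsm.comp_hasFDerivAt z hgd
        rw [hsd'.fderiv]
        have hST : 0 ≤ deriv Real.smoothTransition (g z) := Real.smoothTransition.monotone.deriv_nonneg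
        -- `V` points upwards within 45 degrees of the vertical. As `|δ'| ≤ 1` and `z.im ≤ δ`, the
        -- quotient `z.im / δ` does not decrease in such a direction.
        have hVim : |V.re| ≤ V.im := by
          have hs01 : s z ∈ Icc (0 : ℝ) 1 :=
            ⟨Real.smoothTransition.nonneg _, Real.smoothTransition.le_one _⟩
          have h5 : ‖z - m‖ ≤ r - l := by
            have h6 := Complex.norm_le_abs_re_add_abs_im (z - m)
            have h7 : |(z - m).re| ≤ (r - l) / 2 := by
              rw [hm, Complex.sub_re, Complex.ofReal_re, abs_le]; constructor <;> linarith
            have h8 : |(z - m).im| ≤ (r - l) / 2 := by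
              rw [hm, Complex.sub_im, Complex.ofReal_im, sub_zero, abs_of_pos h3]
              have h9 := hδm _ h1 h2
              have := min_le_left (z.re - l) (r - z.re)
              have := min_le_right (z.re - l) (r - z.re)
              linarith
            linarith
          have h6 : ‖κ (s z) * (z - m)‖ ≤ β (s z) / 2 := by
            rw [norm_mul]
            have := hR _ hs01
            nlinarith [norm_nonneg (κ (s z))]
          have h7 := (Complex.abs_re_le_norm (κ (s z) * (z - m))).trans h6
          have h8 := (Complex.abs_im_le_norm (κ (s z) * (z - m))).trans h6
          have h9 : V.re = (κ (s z) * (z - m)).re := by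
            rw [hV, Complex.add_re]; simp
          have h10 : V.im = β (s z) + (κ (s z) * (z - m)).im := by
            rw [hV, Complex.add_im]; simp
          rw [h9, h10]
          linarith [neg_abs_le (κ (s z) * (z - m)).im]
        have hδ' : |(l + r - 2 * z.re) / (r - l)| ≤ 1 := by
          rw [abs_div, abs_of_pos hrl, div_le_one hrl, abs_le]
          constructor <;> linarith
        generalize (l + r - 2 * z.re) / (r - l) = q at hδ'
        have hq : q * V.re ≤ V.im := by
          have h5 := le_abs_self (q * V.re)
          rw [abs_mul] at h5
          nlinarith [abs_nonneg V.re]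
        have hVim0 : 0 ≤ V.im := (abs_nonneg _).trans hVim
        have hyd : z.im * (δ z.re)⁻¹ ≤ 1 := by
          rw [← div_eq_mul_inv, div_le_one hδ0]; exact h4.le
        have hd0 : 0 < (δ z.re)⁻¹ := inv_pos.2 hδ0
        have hyd0 : 0 ≤ z.im * (δ z.re)⁻¹ := (mul_pos h3 hd0).le
        simp
        refine mul_le_mul_of_nonneg_left (mul_le_mul_of_nonneg_left ?_ (by norm_num)) hST
        have h6 : z.im * ((δ z.re ^ 2)⁻¹ * (q * V.re)) =
            (δ z.re)⁻¹ * ((z.im * (δ z.re)⁻¹) * (q * V.re)) := by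
          rw [pow_two, mul_inv]; ring
        rw [h6]
        refine mul_le_mul_of_nonneg_left ?_ hd0.le
        exact (mul_le_mul_of_nonneg_left hq hyd0).trans (mul_le_of_le_one_left hVim0 hyd)
      · intro v
        simp only [hV]
        simp
        ring
    · have h5 : ∀ᶠ z' in 𝓝 z, F z' = z' := by
        have h6 : ∀ᶠ z' : ℂ in 𝓝 z, 2 * δ z'.re < 3 * z'.im ∧ 0 < δ z'.re :=
          ((continuous_const.mul (hδc.comp continuous_re)).continuousAt.eventually_lt
            (continuous_const.mul continuous_im).continuousAt (by
              change 2 * δ z.re < 3 * z.im; linarith)).and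
            (continuousAt_const.eventually_lt (hδc.comp continuous_re).continuousAt hδ0)
        filter_upwards [h6] with z' hz'
        apply hF1
        apply Real.smoothTransition.one_of_one_le
        have : 2 / 3 < z'.im / δ z'.re := by rw [lt_div_iff₀ hz'.2]; linarith [hz'.1]
        simp only [g]; linarith
      exact ⟨ContinuousLinearMap.id ℝ ℂ, Function.injective_id,
        (hasStrictFDerivAt_id z).congr_of_eventuallyEq (h5.mono fun _ h => h.symm)⟩

end

/-! ### Immersions of the half plane with prescribed affine boundary germs -/

section

/-- The interval `(l, r)` is a bounded component of the complement of `Q`. -/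
def IsGap (Q : Set ℝ) (l r : ℝ) : Prop := l ∈ Q ∧ r ∈ Q ∧ l < r ∧ Disjoint Q (Ioo l r)

theorem exists_isGap {Q : Set ℝ} (hQ : Q.Finite) {x a b : ℝ} (ha : a ∈ Q) (hb : b ∈ Q)
    (hax : a < x) (hxb : x < b) (hx : x ∉ Q) : ∃ l r, IsGap Q l r ∧ x ∈ Ioo l r := by
  obtain ⟨l, ⟨hl, hlx⟩, hlm⟩ := exists_max_image (Q ∩ Iio x) id
    (hQ.subset inter_subset_left) ⟨a, ha, hax⟩
  obtain ⟨r, ⟨hr, hxr⟩, hrm⟩ := exists_min_image (Q ∩ Ioi x) id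
    (hQ.subset inter_subset_left) ⟨b, hb, hxb⟩
  rw [mem_Iio] at hlx
  rw [mem_Ioi] at hxr
  refine ⟨l, r, ⟨hl, hr, hlx.trans hxr, ?_⟩, hlx, hxr⟩
  rw [disjoint_left]
  rintro q hq ⟨h1, h2⟩
  rcases lt_trichotomy q x with h | h | h
  · exact absurd (hlm q ⟨hq, h⟩) (not_le.2 h1)
  · exact hx (h ▸ hq)
  · exact absurd (hrm q ⟨hq, h⟩) (not_le.2 h2)

theorem IsGap.unique {Q : Set ℝ} {l r l' r' x : ℝ} (h : IsGap Q l r) (h' : IsGap Q l' r')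
    (hx : x ∈ Ioo l r) (hx' : x ∈ Ioo l' r') : l = l' ∧ r = r' := by
  obtain ⟨hl, hr, -, hd⟩ := h
  obtain ⟨hl', hr', -, hd'⟩ := h'
  rw [disjoint_left] at hd hd'
  constructor
  · apply le_antisymm
    · by_contra! hlt
      exact hd' hl ⟨hlt, hx.1.trans hx'.2⟩
    · by_contra! hlt
      exact hd hl' ⟨hlt, hx'.1.trans hx.2⟩
  · apply le_antisymm
    · by_contra! hlt
      exact hd hr' ⟨hx.1.trans hx'.2, hlt⟩
    · by_contra! hlt
      exact hd' hr ⟨hx'.1.trans hx.2, hlt⟩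

/-- The inverse function theorem: an injective real-linear endomorphism of the plane is invertible.
-/
theorem HasStrictFDerivAt.exists_openPartialHomeomorph {F : ℂ → ℂ} {L : ℂ →L[ℝ] ℂ} {z : ℂ}
    (hL : Function.Injective L) (hF : HasStrictFDerivAt F L z) :
    ∃ e : OpenPartialHomeomorph ℂ ℂ, z ∈ e.source ∧ ∀ w, F w = e w := by
  let L' : ℂ ≃L[ℝ] ℂ := (LinearEquiv.ofInjectiveEndo L.toLinearMap hL).toContinuousLinearEquiv
  have hL' : (L' : ℂ →L[ℝ] ℂ) = L := by ext v; rfl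
  rw [← hL'] at hF
  exact ⟨hF.toOpenPartialHomeomorph F, hF.mem_toOpenPartialHomeomorph_source, fun w => rfl⟩

/-- There is a locally homeomorphic map of the open half plane to the plane that has prescribed
affine germs at all gaps of a finite set of boundary points. -/
theorem exists_immersion_halfPlane {Q : Set ℝ} (B : ℝ → AffC)
    (hB : ∀ l r, IsGap Q l r → ∀ x ∈ Ioo l r, ∀ y ∈ Ioo l r, B x = B y) (hQ : Q.Finite) :
    ∃ F : ℂ → ℂ, (∀ a ∈ Q, ∀ b ∈ Q, ∀ x ∈ Ioo a b, x ∉ Q → ∀ᶠ z in 𝓝 (x : ℂ), F z = B x z) ∧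
      ∀ a ∈ Q, ∀ b ∈ Q, ∀ z : ℂ, z.re ∈ Ioo a b → 0 < z.im →
        ∃ e : OpenPartialHomeomorph ℂ ℂ, z ∈ e.source ∧ ∀ᶠ w in 𝓝 z, F w = e w := by
  classical
  have hT : ∀ l r : ℝ, ∃ T : ℂ → ℂ, IsGap Q l r →
    (∀ z : ℂ, l < z.re → z.re < r → min (z.re - l) (r - z.re) ≤ z.im → T z = z) ∧
    (∀ x : ℝ, l < x → x < r → ∀ᶠ z in 𝓝 (x : ℂ), T z = B x z) ∧
    (∀ z : ℂ, l < z.re → z.re < r → 0 < z.im →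
      ∃ L : ℂ →L[ℝ] ℂ, Function.Injective L ∧ HasStrictFDerivAt T L z) := by
    intro l r
    by_cases hg : IsGap Q l r
    · obtain ⟨T, h1, h2, h3⟩ := exists_tab hg.2.2.1 (B ((l + r) / 2))
      refine ⟨T, fun _ => ⟨h1, fun x hlx hxr => ?_, h3⟩⟩
      have := hg.2.2.1
      rw [hB l r hg x ⟨hlx, hxr⟩ ((l + r) / 2) ⟨by linarith, by linarith⟩]
      exact h2 x hlx hxr
    · exact ⟨id, fun h => absurd h hg⟩
  choose T hT using hT
  let F : ℂ → ℂ := fun z =>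
    if h : ∃ lr : ℝ × ℝ, IsGap Q lr.1 lr.2 ∧ z.re ∈ Ioo lr.1 lr.2 then T h.choose.1 h.choose.2 z
    else z
  have hF : ∀ z : ℂ, ∀ l r, IsGap Q l r → z.re ∈ Ioo l r → F z = T l r z := by
    intro z l r hg hz
    have h : ∃ lr : ℝ × ℝ, IsGap Q lr.1 lr.2 ∧ z.re ∈ Ioo lr.1 lr.2 := ⟨(l, r), hg, hz⟩
    simp only [F]
    rw [dif_pos h]
    obtain ⟨h1, h2⟩ := h.choose_spec.1.unique hg h.choose_spec.2 hz
    rw [h1, h2]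
  have hFn : ∀ z : ℂ, ∀ l r, IsGap Q l r → z.re ∈ Ioo l r → ∀ᶠ w in 𝓝 z, F w = T l r w := by
    intro z l r hg hz
    filter_upwards [Complex.continuous_re.continuousAt.preimage_mem_nhds
      (isOpen_Ioo.mem_nhds hz)] with w hw
    exact hF w l r hg hw
  refine ⟨F, fun a ha b hb x hx hxQ => ?_, fun a ha b hb z hz hz0 => ?_⟩
  · obtain ⟨l, r, hg, hlr⟩ := exists_isGap hQ ha hb hx.1 hx.2 hxQ
    filter_upwards [hFn x l r hg (by simpa using hlr), (hT l r hg).2.1 x hlr.1 hlr.2] with w h1 h2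
    rw [h1, h2]
  · by_cases hzQ : z.re ∈ Q
    · refine ⟨OpenPartialHomeomorph.refl ℂ, mem_univ _, ?_⟩
      -- Over a cut the tabs on both sides stay below the lines of slope ±1 through the cut, so `F`
      -- is the identity in this cone.
      have h1 : ∀ᶠ w : ℂ in 𝓝 z, |w.re - z.re| < w.im := by
        refine ContinuousAt.eventually_lt (by fun_prop) (by fun_prop) (by simpa using hz0)
      filter_upwards [h1] with w hw
      change F w = w
      by_cases h : ∃ lr : ℝ × ℝ, IsGap Q lr.1 lr.2 ∧ w.re ∈ Ioo lr.1 lr.2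
      · obtain ⟨⟨l, r⟩, hg, hlr⟩ := h
        rw [hF w l r hg hlr]
        refine (hT l r hg).1 w hlr.1 hlr.2 ?_
        have hnz : z.re ∉ Ioo l r := disjoint_left.1 hg.2.2.2 hzQ
        rw [abs_lt] at hw
        by_contra! hlt
        rw [lt_min_iff] at hlt
        exact hnz ⟨by linarith, by linarith⟩
      · exact dif_neg h
    · obtain ⟨l, r, hg, hlr⟩ := exists_isGap hQ ha hb hz.1 hz.2 hzQ
      obtain ⟨L, hL, hTL⟩ := (hT l r hg).2.2 z hlr.1 hlr.2 hz0
      obtain ⟨e, he, hTe⟩ := HasStrictFDerivAt.exists_openPartialHomeomorph hL hTL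
      refine ⟨e, he, ?_⟩
      filter_upwards [hFn z l r hg hlr] with w hw
      rw [hw, hTe]

end

/-! ### The boundary of the polygon and the equivalence relation of the gluing -/

section

/-- The point at parameter `t` of the boundary of the disc, divided into `M` equal arcs. -/
def arc (M : ℕ) (t : ℝ) : UnitDisc :=
  ⟨Complex.exp ((2 * Real.pi * t / M : ℝ) * Complex.I), by
    rw [mem_closedBall_zero_iff, Complex.norm_exp_ofReal_mul_I]⟩

theorem boundaryPoint_eq_arc (g : ℕ) (t : ℝ) : boundaryPoint g t = arc (4 * g) t := by
  simp [boundaryPoint, arc]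

theorem norm_arc (M : ℕ) (t : ℝ) : ‖(arc M t : ℂ)‖ = 1 := Complex.norm_exp_ofReal_mul_I _

theorem arc_eq_arc_iff {M : ℕ} (hM : 0 < M) {t t' : ℝ} :
    arc M t = arc M t' ↔ ∃ k : ℤ, t = t' + k * M := by
  have hM' : (M : ℝ) ≠ 0 := by positivity
  have hpi := Real.pi_ne_zero
  rw [Subtype.ext_iff]
  simp only [arc]
  rw [Complex.exp_eq_exp_iff_exists_int]
  refine exists_congr fun k => ?_
  have h1 : (((2 * Real.pi * t' / M : ℝ) : ℂ) * Complex.I + k * (2 * Real.pi * Complex.I)) =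
      ((2 * Real.pi * (t' + k * M) / M : ℝ) : ℂ) * Complex.I := by
    have : (M : ℂ) ≠ 0 := by exact_mod_cast hM'
    push_cast; field_simp
  rw [h1, mul_left_inj' Complex.I_ne_zero, Complex.ofReal_inj]
  constructor
  · intro h
    field_simp at h
    linarith
  · intro h
    rw [h]

theorem exists_arc {M : ℕ} (hM : 0 < M) {z : UnitDisc} (hz : ‖(z : ℂ)‖ = 1) :
    ∃ t ∈ Ico (0 : ℝ) M, z = arc M t := by
  have hM' : (0 : ℝ) < M := by positivity
  obtain ⟨θ, hθ⟩ := (Complex.norm_eq_one_iff _).1 hz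
  have h1 : z = arc M (M * θ / (2 * Real.pi)) := by
    apply Subtype.ext
    rw [← hθ]
    simp only [arc]
    congr 3
    have := Real.pi_ne_zero
    field_simp
  have h2 := toIcoMod_mem_Ico hM' 0 (M * θ / (2 * Real.pi))
  refine ⟨toIcoMod hM' 0 (M * θ / (2 * Real.pi)), by simpa using h2, ?_⟩
  rw [h1, arc_eq_arc_iff hM]
  refine ⟨toIcoDiv hM' 0 (M * θ / (2 * Real.pi)), ?_⟩
  have := toIcoMod_add_toIcoDiv_zsmul hM' 0 (M * θ / (2 * Real.pi))
  rw [zsmul_eq_mul] at this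
  exact this.symm

theorem continuous_arc (M : ℕ) : Continuous (arc M) := by
  apply Continuous.subtype_mk
  fun_prop

/-- The vertices of the polygon with `M` sides. -/
def IsVertex (M : ℕ) (z : UnitDisc) : Prop := ∃ n : ℕ, z = arc M n

theorem isVertex_arc_iff {M : ℕ} (hM : 0 < M) {t : ℝ} :
    IsVertex M (arc M t) ↔ ∃ k : ℤ, t = k := by
  constructor
  · rintro ⟨n, hn⟩
    obtain ⟨k, hk⟩ := (arc_eq_arc_iff hM).1 hn
    exact ⟨n + k * M, by rw [hk]; push_cast; ring⟩
  · rintro ⟨k, rfl⟩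
    have hM' : (0 : ℤ) < M := by exact_mod_cast hM
    refine ⟨(k % M).toNat, (arc_eq_arc_iff hM).2 ⟨k / M, ?_⟩⟩
    have h1 : (((k % M).toNat : ℤ) : ℝ) = ((k % M : ℤ) : ℝ) := by
      rw [Int.toNat_of_nonneg (Int.emod_nonneg _ hM'.ne')]
    have h2 : ((k % M + M * (k / M) : ℤ) : ℝ) = k := by rw [Int.emod_add_mul_ediv]
    rw [← Int.cast_natCast, h1, ← h2]
    push_cast
    ring

/-- The space `X` is obtained from the polygon with `M` sides by gluing the side `n` with the side
`ν n` under reversal of the direction. If `V` holds, all vertices are identified. -/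
structure IsPolygonGluing {X : Type*} [TopologicalSpace X] (M : ℕ) (ν : ℕ → ℕ) (V : Prop)
    (q : UnitDisc → X) : Prop where
  pos : 0 < M
  isQuotientMap : IsQuotientMap q
  lt : ∀ n < M, ν n < M
  invol : ∀ n < M, ν (ν n) = n
  ne : ∀ n < M, ν n ≠ n
  eq_iff : ∀ z w, q z = q w ↔ z = w ∨
    (∃ n < M, ∃ t ∈ Icc (n : ℝ) (n + 1), z = arc M t ∧ w = arc M (n + ν n + 1 - t)) ∨
    (V ∧ IsVertex M z ∧ IsVertex M w)

/-- The sphere is a bigon. Complex conjugation on the circle is already an equivalence relation, and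
in arc parameters it is `t ↦ 2 - t`, that is `n + ν n + 1 - t` on either side. Its two vertices stay
distinct. -/
theorem isPolygonGluing_zero :
    IsPolygonGluing 2 (fun n => 1 - n) False (Quot.mk (SideGluing 0) : UnitDisc → ClosedSurface 0) where
  pos := two_pos
  isQuotientMap := isQuotientMap_quot_mk
  lt n hn := by lia
  invol n hn := by lia
  ne n hn := by lia
  eq_iff z w := by
    have hconj : ∀ t : ℝ, ∀ n < 2, (arc 2 (n + ((1 - n : ℕ) : ℝ) + 1 - t) : ℂ) =
        (starRingEnd ℂ) (arc 2 t) := by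
      intro t n hn
      have h1 : (n : ℝ) + ((1 - n : ℕ) : ℝ) + 1 - t = -t + (1 : ℤ) * (2 : ℕ) := by
        interval_cases n <;> norm_num <;> ring
      rw [(arc_eq_arc_iff two_pos).2 ⟨1, h1⟩]
      simp only [arc, ← Complex.exp_conj, map_mul, Complex.conj_I, Complex.conj_ofReal]
      congr 1
      push_cast
      ring
    let R : UnitDisc → UnitDisc → Prop := fun z w =>
      z = w ∨ ‖(z : ℂ)‖ = 1 ∧ (w : ℂ) = (starRingEnd ℂ) (z : ℂ)
    have hR : Equivalence R := by
      refine ⟨fun z => Or.inl rfl, ?_, ?_⟩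
      · rintro z w (rfl | ⟨h1, h2⟩)
        · exact Or.inl rfl
        · exact Or.inr ⟨by rw [h2, RCLike.norm_conj, h1], by rw [h2, Complex.conj_conj]⟩
      · rintro z w u (rfl | ⟨h1, h2⟩) (rfl | ⟨h3, h4⟩)
        · exact Or.inl rfl
        · exact Or.inr ⟨h3, h4⟩
        · exact Or.inr ⟨h1, h2⟩
        · left; apply Subtype.ext; rw [h4, h2, Complex.conj_conj]
    have h1 : (Quot.mk (SideGluing 0) z = Quot.mk (SideGluing 0) w) ↔ R z w := by
      constructor
      · intro h
        have h2 : ∀ z w, SideGluing 0 z w → R z w := by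
          rintro _ _ (⟨_, z, w, hz, hw⟩ | ⟨j, hj, _⟩)
          · exact Or.inr ⟨hz, hw⟩
          · exact absurd hj (Nat.not_lt_zero _)
        exact hR.eqvGen_iff.1 (Relation.EqvGen.mono h2 _ _ (Quot.eqvGen_exact h))
      · rintro (rfl | ⟨h1, h2⟩)
        · rfl
        · exact Quot.sound (SideGluing.sphere rfl z w h1 h2)
    refine h1.trans ?_
    constructor
    · rintro (rfl | ⟨h1, h2⟩)
      · exact Or.inl rfl
      · right; left
        obtain ⟨t, ht, rfl⟩ := exists_arc two_pos h1
        refine ⟨⌊t⌋₊, ?_, t, ⟨Nat.floor_le ht.1, (Nat.lt_floor_add_one t).le⟩, rfl, ?_⟩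
        · exact (Nat.floor_lt ht.1).2 ht.2
        · apply Subtype.ext
          rw [hconj t _ ((Nat.floor_lt ht.1).2 ht.2), h2]
    · rintro (rfl | ⟨n, hn, t, -, rfl, rfl⟩ | ⟨h, -⟩)
      · exact Or.inl rfl
      · exact Or.inr ⟨norm_arc _ _, hconj t n hn⟩
      · exact h.elim

/-- The side to which the side `n` of the standard polygon of positive genus is glued. -/
def partner (n : ℕ) : ℕ := if n % 4 < 2 then n + 2 else n - 2

theorem quot_handle {g j i : ℕ} (hj : j < g) (hi : i < 2) {s : ℝ} (hs : s ∈ Icc (0 : ℝ) 1) :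
    (Quot.mk (SideGluing g) (arc (4 * g) (4 * j + i + s)) : ClosedSurface g) =
      Quot.mk (SideGluing g) (arc (4 * g) (4 * j + i + 2 + (1 - s))) := by
  rw [← boundaryPoint_eq_arc, ← boundaryPoint_eq_arc]
  exact Quot.sound (SideGluing.handle j hj i hi s hs)

/-- The end points of the glued sides give the chain 4j, 4j+3, 4j+2, 4j+1, 4j+4 of identified
vertices, which links each handle to the next. -/
theorem quot_vertex {g : ℕ} (hg : 0 < g) {z : UnitDisc} (hz : IsVertex (4 * g) z) :
    (Quot.mk (SideGluing g) z : ClosedSurface g) = Quot.mk (SideGluing g) (arc (4 * g) 0) := by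
  have h0 : (0 : ℝ) ∈ Icc (0 : ℝ) 1 := ⟨le_rfl, zero_le_one⟩
  have h1 : (1 : ℝ) ∈ Icc (0 : ℝ) 1 := ⟨zero_le_one, le_rfl⟩
  let f : ℝ → ClosedSurface g := fun t => Quot.mk (SideGluing g) (arc (4 * g) t)
  have hf : ∀ j < g, ∀ i : ℕ, i < 2 → ∀ s ∈ Icc (0 : ℝ) 1, ∀ t t', t = 4 * j + i + s →
      t' = 4 * j + i + 2 + (1 - s) → f t = f t' := by
    rintro j hj i hi s hs _ _ rfl rfl
    exact quot_handle hj hi hs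
  have e1 : ∀ j < g, f (4 * j) = f (4 * j + 3) := fun j hj =>
    hf j hj 0 (by norm_num) 0 h0 _ _ (by push_cast; ring) (by push_cast; ring)
  have e2 : ∀ j < g, f (4 * j + 1) = f (4 * j + 2) := fun j hj =>
    hf j hj 0 (by norm_num) 1 h1 _ _ (by push_cast; ring) (by push_cast; ring)
  have e3 : ∀ j < g, f (4 * j + 1) = f (4 * j + 4) := fun j hj =>
    hf j hj 1 (by norm_num) 0 h0 _ _ (by push_cast; ring) (by push_cast; ring)
  have e4 : ∀ j < g, f (4 * j + 2) = f (4 * j + 3) := fun j hj =>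
    hf j hj 1 (by norm_num) 1 h1 _ _ (by push_cast; ring) (by push_cast; ring)
  have e0 : ∀ j ≤ g, f (4 * j) = f 0 := by
    intro j
    induction j with
    | zero => intro _; simp
    | succ j ih =>
      intro hj
      rw [← ih (by lia), e1 j hj, ← e4 j hj, ← e2 j hj, e3 j hj]
      congr 1; push_cast; ring
  obtain ⟨n, rfl⟩ := hz
  have hM : 0 < 4 * g := by lia
  have hmod : arc (4 * g) n = arc (4 * g) ((n % (4 * g) : ℕ) : ℝ) := by
    refine (arc_eq_arc_iff hM).2 ⟨((n / (4 * g) : ℕ) : ℤ), ?_⟩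
    have : ((n % (4 * g) + (4 * g) * (n / (4 * g)) : ℕ) : ℝ) = n := by rw [Nat.mod_add_div]
    rw [← this, Int.cast_natCast, Nat.cast_add, Nat.cast_mul (4 * g), mul_comm ((4 * g : ℕ) : ℝ)]
  rw [hmod]
  have hlt := Nat.mod_lt n hM
  generalize n % (4 * g) = m at hlt
  change f m = f 0
  obtain ⟨j, i, hi, rfl⟩ : ∃ j i, i < 4 ∧ m = 4 * j + i := ⟨m / 4, m % 4, by lia, by lia⟩
  have hj : j < g := by lia
  rw [← e0 j hj.le]
  interval_cases i
  · congr 1; push_cast; ring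
  · rw [e1 j hj, ← e4 j hj, ← e2 j hj]; congr 1; push_cast; ring
  · rw [e1 j hj, ← e4 j hj]; congr 1; push_cast; ring
  · rw [e1 j hj]; congr 1; push_cast; ring

theorem partner_lt {g n : ℕ} (hn : n < 4 * g) : partner n < 4 * g := by
  unfold partner; split_ifs <;> lia

theorem partner_partner (n : ℕ) : partner (partner n) = n := by
  unfold partner; split_ifs <;> lia

theorem partner_ne (n : ℕ) : partner n ≠ n := by
  unfold partner; split_ifs <;> lia

/-- The relation on the right is an equivalence relation that contains the generators and is
contained in the generated one, so it is the kernel of the quotient map. Only transitivity needs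
care. -/
theorem isPolygonGluing_pos {g : ℕ} (hg : 0 < g) :
    IsPolygonGluing (4 * g) partner True (Quot.mk (SideGluing g) : UnitDisc → ClosedSurface g) where
  pos := by lia
  isQuotientMap := isQuotientMap_quot_mk
  lt n hn := partner_lt hn
  invol n hn := partner_partner n
  ne n hn := partner_ne n
  eq_iff z w := by
    have hM : 0 < 4 * g := by lia
    let R : UnitDisc → UnitDisc → Prop := fun z w => z = w ∨
      (∃ n < 4 * g, ∃ t ∈ Icc (n : ℝ) (n + 1), z = arc (4 * g) t ∧
        w = arc (4 * g) (n + partner n + 1 - t)) ∨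
      (True ∧ IsVertex (4 * g) z ∧ IsVertex (4 * g) w)
    have hsymm : ∀ z w, R z w → R w z := by
      rintro z w (rfl | ⟨n, hn, t, ht, rfl, rfl⟩ | ⟨-, h1, h2⟩)
      · exact Or.inl rfl
      · refine Or.inr (Or.inl ⟨partner n, partner_lt hn, n + partner n + 1 - t, ⟨?_, ?_⟩, rfl, ?_⟩)
        · linarith [ht.2]
        · linarith [ht.1]
        · rw [partner_partner]; congr 1; ring
      · exact Or.inr (Or.inr ⟨trivial, h2, h1⟩)
    have hv : ∀ z w, R z w → IsVertex (4 * g) z → IsVertex (4 * g) w := by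
      rintro z w (rfl | ⟨n, hn, t, ht, rfl, rfl⟩ | ⟨-, h1, h2⟩) h
      · exact h
      · rw [isVertex_arc_iff hM] at h ⊢
        obtain ⟨k, rfl⟩ := h
        exact ⟨n + partner n + 1 - k, by push_cast; ring⟩
      · exact h2
    have hR : Equivalence R := by
      refine ⟨fun z => Or.inl rfl, fun h => hsymm _ _ h, ?_⟩
      intro z w u h h'
      by_cases hw : IsVertex (4 * g) w
      · exact Or.inr (Or.inr ⟨trivial, hv _ _ (hsymm _ _ h) hw, hv _ _ h' hw⟩)
      rcases h with rfl | ⟨n, hn, t, ht, rfl, rfl⟩ | ⟨-, h1, h2⟩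
      · exact h'
      · rcases h' with rfl | ⟨n', hn', t', ht', h3, rfl⟩ | ⟨-, h1, h2⟩
        · exact Or.inr (Or.inl ⟨n, hn, t, ht, rfl, rfl⟩)
        · left
          obtain ⟨k, hk⟩ := (arc_eq_arc_iff hM).1 h3
          rw [isVertex_arc_iff hM] at hw
          -- The middle point is not a vertex, so its parameter is not an integer and the floor
          -- determines its side. Hence the second identification is the inverse of the first.
          have hni : ∀ m : ℤ, (n : ℝ) + partner n + 1 - t ≠ m := fun m h => hw ⟨m, h⟩
          have hf1 : ⌊(n : ℝ) + partner n + 1 - t⌋ = partner n := by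
            rw [Int.floor_eq_iff]
            refine ⟨by push_cast; linarith [ht.2], lt_of_le_of_ne (by push_cast; linarith [ht.1]) ?_⟩
            have := hni (partner n + 1)
            exact_mod_cast this
          have hf2 : ⌊(n : ℝ) + partner n + 1 - t⌋ = n' + k * (4 * g : ℕ) := by
            rw [Int.floor_eq_iff]
            rw [hk]
            refine ⟨by push_cast; linarith [ht'.1], lt_of_le_of_ne (by push_cast; linarith [ht'.2]) ?_⟩
            have := hni (n' + k * (4 * g : ℕ) + 1)
            rw [hk] at this
            exact_mod_cast this
          have h5 : (partner n : ℤ) = n' + k * (4 * g : ℕ) := hf1.symm.trans hf2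
          have h6 := partner_lt hn
          have hk0 : k = 0 := by
            have h7 : k * (4 * g : ℕ) < 1 * (4 * g : ℕ) := by lia
            have h8 : -1 * (4 * g : ℕ) < k * (4 * g : ℕ) := by lia
            have h9 : (0 : ℤ) < (4 * g : ℕ) := by exact_mod_cast hM
            have h10 := lt_of_mul_lt_mul_right h7 h9.le
            have h11 := lt_of_mul_lt_mul_right h8 h9.le
            lia
          subst hk0
          have h12 : n' = partner n := by lia
          subst h12
          congr 1
          rw [partner_partner]
          simp at hk
          linarith
        · exact absurd h1 hw
      · exact absurd h2 hw
    have hquot : ∀ n < 4 * g, ∀ t ∈ Icc (n : ℝ) (n + 1),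
        (Quot.mk (SideGluing g) (arc (4 * g) t) : ClosedSurface g) =
          Quot.mk (SideGluing g) (arc (4 * g) (n + partner n + 1 - t)) := by
      intro n hn t ht
      by_cases h : n % 4 < 2
      · have h1 := quot_handle (g := g) (j := n / 4) (i := n % 4) (by lia) h
          (s := t - n) ⟨by linarith [ht.1], by linarith [ht.2]⟩
        have h2 : (n : ℝ) = 4 * (n / 4 : ℕ) + (n % 4 : ℕ) := by
          have : n = 4 * (n / 4) + n % 4 := by lia
          exact_mod_cast this
        have h3 : (partner n : ℝ) = n + 2 := by unfold partner; rw [if_pos h]; push_cast; ring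
        rw [h3]
        convert h1 using 3
        · linarith
        · linarith
      · have h1 := quot_handle (g := g) (j := n / 4) (i := n % 4 - 2) (by lia) (by lia)
          (s := n + 1 - t) ⟨by linarith [ht.2], by linarith [ht.1]⟩
        have h2 : (n : ℝ) = 4 * (n / 4 : ℕ) + (n % 4 - 2 : ℕ) + 2 := by
          have : n = 4 * (n / 4) + (n % 4 - 2) + 2 := by lia
          exact_mod_cast this
        have h3 : (partner n : ℝ) = n - 2 := by
          unfold partner; rw [if_neg h]
          have : 2 ≤ n := by lia
          push_cast [Nat.cast_sub this]; ring
        rw [h3]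
        symm
        convert h1 using 3
        · linarith
        · linarith
    constructor
    · intro h
      have h2 : ∀ z w, SideGluing g z w → R z w := by
        rintro _ _ (⟨h, _⟩ | ⟨j, hj, i, hi, s, hs⟩)
        · exact absurd h hg.ne'
        · refine Or.inr (Or.inl ⟨4 * j + i, by lia, 4 * j + i + s, ⟨?_, ?_⟩,
            boundaryPoint_eq_arc _ _, ?_⟩)
          · push_cast; linarith [hs.1]
          · push_cast; linarith [hs.2]
          · rw [boundaryPoint_eq_arc]
            have h3 : partner (4 * j + i) = 4 * j + i + 2 := by
              unfold partner; rw [if_pos (by lia)]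
            rw [h3]
            congr 1
            push_cast; ring
      exact hR.eqvGen_iff.1 (Relation.EqvGen.mono h2 _ _ (Quot.eqvGen_exact h))
    · rintro (rfl | ⟨n, hn, t, ht, rfl, rfl⟩ | ⟨-, h1, h2⟩)
      · rfl
      · exact hquot n hn t ht
      · rw [quot_vertex hg h1, quot_vertex hg h2]

end

/-! ### Disc charts and homeomorphisms that move finite sets -/

section

/-- A continuous map from a compact set to a Hausdorff space is closed, hence a quotient map onto
its image. -/
theorem IsCompact.continuousOn_image {A X Y : Type*} [TopologicalSpace A] [TopologicalSpace X]
    [TopologicalSpace Y] [T2Space X] {K : Set A} (hK : IsCompact K) {V : A → X}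
    (hV : ContinuousOn V K) {f : X → Y} (hf : ContinuousOn (f ∘ V) K) : ContinuousOn f (V '' K) := by
  rw [continuousOn_iff_isClosed]
  intro t ht
  obtain ⟨u, hu, hut⟩ := continuousOn_iff_isClosed.1 hf t ht
  refine ⟨V '' (K ∩ u), ((hK.inter_right hu).image_of_continuousOn
    (hV.mono inter_subset_left)).isClosed, ?_⟩
  ext x
  constructor
  · rintro ⟨h1, a, ha, rfl⟩
    have : a ∈ f ∘ V ⁻¹' t ∩ K := ⟨h1, ha⟩
    rw [hut] at this
    exact ⟨⟨a, ⟨ha, this.1⟩, rfl⟩, a, ha, rfl⟩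
  · rintro ⟨⟨a, ⟨ha, hau⟩, rfl⟩, h⟩
    have : a ∈ u ∩ K := ⟨hau, ha⟩
    rw [← hut] at this
    exact ⟨this.1, h⟩

/-- The map `V` restricts to an embedding of the closed unit disc whose restriction to the open
unit disc is an open embedding. -/
structure IsDiscChart {X : Type*} [TopologicalSpace X] (V : ℂ → X) : Prop where
  continuousOn : ContinuousOn V (Metric.closedBall 0 1)
  injOn : InjOn V (Metric.closedBall 0 1)
  isOpen : IsOpen (V '' Metric.ball 0 1)

variable {X : Type*} [TopologicalSpace X]

/-- The image of `W` is the open image of the open disc minus the image of the compact set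
complementary to `W`. -/
theorem IsDiscChart.isOpen_image [T2Space X] {V : ℂ → X} (hV : IsDiscChart V) {W : Set ℂ}
    (hW : IsOpen W) (hWb : W ⊆ Metric.ball 0 1) : IsOpen (V '' W) := by
  have h1 : V '' W = V '' Metric.ball 0 1 ∩ (V '' (Metric.closedBall 0 1 \ W))ᶜ := by
    ext x
    constructor
    · rintro ⟨a, ha, rfl⟩
      refine ⟨⟨a, hWb ha, rfl⟩, ?_⟩
      rintro ⟨b, ⟨hb, hbW⟩, hab⟩
      exact hbW (hV.injOn hb (Metric.ball_subset_closedBall (hWb ha)) hab ▸ ha)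
    · rintro ⟨⟨a, ha, rfl⟩, h⟩
      by_contra h'
      exact h ⟨a, ⟨Metric.ball_subset_closedBall ha, fun haW => h' ⟨a, haW, rfl⟩⟩, rfl⟩
  rw [h1]
  refine hV.isOpen.inter (IsCompact.isClosed ?_).isOpen_compl
  exact ((isCompact_closedBall 0 1).diff hW).image_of_continuousOn
    (hV.continuousOn.mono sdiff_subset)

theorem IsDiscChart.exists_subset [T2Space X] {V : ℂ → X} (hV : IsDiscChart V) {U : Set X}
    (hU : IsOpen U) (h0 : V 0 ∈ U) : ∃ V' : ℂ → X, IsDiscChart V' ∧ V' 0 = V 0 ∧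
      V' '' Metric.closedBall 0 1 ⊆ U := by
  have h1 : ∀ᶠ z in 𝓝 (0 : ℂ), V z ∈ U :=
    (hV.continuousOn.continuousAt (Metric.closedBall_mem_nhds 0 one_pos)).preimage_mem_nhds
      (hU.mem_nhds h0)
  obtain ⟨ε, hε, h2⟩ := Metric.eventually_nhds_iff_ball.1 h1
  obtain ⟨r, hr0, hrε, hr1⟩ : ∃ r : ℝ, 0 < r ∧ r < ε ∧ r < 1 :=
    ⟨min ε 1 / 2, by positivity, by linarith [min_le_left ε 1], by linarith [min_le_right ε 1]⟩
  have hmem : ∀ z : ℂ, z ∈ Metric.closedBall (0 : ℂ) 1 → ‖(r : ℂ) * z‖ ≤ r := by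
    intro z hz
    rw [mem_closedBall_zero_iff] at hz
    rw [norm_mul, Complex.norm_of_nonneg hr0.le]
    nlinarith
  have hmaps : MapsTo (fun z : ℂ => (r : ℂ) * z) (Metric.closedBall 0 1) (Metric.closedBall 0 1) :=
    fun z hz => by rw [mem_closedBall_zero_iff]; exact (hmem z hz).trans hr1.le
  have hrC : (r : ℂ) ≠ 0 := by exact_mod_cast hr0.ne'
  refine ⟨fun z => V (r * z), ⟨?_, ?_, ?_⟩, by simp, ?_⟩
  · exact hV.continuousOn.comp (by fun_prop) hmaps
  · intro z hz w hw h
    exact mul_left_cancel₀ hrC (hV.injOn (hmaps hz) (hmaps hw) h)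
  · have h3 : (fun z : ℂ => V (r * z)) '' Metric.ball 0 1 = V '' Metric.ball 0 r := by
      ext x
      constructor
      · rintro ⟨z, hz, rfl⟩
        refine ⟨r * z, ?_, rfl⟩
        rw [mem_ball_zero_iff] at hz ⊢
        rw [norm_mul, Complex.norm_of_nonneg hr0.le]
        nlinarith
      · rintro ⟨z, hz, rfl⟩
        refine ⟨z / r, ?_, by simp only; rw [mul_div_cancel₀ _ hrC]⟩
        rw [mem_ball_zero_iff] at hz ⊢
        rw [norm_div, Complex.norm_of_nonneg hr0.le, div_lt_one hr0]
        exact hz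
    rw [h3]
    exact hV.isOpen_image Metric.isOpen_ball (Metric.ball_subset_ball hr1.le)
  · rintro _ ⟨z, hz, rfl⟩
    apply h2
    rw [mem_ball_zero_iff]
    exact (hmem z hz).trans_lt hrε

/-- A homeomorphism of the plane that is the identity outside the unit disc and moves the origin to
a given point of the disc. -/
theorem exists_homeomorph_disc {b : ℂ} (hb : ‖b‖ < 1) :
    ∃ h : ℂ ≃ₜ ℂ, h 0 = b ∧ (∀ z, 1 ≤ ‖z‖ → h z = z) := by
  let f : ℂ → ℂ := fun z => z + (max (1 - ‖z‖) 0 : ℝ) * b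
  -- The perturbation of the identity is Lipschitz with constant `‖b‖ < 1`, which makes `f` a
  -- homeomorphism.
  have hf : ApproximatesLinearOn f ((ContinuousLinearEquiv.refl ℝ ℂ : ℂ ≃L[ℝ] ℂ) : ℂ →L[ℝ] ℂ) univ
      ‖b‖₊ := by
    intro x _ y _
    have h1 : f x - f y - ((ContinuousLinearEquiv.refl ℝ ℂ : ℂ ≃L[ℝ] ℂ) : ℂ →L[ℝ] ℂ) (x - y) =
        ((max (1 - ‖x‖) 0 - max (1 - ‖y‖) 0 : ℝ) : ℂ) * b := by
      simp [f]; ring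
    rw [h1, norm_mul, Complex.norm_real, mul_comm, coe_nnnorm]
    refine mul_le_mul_of_nonneg_left ?_ (norm_nonneg _)
    have h2 := abs_max_sub_max_le_abs (1 - ‖x‖) (1 - ‖y‖) 0
    rw [Real.norm_eq_abs]
    refine h2.trans ?_
    have h3 : 1 - ‖x‖ - (1 - ‖y‖) = ‖y‖ - ‖x‖ := by ring
    rw [h3, norm_sub_rev]
    exact abs_norm_sub_norm_le y x
  refine ⟨hf.toHomeomorph f (Or.inr ?_), ?_, fun z hz => ?_⟩
  · have h2 : ‖(((ContinuousLinearEquiv.refl ℝ ℂ).symm : ℂ ≃L[ℝ] ℂ) : ℂ →L[ℝ] ℂ)‖₊ = 1 := by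
      have : ‖ContinuousLinearMap.id ℝ ℂ‖₊ = 1 := by
        rw [← NNReal.coe_inj]; simp
      exact this
    rw [h2, inv_one]
    exact_mod_cast hb
  · change f 0 = b
    simp [f]
  · change f z = z
    simp only [f]
    rw [max_eq_right (by linarith)]
    simp

open Classical in
/-- The self-map of `X` that is given by `h` in a disc chart and is the identity elsewhere. -/
def discExtend (V : ℂ → X) (h : ℂ → ℂ) (x : X) : X :=
  if x ∈ V '' Metric.ball 0 1 then V (h (Function.invFunOn V (Metric.closedBall 0 1) x)) else x

theorem IsDiscChart.discExtend_apply {V : ℂ → X} (hV : IsDiscChart V) {h : ℂ → ℂ}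
    (hh : ∀ z, 1 ≤ ‖z‖ → h z = z) {z : ℂ} (hz : z ∈ Metric.closedBall (0 : ℂ) 1) :
    discExtend V h (V z) = V (h z) := by
  unfold discExtend
  split_ifs with hc
  · rw [hV.injOn.leftInvOn_invFunOn hz]
  · rw [hh]
    by_contra! hlt
    exact hc ⟨z, by rwa [mem_ball_zero_iff], rfl⟩

theorem discExtend_of_notMem {X : Type*} {V : ℂ → X} {h : ℂ → ℂ} {x : X} (hx : x ∉ V '' Metric.ball 0 1) :
    discExtend V h x = x := if_neg hx

theorem IsDiscChart.continuous_discExtend [T2Space X] {V : ℂ → X} (hV : IsDiscChart V) {h : ℂ → ℂ}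
    (hc : Continuous h) (hm : MapsTo h (Metric.closedBall 0 1) (Metric.closedBall 0 1))
    (hh : ∀ z, 1 ≤ ‖z‖ → h z = z) : Continuous (discExtend V h) := by
  have h1 : ContinuousOn (discExtend V h) (V '' Metric.closedBall 0 1) := by
    refine (isCompact_closedBall 0 1).continuousOn_image hV.continuousOn ?_
    refine (hV.continuousOn.comp hc.continuousOn hm).congr fun z hz => ?_
    exact hV.discExtend_apply hh hz
  have h2 : ContinuousOn (discExtend V h) (V '' Metric.ball 0 1)ᶜ :=
    continuousOn_id.congr fun x hx => discExtend_of_notMem hx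
  rw [← continuousOn_univ]
  have h3 : (univ : Set X) = V '' Metric.closedBall 0 1 ∪ (V '' Metric.ball 0 1)ᶜ := by
    refine (eq_univ_of_forall fun x => ?_).symm
    by_cases hx : x ∈ V '' Metric.ball 0 1
    · exact Or.inl (image_mono Metric.ball_subset_closedBall hx)
    · exact Or.inr hx
  rw [h3]
  exact h1.union_of_isClosed h2
    ((isCompact_closedBall 0 1).image_of_continuousOn hV.continuousOn).isClosed
    hV.isOpen.isClosed_compl

theorem IsDiscChart.exists_homeomorph [T2Space X] {V : ℂ → X} (hV : IsDiscChart V) {b : ℂ}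
    (hb : b ∈ Metric.ball (0 : ℂ) 1) :
    ∃ H : X ≃ₜ X, H (V 0) = V b ∧ ∀ x, x ∉ V '' Metric.ball 0 1 → H x = x := by
  obtain ⟨h, h0, h1⟩ := exists_homeomorph_disc (mem_ball_zero_iff.1 hb)
  have h1' : ∀ z, 1 ≤ ‖z‖ → h.symm z = z := fun z hz => by
    rw [Homeomorph.symm_apply_eq, h1 z hz]
  have hm : ∀ k : ℂ ≃ₜ ℂ, (∀ z, 1 ≤ ‖z‖ → k z = z) →
      MapsTo k (Metric.closedBall 0 1) (Metric.closedBall 0 1) := by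
    intro k hk z hz
    rw [mem_closedBall_zero_iff] at hz ⊢
    by_contra! hlt
    have h2 := hk _ hlt.le
    have h3 := k.injective h2
    rw [h3] at hlt
    linarith
  have hinv : ∀ k l : ℂ ≃ₜ ℂ, (∀ z, 1 ≤ ‖z‖ → k z = z) → (∀ z, 1 ≤ ‖z‖ → l z = z) →
      (∀ z, l (k z) = z) → Function.LeftInverse (discExtend V l) (discExtend V k) := by
    intro k l hk hl hlk x
    by_cases hx : x ∈ V '' Metric.ball 0 1
    · obtain ⟨z, hz, rfl⟩ := hx
      have hz' := Metric.ball_subset_closedBall hz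
      rw [hV.discExtend_apply hk hz', hV.discExtend_apply hl (hm k hk hz'), hlk]
    · rw [discExtend_of_notMem hx, discExtend_of_notMem hx]
  refine ⟨⟨⟨discExtend V h, discExtend V h.symm, hinv h h.symm h1 h1' h.symm_apply_apply,
    hinv h.symm h h1' h1 h.apply_symm_apply⟩, hV.continuous_discExtend h.continuous (hm h h1) h1,
    hV.continuous_discExtend h.symm.continuous (hm h.symm h1') h1'⟩, ?_,
    fun x hx => discExtend_of_notMem hx⟩
  change discExtend V h (V 0) = V b
  rw [hV.discExtend_apply h1 (by simp), h0]

/-- The relation of being exchanged by a homeomorphism that fixes `F` is symmetric and transitive,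
and it holds locally by moving points inside a disc chart that avoids `F`. The complement of `F` is
connected, so it holds everywhere there. -/
theorem exists_homeomorph_point [T2Space X] (hch : ∀ x : X, ∃ V, IsDiscChart V ∧ V 0 = x)
    (hconn : ∀ F : Set X, F.Finite → IsPreconnected Fᶜ) {F : Set X} (hF : F.Finite) {x y : X}
    (hx : x ∉ F) (hy : y ∉ F) : ∃ H : X ≃ₜ X, H x = y ∧ ∀ f ∈ F, H f = f := by
  refine (hconn F hF).induction₂ (fun x y => ∃ H : X ≃ₜ X, H x = y ∧ ∀ f ∈ F, H f = f) ?_ ?_ ?_ hx hy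
  · intro x hx
    obtain ⟨V, hV, rfl⟩ := hch x
    obtain ⟨V', hV', h0, hsub⟩ := hV.exists_subset hF.isClosed.isOpen_compl hx
    apply Filter.Eventually.filter_mono nhdsWithin_le_nhds
    have h1 : V' '' Metric.ball 0 1 ∈ 𝓝 (V 0) :=
      hV'.isOpen.mem_nhds ⟨0, by simp, h0⟩
    filter_upwards [h1] with y hy
    obtain ⟨b, hb, rfl⟩ := hy
    obtain ⟨H, hH0, hH⟩ := hV'.exists_homeomorph hb
    refine ⟨H, by rw [← h0, hH0], fun f hf => hH f fun h => ?_⟩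
    exact hsub (image_mono Metric.ball_subset_closedBall h) hf
  · rintro x y z - - - ⟨H, rfl, hH⟩ ⟨K, rfl, hK⟩
    exact ⟨H.trans K, rfl, fun f hf => by rw [Homeomorph.trans_apply, hH f hf, hK f hf]⟩
  · rintro x y - - ⟨H, rfl, hH⟩
    exact ⟨H.symm, by simp, fun f hf => by rw [Homeomorph.symm_apply_eq, hH f hf]⟩

/-- Finite sets of the same size are related by a homeomorphism of the surface. -/
theorem exists_homeomorph_image_finite [T2Space X] (hch : ∀ x : X, ∃ V, IsDiscChart V ∧ V 0 = x)
    (hconn : ∀ F : Set X, F.Finite → IsPreconnected Fᶜ) {A B : Set X} (hA : A.Finite)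
    (hAB : A.encard = B.encard) : ∃ H : X ≃ₜ X, H '' A = B := by
  induction A, hA using Set.Finite.induction_on generalizing B with
  | empty =>
    rw [encard_empty] at hAB
    rw [Set.encard_eq_zero.1 hAB.symm]
    exact ⟨Homeomorph.refl X, by simp⟩
  | @insert a A ha hA ih =>
    rw [encard_insert_of_notMem ha] at hAB
    have hBne : B.Nonempty := by
      rw [← Set.encard_pos, ← hAB]; simp
    obtain ⟨b, hb⟩ := hBne
    have h1 : A.encard = (B \ {b}).encard := by
      have := Set.encard_sdiff_singleton_add_one hb
      rw [← hAB] at this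
      exact (ENat.add_left_injective_of_ne_top (by simp) this).symm
    obtain ⟨H, hH⟩ := ih h1
    have hfin : (B \ {b}).Finite := by rw [← hH]; exact hA.image _
    have hHa : H a ∉ B \ {b} := by
      rw [← hH]
      rintro ⟨a', ha', h⟩
      exact ha (H.injective h ▸ ha')
    -- The points already placed are kept fixed while the image of `a` is moved to `b`.
    obtain ⟨K, hK, hKf⟩ := exists_homeomorph_point hch hconn hfin hHa (y := b) (by simp)
    refine ⟨H.trans K, ?_⟩
    change (K ∘ H) '' _ = _
    rw [image_comp, image_insert_eq, hH, image_insert_eq, hK]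
    have : K '' (B \ {b}) = B \ {b} := by
      ext x
      constructor
      · rintro ⟨y, hy, rfl⟩
        rwa [hKf y hy]
      · intro hx
        exact ⟨x, hx, hKf x hx⟩
    rw [this, insert_sdiff_singleton, insert_eq_of_mem hb]

end

/-! ### Separation and connectedness of the glued surface; cones over cycles of half discs -/

section

variable {X : Type*} [TopologicalSpace X] {M : ℕ} {ν : ℕ → ℕ} {V : Prop} {q : UnitDisc → X}

instance : CompactSpace UnitDisc := isCompact_iff_compactSpace.1 (isCompact_closedBall (0 : ℂ) 1)

theorem IsVertex.exists_lt (hM : 0 < M) {z : UnitDisc} (hz : IsVertex M z) :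
    ∃ n < M, z = arc M n := by
  obtain ⟨n, rfl⟩ := hz
  refine ⟨n % M, Nat.mod_lt n hM, (arc_eq_arc_iff hM).2 ⟨(n / M : ℕ), ?_⟩⟩
  have : ((n % M + M * (n / M) : ℕ) : ℝ) = n := by rw [Nat.mod_add_div]
  rw [← this, Int.cast_natCast, Nat.cast_add, Nat.cast_mul M]
  ring

theorem finite_isVertex (hM : 0 < M) : {z | IsVertex M z}.Finite := by
  refine ((Set.finite_Iio M).image fun n : ℕ => arc M n).subset ?_
  intro z hz
  obtain ⟨n, hn, rfl⟩ := IsVertex.exists_lt hM hz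
  exact ⟨n, hn, rfl⟩

/-- The saturation of a closed set adds only finitely many reflected compact pieces of arcs and
finitely many vertices. -/
theorem IsPolygonGluing.isClosedMap (h : IsPolygonGluing M ν V q) : IsClosedMap q := by
  intro C hC
  rw [← h.isQuotientMap.isClosed_preimage]
  have h1 : q ⁻¹' (q '' C) = C ∪ (⋃ n ∈ Finset.range M,
      (fun t : ℝ => arc M (n + ν n + 1 - t)) '' (Icc (n : ℝ) (n + 1) ∩ arc M ⁻¹' C)) ∪
      {w | V ∧ IsVertex M w ∧ ∃ z ∈ C, IsVertex M z} := by
    ext w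
    simp only [mem_preimage, mem_image, mem_union, mem_iUnion, Finset.mem_range, mem_inter_iff,
      mem_ofPred_eq]
    constructor
    · rintro ⟨z, hz, hzw⟩
      rcases (h.eq_iff z w).1 hzw with rfl | ⟨n, hn, t, ht, rfl, rfl⟩ | ⟨hV, h1, h2⟩
      · exact Or.inl (Or.inl hz)
      · exact Or.inl (Or.inr ⟨n, hn, t, ⟨ht, hz⟩, rfl⟩)
      · exact Or.inr ⟨hV, h2, z, hz, h1⟩
    · rintro ((hw | ⟨n, hn, t, ⟨ht, hz⟩, rfl⟩) | ⟨hV, h2, z, hz, h1⟩)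
      · exact ⟨w, hw, rfl⟩
      · exact ⟨_, hz, (h.eq_iff _ _).2 (Or.inr (Or.inl ⟨n, hn, t, ht, rfl, rfl⟩))⟩
      · exact ⟨z, hz, (h.eq_iff _ _).2 (Or.inr (Or.inr ⟨hV, h1, h2⟩))⟩
  rw [h1]
  refine (hC.union (isClosed_biUnion_finset fun n _ => IsCompact.isClosed ?_)).union ?_
  · exact (isCompact_Icc.inter_right (hC.preimage (continuous_arc M))).image
      ((continuous_arc M).comp (by fun_prop))
  · exact ((finite_isVertex h.pos).subset fun w hw => hw.2.1).isClosed

/-- Distinct fibres are disjoint closed sets in a normal space, and a closed map carries separating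
open sets down to the quotient. -/
theorem IsPolygonGluing.t2Space (h : IsPolygonGluing M ν V q) : T2Space X := by
  have hsing : ∀ x : X, IsClosed ({x} : Set X) := fun x => by
    obtain ⟨z, rfl⟩ := h.isQuotientMap.surjective x
    have := h.isClosedMap {z} isClosed_singleton
    rwa [image_singleton] at this
  have hc := h.isQuotientMap.continuous
  refine ⟨fun x y hxy => ?_⟩
  obtain ⟨U, W, hU, hW, hxU, hyW, hUW⟩ := normal_separation ((hsing x).preimage hc)
    ((hsing y).preimage hc) (disjoint_singleton.2 hxy |>.preimage q)
  refine ⟨(q '' Uᶜ)ᶜ, (q '' Wᶜ)ᶜ, (h.isClosedMap _ hU.isClosed_compl).isOpen_compl,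
    (h.isClosedMap _ hW.isClosed_compl).isOpen_compl, ?_, ?_, ?_⟩
  · rintro ⟨z, hz, hzx⟩
    exact hz (hxU hzx)
  · rintro ⟨z, hz, hzx⟩
    exact hz (hyW hzx)
  · rw [disjoint_left]
    rintro w hw1 hw2
    obtain ⟨z, rfl⟩ := h.isQuotientMap.surjective w
    have h1 : z ∈ U := by by_contra hz; exact hw1 ⟨z, hz, rfl⟩
    have h2 : z ∈ W := by by_contra hz; exact hw2 ⟨z, hz, rfl⟩
    exact disjoint_left.1 hUW h1 h2

theorem IsPolygonGluing.eq_of_norm_lt (h : IsPolygonGluing M ν V q) {z w : UnitDisc}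
    (hz : ‖(z : ℂ)‖ < 1) (hzw : q z = q w) : z = w := by
  rcases (h.eq_iff z w).1 hzw with h1 | ⟨n, hn, t, ht, rfl, -⟩ | ⟨-, ⟨n, rfl⟩, -⟩
  · exact h1
  · rw [norm_arc] at hz; exact absurd hz (lt_irrefl _)
  · rw [norm_arc] at hz; exact absurd hz (lt_irrefl _)

/-- The open disc, a copy of the plane, embeds injectively with dense image. The plane minus a
countable set is connected and dense, so its image is a connected dense subset of the surface inside
the complement of `F`. -/
theorem IsPolygonGluing.isPreconnected_compl (h : IsPolygonGluing M ν V q) {F : Set X}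
    (hF : F.Finite) : IsPreconnected Fᶜ := by
  have hball : ∀ w : ℂ, OpenPartialHomeomorph.univUnitBall w ∈ Metric.ball (0 : ℂ) 1 := fun w =>
    OpenPartialHomeomorph.univUnitBall.map_source (mem_univ w)
  let ψ : ℂ → UnitDisc := fun w =>
    ⟨OpenPartialHomeomorph.univUnitBall w, Metric.ball_subset_closedBall (hball w)⟩
  have hψ : Continuous ψ := Continuous.subtype_mk
    (continuousOn_univ.1 OpenPartialHomeomorph.univUnitBall.continuousOn) _
  have hψr : range ψ = {z : UnitDisc | ‖(z : ℂ)‖ < 1} := by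
    ext z
    constructor
    · rintro ⟨w, rfl⟩
      exact mem_ball_zero_iff.1 (hball w)
    · intro hz
      refine ⟨OpenPartialHomeomorph.univUnitBall.symm z, Subtype.ext ?_⟩
      exact OpenPartialHomeomorph.univUnitBall.right_inv (mem_ball_zero_iff.2 hz)
  have hψd : DenseRange ψ := by
    intro z
    rw [mem_closure_iff_seq_limit]
    refine ⟨fun n => ⟨(1 - 1 / ((n : ℝ) + 1) : ℝ) * z, ?_⟩, fun n => ?_, ?_⟩
    · have h1 : 1 / ((n : ℝ) + 1) ≤ 1 := by
        rw [div_le_one (by positivity)]; linarith [n.cast_nonneg (α := ℝ)]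
      have h2 : 0 < 1 / ((n : ℝ) + 1) := by positivity
      rw [mem_closedBall_zero_iff, norm_mul, Complex.norm_of_nonneg (by linarith)]
      have := mem_closedBall_zero_iff.1 z.2
      nlinarith [norm_nonneg (z : ℂ)]
    · rw [hψr]
      have h1 : 1 / ((n : ℝ) + 1) ≤ 1 := by
        rw [div_le_one (by positivity)]; linarith [n.cast_nonneg (α := ℝ)]
      have h2 : 0 < 1 / ((n : ℝ) + 1) := by positivity
      change ‖_‖ < 1
      rw [norm_mul, Complex.norm_of_nonneg (by linarith)]
      have := mem_closedBall_zero_iff.1 z.2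
      nlinarith [norm_nonneg (z : ℂ)]
    · rw [tendsto_subtype_rng]
      have h1 := (tendsto_one_div_add_atTop_nhds_zero_nat (𝕜 := ℝ)).const_sub 1
      have h2 := ((Complex.continuous_ofReal.tendsto _).comp h1).mul_const (z : ℂ)
      simpa using h2
  have hinj : Function.Injective (q ∘ ψ) := by
    intro w w' hw
    have h1 := h.eq_of_norm_lt (mem_ball_zero_iff.1 (hball w)) hw
    exact OpenPartialHomeomorph.univUnitBall.injOn (mem_univ _) (mem_univ _)
      (congrArg Subtype.val h1)
  have hcount : ((q ∘ ψ) ⁻¹' F).Countable := (hF.preimage hinj.injOn).countable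
  have hrank : 1 < Module.rank ℝ ℂ := by rw [Complex.rank_real_complex]; norm_num
  have hG := hcount.isConnected_compl_of_one_lt_rank hrank
  have hcont : Continuous (q ∘ ψ) := h.isQuotientMap.continuous.comp hψ
  have hdr : DenseRange (q ∘ ψ) :=
    h.isQuotientMap.surjective.denseRange.comp hψd h.isQuotientMap.continuous
  have hdense : Dense ((q ∘ ψ) '' ((q ∘ ψ) ⁻¹' F)ᶜ) :=
    hdr.dense_image hcont (hcount.dense_compl ℝ)
  refine (hG.isPreconnected.image _ hcont.continuousOn).subset_closure ?_ ?_
  · rintro _ ⟨w, hw, rfl⟩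
    exact hw
  · rw [hdense.closure_eq]
    exact subset_univ _

/-- The closed half discs `h m`, for `m < N`, glued cyclically along their diameters, form a
neighbourhood of their common midpoint that is homeomorphic to a disc. -/
theorem exists_isDiscChart_of_cone [T2Space X] {N : ℕ} (hN : 0 < N) {h : ℕ → ℂ → X}
    (hc : ∀ m, Continuous (h m)) (hN0 : h N = h 0)
    (hglue : ∀ m < N, ∀ ρ : ℝ, 0 ≤ ρ → ρ ≤ 1 → h m ρ = h (m + 1) (-ρ))
    (hinj : ∀ m < N, ∀ m' < N, ∀ x x' : ℂ, ‖x‖ ≤ 1 → ‖x'‖ ≤ 1 →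
      (0 < x.im ∨ x.im = 0 ∧ x.re ≤ 0) → (0 < x'.im ∨ x'.im = 0 ∧ x'.re ≤ 0) →
      h m x = h m' x' → x = x' ∧ (x = 0 ∨ m = m'))
    (hopen : IsOpen (⋃ m ∈ Finset.range N, h m '' {x | ‖x‖ < 1 ∧ 0 ≤ x.im})) :
    ∃ V : ℂ → X, IsDiscChart V ∧ V 0 = h 0 0 := by
  have hN' : (0 : ℝ) < N := by exact_mod_cast hN
  have hpi := Real.pi_pos
  -- Polar coordinates with angular parameter `a` in `[0, N]`: the half disc `h m` fills the sector
  -- `m ≤ a ≤ m + 1`, and `u` traverses its half circle from `-ρ` to `ρ`. The canonical points in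
  -- `hinj` contain only the negative radius, so that each glued radius is counted once.
  let u : ℝ → ℝ → ℂ := fun ρ s => ρ * Complex.exp ((Real.pi * (1 - s) : ℝ) * Complex.I)
  let W : ℝ × ℝ → X := fun k => h ⌊k.2⌋₊ (u k.1 (k.2 - ⌊k.2⌋₊))
  let pol : ℝ × ℝ → ℂ := fun k => k.1 * Complex.exp ((2 * Real.pi * k.2 / N : ℝ) * Complex.I)
  let K : Set (ℝ × ℝ) := Icc 0 1 ×ˢ Icc 0 (N : ℝ)
  have hu0 : ∀ ρ, u ρ 0 = -ρ := fun ρ => by simp [u]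
  have hu1 : ∀ ρ, u ρ 1 = ρ := fun ρ => by simp [u]
  have hu : ∀ ρ s, 0 ≤ ρ → ‖u ρ s‖ = ρ := fun ρ s hρ => by
    simp only [u]
    rw [norm_mul, Complex.norm_exp_ofReal_mul_I, mul_one, Complex.norm_of_nonneg hρ]
  have huim : ∀ ρ s, (u ρ s).im = ρ * Real.sin (Real.pi * s) := fun ρ s => by
    simp only [u]
    rw [Complex.im_ofReal_mul, Complex.exp_ofReal_mul_I_im, mul_sub,
      mul_one, Real.sin_pi_sub]
  have hure : ∀ ρ s, (u ρ s).re = -(ρ * Real.cos (Real.pi * s)) := fun ρ s => by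
    simp only [u]
    rw [Complex.re_ofReal_mul, Complex.exp_ofReal_mul_I_re, mul_sub, mul_one, Real.cos_pi_sub]
    ring
  have hucan : ∀ ρ s, 0 ≤ ρ → s ∈ Ico (0 : ℝ) 1 → 0 < (u ρ s).im ∨ (u ρ s).im = 0 ∧ (u ρ s).re ≤ 0 := by
    intro ρ s hρ hs
    rw [huim, hure]
    rcases hρ.eq_or_lt with rfl | hρ
    · simp
    rcases hs.1.eq_or_lt with rfl | hs0
    · simp [hρ.le]
    · exact Or.inl (mul_pos hρ (Real.sin_pos_of_pos_of_lt_pi (by positivity) (by nlinarith [hs.2])))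
  have hW : ∀ m < N, ∀ ρ a : ℝ, ρ ∈ Icc (0 : ℝ) 1 → a ∈ Icc (m : ℝ) (m + 1) →
      W (ρ, a) = h m (u ρ (a - m)) := by
    intro m hm ρ a hρ ha
    rcases ha.2.eq_or_lt with rfl | ha2
    · have h1 : ⌊(m : ℝ) + 1⌋₊ = m + 1 := by exact_mod_cast Nat.floor_natCast (R := ℝ) (m + 1)
      simp only [W, h1]
      push_cast
      rw [sub_self, add_sub_cancel_left, hu0, hu1, hglue m hm ρ hρ.1 hρ.2]
    · have h1 : ⌊a⌋₊ = m := (Nat.floor_eq_iff (m.cast_nonneg.trans ha.1)).2 ⟨ha.1, ha2⟩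
      simp only [W, h1]
  have hWc : ContinuousOn W K := by
    have h1 : K ⊆ ⋃ m : Fin N, Icc (0 : ℝ) 1 ×ˢ Icc ((m : ℕ) : ℝ) ((m : ℕ) + 1) := by
      rintro ⟨ρ, a⟩ ⟨hρ, ha⟩
      rw [mem_iUnion]
      rcases ha.2.eq_or_lt with h2 | h2
      · refine ⟨⟨N - 1, by lia⟩, hρ, ?_⟩
        have h3 : ((N - 1 : ℕ) : ℝ) = N - 1 := by rw [Nat.cast_pred hN]
        simp only at h2 ⊢
        rw [h3, h2]
        constructor <;> linarith
      · exact ⟨⟨⌊a⌋₊, (Nat.floor_lt ha.1).2 h2⟩, hρ, Nat.floor_le ha.1, (Nat.lt_floor_add_one a).le⟩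
    refine ContinuousOn.mono ?_ h1
    refine (locallyFinite_of_finite _).continuousOn_iUnion (fun m => isClosed_Icc.prod isClosed_Icc)
      fun m => ?_
    refine ContinuousOn.congr (f := fun k : ℝ × ℝ => h m (u k.1 (k.2 - (m : ℕ)))) ?_ ?_
    · refine ((hc m).comp ?_).continuousOn
      simp only [u]
      fun_prop
    · rintro ⟨ρ, a⟩ ⟨hρ, ha⟩
      exact hW m m.2 ρ a hρ ha
  have h00 : ∀ m ≤ N, h m 0 = h 0 0 := by
    intro m
    induction m with
    | zero => exact fun _ => rfl
    | succ m ih =>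
      intro hm
      have := hglue m hm 0 le_rfl zero_le_one
      rw [← ih (by lia)]
      simpa using this.symm
  have hW0 : ∀ a ∈ Icc 0 (N : ℝ), W (0, a) = h 0 0 := by
    intro a ha
    have : u 0 (a - ⌊a⌋₊) = 0 := by simp [u]
    simp only [W, this]
    exact h00 _ (Nat.floor_le_of_le ha.2)
  have hcan : ∀ k ∈ K, ∃ k' : ℝ × ℝ, k'.1 = k.1 ∧ k'.2 ∈ Ico 0 (N : ℝ) ∧ W k = W k' ∧ pol k = pol k' := by
    rintro ⟨ρ, a⟩ ⟨hρ, ha⟩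
    rcases ha.2.eq_or_lt with h2 | h2
    · refine ⟨(ρ, 0), rfl, ⟨le_rfl, hN'⟩, ?_, ?_⟩
      · simp only at h2
        simp only [W, h2, Nat.floor_natCast, Nat.floor_zero, sub_self, Nat.cast_zero, hN0]
      · simp only at h2
        simp only [pol, h2]
        rw [mul_div_cancel_right₀ _ hN'.ne']
        simp [Complex.exp_two_pi_mul_I]
    · exact ⟨(ρ, a), rfl, ⟨ha.1, h2⟩, rfl, rfl⟩
  have hpoln : ∀ k : ℝ × ℝ, 0 ≤ k.1 → ‖pol k‖ = k.1 := fun k hk => by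
    simp only [pol]
    rw [norm_mul, Complex.norm_exp_ofReal_mul_I, mul_one, Complex.norm_of_nonneg hk]
  have hexp : ∀ θ ∈ Ico (0 : ℝ) (2 * Real.pi), ∀ θ' ∈ Ico (0 : ℝ) (2 * Real.pi),
      Complex.exp (θ * Complex.I) = Complex.exp (θ' * Complex.I) → θ = θ' := by
    intro θ hθ θ' hθ' heq
    obtain ⟨n, hn⟩ := Complex.exp_eq_exp_iff_exists_int.1 heq
    have h2 : θ = θ' + n * (2 * Real.pi) := by
      have h3 : (θ : ℂ) * Complex.I = ((θ' + n * (2 * Real.pi) : ℝ) : ℂ) * Complex.I := by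
        rw [hn]; push_cast; ring
      exact_mod_cast mul_right_cancel₀ Complex.I_ne_zero h3
    have h4 : n = 0 := by
      have h5 : (-1 : ℝ) < n := by nlinarith [hθ.1, hθ'.2]
      have h6 : (n : ℝ) < 1 := by nlinarith [hθ.2, hθ'.1]
      have h7 : (-1 : ℤ) < n := by exact_mod_cast h5
      have h8 : n < (1 : ℤ) := by exact_mod_cast h6
      lia
    rw [h2, h4]; simp
  -- On the compact rectangle `K` the maps `W` and `pol` have the same fibres. Hence `W` descends
  -- along `pol` to a continuous injective map of the closed disc.
  have hiff : ∀ k ∈ K, ∀ k' ∈ K, W k = W k' ↔ pol k = pol k' := by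
    intro k hk k' hk'
    obtain ⟨l, hl1, hl2, hlW, hlp⟩ := hcan k hk
    obtain ⟨l', hl1', hl2', hlW', hlp'⟩ := hcan k' hk'
    rw [hlW, hlW', hlp, hlp']
    have hρ : l.1 ∈ Icc (0 : ℝ) 1 := hl1 ▸ hk.1
    have hρ' : l'.1 ∈ Icc (0 : ℝ) 1 := hl1' ▸ hk'.1
    obtain ⟨ρ, a⟩ := l
    obtain ⟨ρ', a'⟩ := l'
    simp only at hl2 hl2' hρ hρ'
    have ha := Nat.floor_le hl2.1
    have ha' := Nat.floor_le hl2'.1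
    have hb := Nat.lt_floor_add_one a
    have hb' := Nat.lt_floor_add_one a'
    constructor
    · intro heq
      obtain ⟨h1, h2⟩ := hinj ⌊a⌋₊ ((Nat.floor_lt hl2.1).2 hl2.2) ⌊a'⌋₊
        ((Nat.floor_lt hl2'.1).2 hl2'.2) (u ρ (a - ⌊a⌋₊)) (u ρ' (a' - ⌊a'⌋₊))
        (by rw [hu _ _ hρ.1]; exact hρ.2) (by rw [hu _ _ hρ'.1]; exact hρ'.2)
        (hucan _ _ hρ.1 ⟨by linarith, by linarith⟩)
        (hucan _ _ hρ'.1 ⟨by linarith, by linarith⟩) heq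
      have h3 : ρ = ρ' := by
        rw [← hu ρ (a - ⌊a⌋₊) hρ.1, h1, hu _ _ hρ'.1]
      subst h3
      rcases hρ.1.eq_or_lt with rfl | h0
      · simp [pol]
      have h4 : ⌊a⌋₊ = ⌊a'⌋₊ := h2.resolve_left fun h => by
        have := hu ρ (a - ⌊a⌋₊) hρ.1
        rw [h, norm_zero] at this
        exact h0.ne this
      rw [← h4] at h1 ha' hb'
      have h5 := hexp (Real.pi * (1 - (a - ⌊a⌋₊))) ⟨by nlinarith, by nlinarith⟩
        (Real.pi * (1 - (a' - ⌊a⌋₊))) ⟨by nlinarith, by nlinarith⟩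
        (mul_left_cancel₀ (Complex.ofReal_ne_zero.2 h0.ne') h1)
      have h6 := mul_left_cancel₀ hpi.ne' h5
      have h7 : a = a' := by linarith
      rw [h7]
    · intro heq
      have h3 : ρ = ρ' := by
        have := hpoln (ρ, a) hρ.1
        rw [heq, hpoln (ρ', a') hρ'.1] at this
        exact this.symm
      subst h3
      rcases hρ.1.eq_or_lt with rfl | h0
      · rw [hW0 a ⟨hl2.1, hl2.2.le⟩, hW0 a' ⟨hl2'.1, hl2'.2.le⟩]
      have hmem : ∀ b ∈ Ico (0 : ℝ) N, 2 * Real.pi * b / N ∈ Ico (0 : ℝ) (2 * Real.pi) := by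
        intro b hb
        refine ⟨by have := hb.1; positivity, ?_⟩
        rw [div_lt_iff₀ hN']
        nlinarith [hb.2]
      have h5 := hexp _ (hmem a hl2) _ (hmem a' hl2')
        (mul_left_cancel₀ (Complex.ofReal_ne_zero.2 h0.ne') heq)
      have h7 : a = a' := by
        field_simp at h5
        exact h5
      rw [h7]
  have hsurj : ∀ z : ℂ, ∃ a ∈ Icc (0 : ℝ) N, pol (‖z‖, a) = z := by
    intro z
    have h1 := toIcoMod_mem_Ico Real.two_pi_pos 0 z.arg
    rw [zero_add] at h1
    refine ⟨N * toIcoMod Real.two_pi_pos 0 z.arg / (2 * Real.pi), ⟨?_, ?_⟩, ?_⟩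
    · have := h1.1; positivity
    · rw [div_le_iff₀ Real.two_pi_pos]
      nlinarith [h1.2]
    · simp only [pol]
      have h2 : 2 * Real.pi * (N * toIcoMod Real.two_pi_pos 0 z.arg / (2 * Real.pi)) / N =
          toIcoMod Real.two_pi_pos 0 z.arg := by field_simp
      rw [h2]
      have h3 : ((toIcoMod Real.two_pi_pos 0 z.arg : ℝ) : ℂ) * Complex.I =
          z.arg * Complex.I - toIcoDiv Real.two_pi_pos 0 z.arg * (2 * Real.pi * Complex.I) := by
        rw [toIcoMod]
        push_cast [zsmul_eq_mul]
        ring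
      rw [h3, Complex.exp_sub, Complex.exp_int_mul_two_pi_mul_I, div_one, Complex.norm_mul_exp_arg_mul_I]
  have hK : IsCompact K := isCompact_Icc.prod isCompact_Icc
  choose α hα hpα using hsurj
  let V : ℂ → X := fun z => W (‖z‖, α z)
  have hVpol : ∀ k ∈ K, V (pol k) = W k := by
    intro k hk
    refine (hiff _ ⟨?_, hα _⟩ k hk).2 (hpα _)
    rw [hpoln k hk.1.1]
    exact hk.1
  have himg : pol '' K = Metric.closedBall 0 1 := by
    ext z
    rw [mem_closedBall_zero_iff]
    constructor
    · rintro ⟨k, hk, rfl⟩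
      rw [hpoln k hk.1.1]
      exact hk.1.2
    · intro hz
      exact ⟨(‖z‖, α z), ⟨⟨norm_nonneg _, hz⟩, hα z⟩, hpα z⟩
  refine ⟨V, ⟨?_, ?_, ?_⟩, ?_⟩
  · rw [← himg]
    exact hK.continuousOn_image (by fun_prop) (hWc.congr hVpol)
  · intro z hz w hw hzw
    rw [mem_closedBall_zero_iff] at hz hw
    have := (hiff _ ⟨⟨norm_nonneg _, hz⟩, hα z⟩ _ ⟨⟨norm_nonneg _, hw⟩, hα w⟩).1 hzw
    rwa [hpα, hpα] at this
  · convert hopen using 1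
    ext x
    simp only [mem_image, mem_iUnion, Finset.mem_range, mem_ball_zero_iff]
    constructor
    · rintro ⟨z, hz, rfl⟩
      obtain ⟨⟨ρ, a⟩, h1, h2, h3, -⟩ := hcan (‖z‖, α z) ⟨⟨norm_nonneg _, hz.le⟩, hα z⟩
      simp only at h1 h2
      refine ⟨⌊a⌋₊, (Nat.floor_lt h2.1).2 h2.2, u ρ (a - ⌊a⌋₊), ⟨?_, ?_⟩, h3.symm⟩
      · rw [h1, hu _ _ (norm_nonneg _)]; exact hz
      · have := Nat.floor_le h2.1
        have := Nat.lt_floor_add_one a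
        rw [huim, h1]
        exact mul_nonneg (norm_nonneg _)
          (Real.sin_nonneg_of_nonneg_of_le_pi (by nlinarith) (by nlinarith))
    · rintro ⟨m, hm, y, ⟨hy1, hy2⟩, rfl⟩
      have h1 := Complex.arg_nonneg_iff.2 hy2
      have h2 := Complex.arg_le_pi y
      have hm' : (m : ℝ) + 1 ≤ N := by exact_mod_cast hm
      have h3 : y.arg / Real.pi ∈ Icc (0 : ℝ) 1 := ⟨by positivity, (div_le_one hpi).2 h2⟩
      have h4 : u ‖y‖ (m + (1 - y.arg / Real.pi) - m) = y := by
        simp only [u]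
        rw [show Real.pi * (1 - (m + (1 - y.arg / Real.pi) - m)) = y.arg by field_simp; ring,
          Complex.norm_mul_exp_arg_mul_I]
      have hk : ((‖y‖, m + (1 - y.arg / Real.pi)) : ℝ × ℝ) ∈ K :=
        ⟨⟨norm_nonneg _, hy1.le⟩, by have := h3.2; have := m.cast_nonneg (α := ℝ); simp only; linarith,
          by have := h3.1; simp only; linarith⟩
      refine ⟨pol (‖y‖, m + (1 - y.arg / Real.pi)), ?_, ?_⟩
      · rw [hpoln _ (norm_nonneg _)]; exact hy1
      · rw [hVpol _ hk, hW m hm _ _ hk.1 ⟨by linarith [h3.2], by linarith [h3.1]⟩, h4]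
  · simp only [V, norm_zero]
    exact hW0 _ (hα 0)

end

/-! ### Exponential coordinates and disc charts at the vertices -/

section

variable {X : Type*} [TopologicalSpace X] {M : ℕ} {ν : ℕ → ℕ} {V : Prop} {q : UnitDisc → X}

/-- A parameter strictly inside a side lies on no other side and is not a vertex, so only one
identification applies to it. -/
theorem IsPolygonGluing.arc_eq_iff (h : IsPolygonGluing M ν V q) {n : ℕ} (hn : n < M) {t : ℝ}
    (ht : t ∈ Ioo (n : ℝ) (n + 1)) (w : UnitDisc) :
    q (arc M t) = q w ↔ arc M t = w ∨ arc M (n + ν n + 1 - t) = w := by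
  have hM : (0 : ℝ) < M := by exact_mod_cast h.pos
  rw [h.eq_iff]
  constructor
  · rintro (rfl | ⟨m, hm, s, hs, h1, rfl⟩ | ⟨-, h1, -⟩)
    · exact Or.inl rfl
    · right
      obtain ⟨k, hk⟩ := (arc_eq_arc_iff h.pos).1 h1
      have hm' : (m : ℝ) + 1 ≤ M := by exact_mod_cast hm
      have hn' : (n : ℝ) + 1 ≤ M := by exact_mod_cast hn
      have h2 : k = 0 := by
        have h5 : (-1 : ℝ) < k := by nlinarith [hs.2, ht.1, n.cast_nonneg (α := ℝ)]
        have h6 : (k : ℝ) < 1 := by nlinarith [hs.1, ht.2, m.cast_nonneg (α := ℝ)]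
        have h7 : (-1 : ℤ) < k := by exact_mod_cast h5
        have h8 : k < (1 : ℤ) := by exact_mod_cast h6
        lia
      obtain rfl : t = s := by rw [hk, h2]; simp
      have h3 : n = m := by
        have h5 : (n : ℝ) < m + 1 := by linarith [hs.2, ht.1]
        have h6 : (m : ℝ) < n + 1 := by linarith [hs.1, ht.2]
        have h7 : n < m + 1 := by exact_mod_cast h5
        have h8 : m < n + 1 := by exact_mod_cast h6
        lia
      rw [h3]
    · obtain ⟨k, rfl⟩ := (isVertex_arc_iff h.pos).1 h1
      have h5 : (n : ℤ) < k := by exact_mod_cast ht.1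
      have h6 : k < (n : ℤ) + 1 := by exact_mod_cast ht.2
      lia
  · rintro (rfl | rfl)
    · exact Or.inl rfl
    · exact Or.inr (Or.inl ⟨n, hn, t, ⟨ht.1.le, ht.2.le⟩, rfl, rfl⟩)

theorem IsPolygonGluing.apply_arc (h : IsPolygonGluing M ν V q) {n : ℕ} (hn : n < M) {t : ℝ}
    (ht : t ∈ Icc (n : ℝ) (n + 1)) : q (arc M t) = q (arc M (n + ν n + 1 - t)) :=
  (h.eq_iff _ _).2 (Or.inr (Or.inl ⟨n, hn, t, ht, rfl, rfl⟩))

/-- The point of the disc obtained from the upper half plane by the exponential map. -/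
def expArc (M : ℕ) (x : ℂ) : UnitDisc :=
  ⟨Complex.exp (2 * Real.pi / M * (x.re + |x.im| * Complex.I) * Complex.I), by
    rw [mem_closedBall_zero_iff, Complex.norm_exp, Real.exp_le_one_iff]
    have h1 : ((2 * Real.pi / M * (x.re + |x.im| * Complex.I) * Complex.I : ℂ)).re =
        -(2 * Real.pi / M * |x.im|) := by
      have : (2 * Real.pi / M * (x.re + |x.im| * Complex.I) * Complex.I : ℂ) =
        ((2 * Real.pi / M : ℝ) : ℂ) * (x.re * Complex.I - (|x.im| : ℝ)) := by
        push_cast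
        ring_nf
        rw [Complex.I_sq]
        ring
      rw [this, Complex.re_ofReal_mul]
      simp
    rw [h1]
    have := Real.pi_pos
    have : 0 ≤ 2 * Real.pi / M * |x.im| := by positivity
    linarith⟩

theorem continuous_expArc (M : ℕ) : Continuous (expArc M) := by
  apply Continuous.subtype_mk
  have := Complex.continuous_re
  have := Complex.continuous_im
  fun_prop

theorem expArc_ofReal (M : ℕ) (t : ℝ) : expArc M t = arc M t := by
  apply Subtype.ext
  simp only [expArc, arc, Complex.ofReal_re, Complex.ofReal_im, abs_zero]
  congr 1
  push_cast
  ring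

theorem coe_expArc {x : ℂ} (hx : 0 ≤ x.im) :
    (expArc M x : ℂ) = Complex.exp (2 * Real.pi / M * x * Complex.I) := by
  simp only [expArc, abs_of_nonneg hx, Complex.re_add_im]

theorem norm_exp_mul (x : ℂ) : ‖Complex.exp (2 * Real.pi / M * x * Complex.I)‖ =
    Real.exp (-(2 * Real.pi / M * x.im)) := by
  rw [Complex.norm_exp]
  congr 1
  have : (2 * Real.pi / M * x * Complex.I : ℂ) =
    ((2 * Real.pi / M : ℝ) : ℂ) * (x * Complex.I) := by
    push_cast
    ring
  rw [this, Complex.re_ofReal_mul, Complex.mul_I_re]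
  ring

theorem norm_expArc_lt (hM : 0 < M) {x : ℂ} (hx : 0 < x.im) : ‖(expArc M x : ℂ)‖ < 1 := by
  rw [coe_expArc hx.le, norm_exp_mul, Real.exp_lt_one_iff]
  have := Real.pi_pos
  have hM : (0 : ℝ) < M := by exact_mod_cast hM
  have : 0 < 2 * Real.pi / M * x.im := by positivity
  linarith

theorem expArc_eq_iff (hM : 0 < M) {x y : ℂ} (hx : 0 ≤ x.im) (hy : 0 ≤ y.im) :
    expArc M x = expArc M y ↔ ∃ k : ℤ, x = y + k * M := by
  have hM' : (M : ℂ) ≠ 0 := by exact_mod_cast hM.ne'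
  have hpi : (Real.pi : ℂ) ≠ 0 := Complex.ofReal_ne_zero.2 Real.pi_ne_zero
  rw [Subtype.ext_iff, coe_expArc hx, coe_expArc hy, Complex.exp_eq_exp_iff_exists_int]
  refine exists_congr fun k => ?_
  have h1 : (2 * Real.pi / M * y * Complex.I : ℂ) + k * (2 * Real.pi * Complex.I) =
    2 * Real.pi / M * (y + k * M) * Complex.I := by
    field_simp
  rw [h1, mul_left_inj' Complex.I_ne_zero,
    mul_right_inj' (div_ne_zero (mul_ne_zero two_ne_zero hpi) hM')]

/-- The exponential is an open map of the plane, and a point of its image lies in the closed disc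
exactly when its parameter lies in the closed upper half plane. -/
theorem isOpen_image_expArc (hM : 0 < M) {W : Set ℂ} (hW : IsOpen W) :
    IsOpen (expArc M '' (W ∩ {x | 0 ≤ x.im})) := by
  have hM' : (0 : ℝ) < M := by exact_mod_cast hM
  have hpi := Real.pi_pos
  have h0 : (2 * Real.pi / M : ℂ) ≠ 0 := by
    have : (2 * Real.pi / M : ℝ) ≠ 0 := by positivity
    exact_mod_cast this
  have hopen : IsOpenMap fun x : ℂ => Complex.exp (2 * Real.pi / M * x * Complex.I) := by
    refine isOpenMap_of_hasStrictDerivAt (f' := fun x =>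
      Complex.exp (2 * Real.pi / M * x * Complex.I) * (2 * Real.pi / M * Complex.I)) ?_ ?_
    · intro x
      have h1 : HasStrictDerivAt (fun x : ℂ => 2 * Real.pi / M * x * Complex.I)
          (2 * Real.pi / M * Complex.I) x := by
        simpa using ((hasStrictDerivAt_id x).const_mul (2 * Real.pi / M : ℂ)).mul_const Complex.I
      exact h1.cexp
    · intro x
      exact mul_ne_zero (Complex.exp_ne_zero _) (mul_ne_zero h0 Complex.I_ne_zero)
  have h1 : expArc M '' (W ∩ {x | 0 ≤ x.im}) =
      Subtype.val ⁻¹' ((fun x : ℂ => Complex.exp (2 * Real.pi / M * x * Complex.I)) '' W) := by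
    ext z
    constructor
    · rintro ⟨x, ⟨hx, hx0⟩, rfl⟩
      exact ⟨x, hx, (coe_expArc hx0).symm⟩
    · rintro ⟨x, hx, hxz⟩
      have hx0 : 0 ≤ x.im := by
        have h2 := mem_closedBall_zero_iff.1 z.2
        rw [← hxz, norm_exp_mul, Real.exp_le_one_iff] at h2
        have h3 : 0 ≤ 2 * Real.pi / M * x.im := by linarith
        exact nonneg_of_mul_nonneg_right h3 (by positivity)
      exact ⟨x, ⟨hx, hx0⟩, Subtype.ext (by rw [coe_expArc hx0]; exact hxz)⟩
  rw [h1]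
  exact (hopen _ hW).preimage continuous_subtype_val

/-- A vertex of the surface at which the corners `e 0, …, e (N - 1)` of the polygon meet has a
neighbourhood homeomorphic to a disc. -/
theorem IsPolygonGluing.exists_isDiscChart_vertex (h : IsPolygonGluing M ν V q) {N : ℕ} (hN : 0 < N)
    {e : ℕ → ℕ} (he : ∀ m < N, e m < M) (hinj : ∀ m < N, ∀ m' < N, e m = e m' → m = m')
    (hsucc : ∀ m < N, ∃ k : ℤ, (e (m + 1) : ℝ) = ν (e m) + 1 + k * M)
    (hN0 : ∃ k : ℤ, (e N : ℝ) = e 0 + k * M)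
    (hstab : ∀ m < N, ∀ w, q (arc M (e m)) = q w → ∃ m' < N, w = arc M (e m')) :
    ∃ V : ℂ → X, IsDiscChart V ∧ V 0 = q (arc M (e 0)) := by
  have := h.t2Space
  have hM : (0 : ℝ) < M := by exact_mod_cast h.pos
  have hshift : ∀ (a b : ℝ), (∃ k : ℤ, a = b + k * M) → ∀ x : ℂ, expArc M (a + x) = expArc M (b + x) := by
    rintro a b ⟨k, rfl⟩ x
    apply Subtype.ext
    simp only [expArc, Complex.add_im, Complex.ofReal_im, Complex.add_re, Complex.ofReal_re]
    rw [Complex.exp_eq_exp_iff_exists_int]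
    refine ⟨k, ?_⟩
    have : (M : ℂ) ≠ 0 := by exact_mod_cast hM.ne'
    push_cast
    field_simp
    ring
  -- The half discs at the corners have radius 1/4 in the arc parameter, so those at different
  -- corners are disjoint before gluing. Two parameters that agree modulo `M` then force an integer
  -- of absolute value less than 1 to vanish.
  have hreal : ∀ a b : ℝ, expArc M (a + b / 4) = arc M (a + b / 4) := fun a b => by
    rw [← expArc_ofReal]; push_cast; rfl
  have hpos : ∀ m < N, ∀ y : ℝ, 0 < y → y ≤ 1 → ∀ w, q (arc M (e m + y / 4)) = q w ↔
      arc M (e m + y / 4) = w ∨ arc M (e (m + 1) - y / 4) = w := by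
    intro m hm y hy0 hy1 w
    rw [h.arc_eq_iff (he m hm) ⟨by linarith, by linarith⟩]
    obtain ⟨k, hk⟩ := hsucc m hm
    have h1 : arc M (e (m + 1) - y / 4) = arc M (e m + ν (e m) + 1 - (e m + y / 4)) :=
      (arc_eq_arc_iff h.pos).2 ⟨k, by rw [hk]; ring⟩
    rw [h1]
  have hglue : ∀ m < N, ∀ y : ℝ, 0 ≤ y → y ≤ 1 →
      q (arc M (e m + y / 4)) = q (arc M (e (m + 1) - y / 4)) := by
    intro m hm y hy0 hy1
    rw [h.apply_arc (he m hm) ⟨by linarith, by linarith⟩]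
    obtain ⟨k, hk⟩ := hsucc m hm
    congr 1
    exact (arc_eq_arc_iff h.pos).2 ⟨-k, by rw [hk]; push_cast; ring⟩
  -- The negative radius at a corner is glued to the positive radius at the preceding corner of the
  -- cycle; corner 0 is preceded by corner `N - 1`.
  have hpred : ∀ m < N, ∃ m' < N, (∃ k : ℤ, (e m : ℝ) = e (m' + 1) + k * M) ∧
      ∃ k : ℤ, (e m : ℝ) = ν (e m') + 1 + k * M := by
    intro m hm
    rcases m with _ | m
    · obtain ⟨k, hk⟩ := hN0
      obtain ⟨k', hk'⟩ := hsucc (N - 1) (by lia)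
      rw [Nat.sub_add_cancel hN] at hk'
      refine ⟨N - 1, by lia, ⟨-k, ?_⟩, k' - k, ?_⟩
      · rw [Nat.sub_add_cancel hN, hk]; push_cast; ring
      · push_cast; linarith
    · exact ⟨m, by lia, ⟨0, by simp⟩, hsucc m (by lia)⟩
  have hmod : ∀ a b : ℕ, a < M → b < M → (∃ k : ℤ, (a : ℝ) = b + k * M) → a = b := by
    rintro a b ha hb ⟨k, hk⟩
    have h1 : (a : ℤ) = b + k * M := by exact_mod_cast hk
    have h2 : k = 0 := by
      have h5 : -1 < k := by nlinarith
      have h6 : k < 1 := by nlinarith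
      lia
    rw [h2] at h1
    lia
  have hvert : ∀ m < N, ∀ y : ℝ, |y| ≤ 1 → ∀ m' < N, q (arc M (e m' )) = q (arc M (e m + y / 4)) →
      y = 0 := by
    intro m hm y hy m' hm' heq
    obtain ⟨m'', -, h1⟩ := hstab m' hm' _ heq
    obtain ⟨k, hk⟩ := (arc_eq_arc_iff h.pos).1 h1
    have h2 : y / 4 = ((e m'' + k * M - e m : ℤ) : ℝ) := by push_cast; linarith
    rw [abs_le] at hy
    have h3 : (e m'' + k * M - e m : ℤ) = 0 := by
      have h5 : (-1 : ℝ) < ((e m'' + k * M - e m : ℤ) : ℝ) := by rw [← h2]; linarith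
      have h6 : ((e m'' + k * M - e m : ℤ) : ℝ) < 1 := by rw [← h2]; linarith
      have h7 : (-1 : ℤ) < e m'' + k * M - e m := by exact_mod_cast h5
      have h8 : (e m'' + k * M - e m : ℤ) < 1 := by exact_mod_cast h6
      lia
    rw [h3] at h2
    simp only [Int.cast_zero] at h2
    linarith
  have him : ∀ (a : ℝ) (x : ℂ), ((a : ℂ) + x / 4).im = x.im / 4 := fun a x => by
    simp
  suffices hmain : ∃ V' : ℂ → X, IsDiscChart V' ∧ V' 0 = q (expArc M ((e 0 : ℝ) + 0 / 4)) by
    obtain ⟨V', hV, h0⟩ := hmain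
    refine ⟨V', hV, ?_⟩
    rw [h0, zero_div, add_zero, expArc_ofReal]
  refine exists_isDiscChart_of_cone hN
    (h := fun m x => q (expArc M ((e m : ℝ) + x / 4))) ?_ ?_ ?_ ?_ ?_
  · intro m
    exact h.isQuotientMap.continuous.comp ((continuous_expArc M).comp (by fun_prop))
  · funext x
    rw [hshift _ _ hN0]
  · intro m hm y hy0 hy1
    have := hreal (e (m + 1)) (-y)
    push_cast at this ⊢
    rw [this, ← Complex.ofReal_natCast (e m), hreal, hglue m hm y hy0 hy1]
    congr 2
    ring
  · intro m hm m' hm' x x' hx hx' hc hc' heq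
    have hre := abs_le.1 ((Complex.abs_re_le_norm x).trans hx)
    have hre' := abs_le.1 ((Complex.abs_re_le_norm x').trans hx')
    by_cases hpp : 0 < x.im ∨ 0 < x'.im
    · have h1 : expArc M ((e m : ℝ) + x / 4) = expArc M ((e m' : ℝ) + x' / 4) := by
        rcases hpp with hp | hp
        · exact h.eq_of_norm_lt (norm_expArc_lt h.pos (by rw [him]; positivity)) heq
        · exact (h.eq_of_norm_lt (norm_expArc_lt h.pos (by rw [him]; positivity)) heq.symm).symm
      have hi : 0 ≤ x.im := by rcases hc with h | h; exacts [h.le, h.1.ge]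
      have hi' : 0 ≤ x'.im := by rcases hc' with h | h; exacts [h.le, h.1.ge]
      obtain ⟨k, hk⟩ := (expArc_eq_iff h.pos (by rw [him]; positivity)
        (by rw [him]; positivity)).1 h1
      have h2 : (e m : ℝ) + x.re / 4 = e m' + x'.re / 4 + k * M := by
        have := congrArg Complex.re hk
        simpa [Complex.div_re] using this
      have h3 : (x.re - x'.re) / 4 = ((e m' + k * M - e m : ℤ) : ℝ) := by push_cast; linarith
      have h4 : (e m' + k * M - e m : ℤ) = 0 := by
        have h5 : (-1 : ℝ) < ((e m' + k * M - e m : ℤ) : ℝ) := by rw [← h3]; linarith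
        have h6 : ((e m' + k * M - e m : ℤ) : ℝ) < 1 := by rw [← h3]; linarith
        have h7 : (-1 : ℤ) < e m' + k * M - e m := by exact_mod_cast h5
        have h8 : (e m' + k * M - e m : ℤ) < 1 := by exact_mod_cast h6
        lia
      have h5 : (e m : ℝ) = e m' + k * M := by
        have : (e m : ℤ) = e m' + k * M := by lia
        exact_mod_cast this
      refine ⟨?_, Or.inr (hinj m hm m' hm' (hmod _ _ (he m hm) (he m' hm') ⟨k, h5⟩))⟩
      have h6 : ((e m : ℝ) : ℂ) = e m' + k * M := by exact_mod_cast congrArg Complex.ofReal h5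
      rw [h6] at hk
      push_cast at hk
      linear_combination 4 * hk
    · push Not at hpp
      obtain ⟨hi, hr⟩ := hc.resolve_left hpp.1.not_gt
      obtain ⟨hi', hr'⟩ := hc'.resolve_left hpp.2.not_gt
      obtain ⟨y, rfl⟩ : ∃ y : ℝ, x = -y := ⟨-x.re, by apply Complex.ext <;> simp [hi]⟩
      obtain ⟨y', rfl⟩ : ∃ y : ℝ, x' = -y := ⟨-x'.re, by apply Complex.ext <;> simp [hi']⟩
      simp only [Complex.neg_re, Complex.ofReal_re] at hr hr' hre hre'
      have key : q (arc M (e m + (-y) / 4)) = q (arc M (e m' + (-y') / 4)) := by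
        have h1 := hreal (e m) (-y)
        have h2 := hreal (e m') (-y')
        push_cast at h1 h2 heq
        rwa [h1, h2] at heq
      by_cases hy : y = 0
      · subst hy
        have := hvert m' hm' (-y') (abs_le.2 hre') m hm (by rw [← key]; simp)
        have h3 : y' = 0 := by linarith
        subst h3
        simp
      by_cases hy' : y' = 0
      · subst hy'
        have := hvert m hm (-y) (abs_le.2 hre) m' hm' (by rw [key]; simp)
        exact absurd (by linarith) hy
      have hy0 : 0 < y := lt_of_le_of_ne (by linarith) (Ne.symm hy)
      have hy0' : 0 < y' := lt_of_le_of_ne (by linarith) (Ne.symm hy')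
      obtain ⟨l, hl, ⟨k, hk⟩, k₁, hk₁⟩ := hpred m hm
      obtain ⟨l', hl', ⟨k', hk'⟩, k₁', hk₁'⟩ := hpred m' hm'
      have h1 : arc M (e m + (-y) / 4) = arc M (e (l + 1) - y / 4) :=
        (arc_eq_arc_iff h.pos).2 ⟨k, by rw [hk]; ring⟩
      have h2 : arc M (e m' + (-y') / 4) = arc M (e (l' + 1) - y' / 4) :=
        (arc_eq_arc_iff h.pos).2 ⟨k', by rw [hk']; ring⟩
      rw [h1, h2, ← hglue l hl y hy0.le (by linarith),
        ← hglue l' hl' y' hy0'.le (by linarith), hpos l hl y hy0 (by linarith)] at key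
      rcases key with h3 | h3
      · obtain ⟨j, hj⟩ := (arc_eq_arc_iff h.pos).1 h3
        have h4 : (y - y') / 4 = ((e l' + j * M - e l : ℤ) : ℝ) := by push_cast; linarith
        have h5 : (e l' + j * M - e l : ℤ) = 0 := by
          have h5 : (-1 : ℝ) < ((e l' + j * M - e l : ℤ) : ℝ) := by rw [← h4]; linarith
          have h6 : ((e l' + j * M - e l : ℤ) : ℝ) < 1 := by rw [← h4]; linarith
          have h7 : (-1 : ℤ) < e l' + j * M - e l := by exact_mod_cast h5
          have h8 : (e l' + j * M - e l : ℤ) < 1 := by exact_mod_cast h6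
          lia
        rw [h5] at h4
        have h6 : y = y' := by simp only [Int.cast_zero] at h4; linarith
        have h7 : (e l : ℝ) = e l' + j * M := by
          have : (e l : ℤ) = e l' + j * M := by lia
          exact_mod_cast this
        have h8 := hmod _ _ (he l hl) (he l' hl') ⟨j, h7⟩
        rw [h8] at hk₁
        refine ⟨by rw [h6], Or.inr (hinj m hm m' hm' (hmod _ _ (he m hm) (he m' hm')
          ⟨k₁ - k₁', ?_⟩))⟩
        push_cast
        linarith
      · obtain ⟨j, hj⟩ := (arc_eq_arc_iff h.pos).1 h3
        have h4 : (y + y') / 4 = ((e (l + 1) - j * M - e l' : ℤ) : ℝ) := by push_cast; linarith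
        have h5 : (0 : ℝ) < ((e (l + 1) - j * M - e l' : ℤ) : ℝ) := by rw [← h4]; linarith
        have h6 : ((e (l + 1) - j * M - e l' : ℤ) : ℝ) < 1 := by rw [← h4]; linarith
        have h7 : (0 : ℤ) < e (l + 1) - j * M - e l' := by exact_mod_cast h5
        have h8 : (e (l + 1) - j * M - e l' : ℤ) < 1 := by exact_mod_cast h6
        lia
  · rw [← h.isQuotientMap.isOpen_preimage]
    have h1 : q ⁻¹' (⋃ m ∈ Finset.range N, (fun x => q (expArc M ((e m : ℝ) + x / 4))) ''
        {x | ‖x‖ < 1 ∧ 0 ≤ x.im}) = ⋃ m ∈ Finset.range N,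
          expArc M '' ((fun x => 4 * (x - (e m : ℝ))) ⁻¹' Metric.ball 0 1 ∩ {x | 0 ≤ x.im}) := by
      have hsub : ∀ m < N, ∀ x : ℂ, ‖x‖ < 1 → 0 ≤ x.im → expArc M ((e m : ℝ) + x / 4) ∈
          ⋃ m ∈ Finset.range N,
          expArc M '' ((fun x => 4 * (x - (e m : ℝ))) ⁻¹' Metric.ball 0 1 ∩ {x | 0 ≤ x.im}) := by
        intro m hm x hx1 hx2
        simp only [mem_iUnion, Finset.mem_range]
        refine ⟨m, hm, _, ⟨?_, ?_⟩, rfl⟩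
        · simp only [mem_preimage, mem_ball_zero_iff]
          have : 4 * ((e m : ℝ) + x / 4 - (e m : ℝ)) = x := by ring
          rwa [this]
        · simp only [mem_ofPred_eq, him]
          positivity
      have hsubr : ∀ m < N, ∀ y : ℝ, |y| < 1 → arc M (e m + y / 4) ∈
          ⋃ m ∈ Finset.range N,
          expArc M '' ((fun x => 4 * (x - (e m : ℝ))) ⁻¹' Metric.ball 0 1 ∩ {x | 0 ≤ x.im}) := by
        intro m hm y hy
        rw [← hreal]
        exact hsub m hm y (by rwa [Complex.norm_real, Real.norm_eq_abs]) (by simp)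
      ext w
      constructor
      · intro hw
        simp only [mem_preimage, mem_iUnion, Finset.mem_range] at hw
        obtain ⟨m, hm, x, ⟨hx1, hx2⟩, hxw⟩ := hw
        rcases hx2.eq_or_lt with hx0 | hx0
        · obtain ⟨y, rfl⟩ : ∃ y : ℝ, x = y := ⟨x.re, by apply Complex.ext <;> simp [← hx0]⟩
          rw [Complex.norm_real, Real.norm_eq_abs, abs_lt] at hx1
          simp only at hxw
          rw [hreal] at hxw
          rcases lt_trichotomy y 0 with hy | hy | hy
          · obtain ⟨l, hl, ⟨k, hk⟩, -⟩ := hpred m hm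
            have h2 : arc M (e m + y / 4) = arc M (e (l + 1) - -y / 4) :=
              (arc_eq_arc_iff h.pos).2 ⟨k, by rw [hk]; ring⟩
            have hxw' := hxw
            rw [h2, ← hglue l hl (-y) (by linarith) (by linarith),
              hpos l hl (-y) (by linarith) (by linarith), ← h2] at hxw'
            rcases hxw' with rfl | rfl
            · exact hsubr l hl (-y) (abs_lt.2 ⟨by linarith, by linarith⟩)
            · exact hsubr m hm y (abs_lt.2 hx1)
          · rw [hy, zero_div, add_zero] at hxw
            obtain ⟨m', hm', rfl⟩ := hstab m hm w hxw
            simpa using hsubr m' hm' 0 (by simp)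
          · rw [hpos m hm y hy hx1.2.le] at hxw
            rcases hxw with rfl | rfl
            · exact hsubr m hm y (abs_lt.2 hx1)
            · obtain ⟨l, hl, k, hk⟩ : ∃ l < N, ∃ k : ℤ, (e (m + 1) : ℝ) = e l + k * M := by
                by_cases hmN : m + 1 < N
                · exact ⟨m + 1, hmN, 0, by simp⟩
                · obtain rfl : m + 1 = N := by lia
                  exact ⟨0, hN, hN0⟩
              have h2 : arc M (e (m + 1) - y / 4) = arc M (e l + -y / 4) :=
                (arc_eq_arc_iff h.pos).2 ⟨k, by rw [hk]; ring⟩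
              rw [h2]
              exact hsubr l hl (-y) (abs_lt.2 ⟨by linarith, by linarith⟩)
        · rw [← h.eq_of_norm_lt (norm_expArc_lt h.pos (by rw [him]; positivity)) hxw]
          exact hsub m hm x hx1 hx2
      · simp only [mem_preimage, mem_iUnion, Finset.mem_range]
        rintro ⟨m, hm, x, ⟨hx1, hx2⟩, rfl⟩
        refine ⟨m, hm, 4 * (x - (e m : ℝ)), ⟨mem_ball_zero_iff.1 hx1, ?_⟩, ?_⟩
        · have : (4 * (x - (e m : ℝ)) : ℂ).im = 4 * x.im := by simp
          rw [this]
          exact mul_nonneg (by norm_num) hx2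
        · have h2 : ((e m : ℝ) : ℂ) + 4 * (x - (e m : ℝ)) / 4 = x := by ring
          simp only [h2]
    rw [h1]
    exact isOpen_biUnion fun m _ => isOpen_image_expArc h.pos (Metric.isOpen_ball.preimage (by fun_prop))

end

/-! ### The strip model of the polygon; disc charts at interior and edge points -/

section

/-- The half-open strip which `stripMap` maps homeomorphically to the disc minus one point. -/
def strip (M : ℕ) : Set ℂ := {x | x.re ∈ Ioo (0 : ℝ) M ∧ 0 ≤ x.im}

/-- A homeomorphism from the strip to the closed unit disc minus the point `1`, which is `arc M` on
the real interval. -/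
def stripMap (M : ℕ) (x : ℂ) : UnitDisc :=
  ⟨(⟨Real.tan (Real.pi * x.re / M - Real.pi / 2), |x.im|⟩ - Complex.I) /
    (⟨Real.tan (Real.pi * x.re / M - Real.pi / 2), |x.im|⟩ + Complex.I), by
    rw [mem_closedBall_zero_iff, norm_div]
    refine div_le_one_of_le₀ ?_ (norm_nonneg _)
    rw [← sq_le_sq₀ (norm_nonneg _) (norm_nonneg _), Complex.sq_norm, Complex.sq_norm,
      Complex.normSq_apply, Complex.normSq_apply]
    simp only [Complex.sub_re, Complex.sub_im, Complex.add_re, Complex.add_im, Complex.I_re,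
      Complex.I_im]
    nlinarith [abs_nonneg x.im]⟩

/-- The inverse of `stripMap`. -/
def stripInv (M : ℕ) (z : ℂ) : ℂ :=
  ⟨M / 2 + M / Real.pi * Real.arctan (Complex.I * (1 + z) / (1 - z)).re,
    (Complex.I * (1 + z) / (1 - z)).im⟩

variable {M : ℕ}

theorem add_I_ne_zero {w : ℂ} (hw : 0 ≤ w.im) : w + Complex.I ≠ 0 := fun h => by
  have := congrArg Complex.im h
  simp only [Complex.add_im, Complex.I_im, Complex.zero_im] at this
  linarith

theorem angle_mem (hM : 0 < M) {t : ℝ} (ht : t ∈ Ioo (0 : ℝ) M) :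
    Real.pi * t / M - Real.pi / 2 ∈ Ioo (-(Real.pi / 2)) (Real.pi / 2) := by
  have hM' : (0 : ℝ) < M := by exact_mod_cast hM
  have hpi := Real.pi_pos
  have h1 : 0 < Real.pi * t / M := by have := ht.1; positivity
  have h2 : Real.pi * t / M < Real.pi := by
    rw [div_lt_iff₀ hM']
    nlinarith [ht.2]
  constructor <;> linarith

theorem continuousOn_stripMap (hM : 0 < M) :
    ContinuousOn (stripMap M) {x | x.re ∈ Ioo (0 : ℝ) M} := by
  rw [continuousOn_iff_continuous_domRestrict]
  apply Continuous.subtype_mk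
  have h1 : Continuous fun x : {x : ℂ | x.re ∈ Ioo (0 : ℝ) M} =>
      Real.tan (Real.pi * (x : ℂ).re / M - Real.pi / 2) := by
    refine (continuousOn_iff_continuous_domRestrict (f := fun x : ℂ =>
      Real.tan (Real.pi * x.re / M - Real.pi / 2))).1 ?_
    refine Real.continuousOn_tan_Ioo.comp ?_ fun x hx => angle_mem hM hx
    have := Complex.continuous_re
    fun_prop
  have h2 : Continuous fun x : {x : ℂ | x.re ∈ Ioo (0 : ℝ) M} =>
      (⟨Real.tan (Real.pi * (x : ℂ).re / M - Real.pi / 2), |(x : ℂ).im|⟩ : ℂ) := by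
    have h3 := Complex.equivRealProdCLM.symm.continuous.comp
      (h1.prodMk ((Complex.continuous_im.comp continuous_subtype_val).abs))
    exact h3
  exact (h2.sub continuous_const).div (h2.add continuous_const)
    fun x => add_I_ne_zero (abs_nonneg _)

theorem one_sub_ne_zero {z : UnitDisc} (hz : (z : ℂ) ≠ 1) : (1 - z : ℂ) ≠ 0 := sub_ne_zero.2 hz.symm

theorem continuousOn_stripInv (M : ℕ) :
    ContinuousOn (fun z : UnitDisc => stripInv M z) {z | (z : ℂ) ≠ 1} := by
  have h1 : ContinuousOn (fun z : UnitDisc => (Complex.I * (1 + z) / (1 - z) : ℂ))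
      {z | (z : ℂ) ≠ 1} :=
    ContinuousOn.div (by fun_prop) (by fun_prop) fun z hz => one_sub_ne_zero hz
  have h2 := Complex.equivRealProdCLM.symm.continuous.comp_continuousOn
    (((Real.continuous_arctan.comp_continuousOn (Complex.continuous_re.comp_continuousOn
      h1)).const_mul (M / Real.pi) |>.const_add (M / 2 : ℝ)).prodMk
        (Complex.continuous_im.comp_continuousOn h1))
  exact h2

theorem stripMap_ne_one (M : ℕ) (x : ℂ) : (stripMap M x : ℂ) ≠ 1 := by
  simp only [stripMap]
  rw [Ne, div_eq_one_iff_eq (add_I_ne_zero (abs_nonneg _)), sub_eq_add_neg, add_right_inj]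
  intro h
  have := congrArg Complex.im h
  norm_num at this

theorem stripInv_stripMap (hM : 0 < M) {x : ℂ} (hx : x ∈ strip M) :
    stripInv M (stripMap M x) = x := by
  have hM' : (0 : ℝ) < M := by exact_mod_cast hM
  have hpi := Real.pi_pos
  have h1 : (Complex.I * (1 + stripMap M x) / (1 - stripMap M x) : ℂ) =
      ⟨Real.tan (Real.pi * x.re / M - Real.pi / 2), |x.im|⟩ := by
    rw [div_eq_iff (one_sub_ne_zero (stripMap_ne_one M x))]
    simp only [stripMap]
    have := add_I_ne_zero (w := ⟨Real.tan (Real.pi * x.re / M - Real.pi / 2), |x.im|⟩) (abs_nonneg _)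
    generalize (⟨Real.tan (Real.pi * x.re / M - Real.pi / 2), |x.im|⟩ : ℂ) = w at *
    field_simp
    ring
  have h2 := angle_mem hM hx.1
  rw [stripInv, h1, Real.arctan_tan h2.1 h2.2, abs_of_nonneg hx.2]
  apply Complex.ext
  · simp only
    field_simp
    ring
  · rfl

theorem stripInv_mem (hM : 0 < M) (z : UnitDisc) : stripInv M z ∈ strip M := by
  have hM' : (0 : ℝ) < M := by exact_mod_cast hM
  have hpi := Real.pi_pos
  have h1 := Real.neg_pi_div_two_lt_arctan (Complex.I * (1 + z) / (1 - z) : ℂ).re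
  have h2 := Real.arctan_lt_pi_div_two (Complex.I * (1 + z) / (1 - z) : ℂ).re
  refine ⟨⟨?_, ?_⟩, ?_⟩
  · simp only [stripInv]
    have : (M : ℝ) / Real.pi * -(Real.pi / 2) <
        M / Real.pi * Real.arctan (Complex.I * (1 + z) / (1 - z) : ℂ).re :=
      mul_lt_mul_of_pos_left h1 (by positivity)
    have h3 : (M : ℝ) / Real.pi * -(Real.pi / 2) = - (M / 2) := by field_simp
    linarith
  · simp only [stripInv]
    have : M / Real.pi * Real.arctan (Complex.I * (1 + z) / (1 - z) : ℂ).re <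
        (M : ℝ) / Real.pi * (Real.pi / 2) :=
      mul_lt_mul_of_pos_left h2 (by positivity)
    have h3 : (M : ℝ) / Real.pi * (Real.pi / 2) = M / 2 := by field_simp
    linarith
  · simp only [stripInv]
    have h3 := mem_closedBall_zero_iff.1 z.2
    have h4 : (z : ℂ).re * (z : ℂ).re + (z : ℂ).im * (z : ℂ).im ≤ 1 := by
      rw [← Complex.normSq_apply, ← Complex.sq_norm]
      nlinarith [norm_nonneg (z : ℂ)]
    rw [Complex.div_im]
    simp only [Complex.mul_re, Complex.mul_im, Complex.I_re, Complex.I_im, Complex.add_re,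
      Complex.add_im, Complex.sub_re, Complex.sub_im, Complex.one_re, Complex.one_im]
    rw [← sub_div]
    refine div_nonneg ?_ (Complex.normSq_nonneg _)
    nlinarith

theorem stripMap_stripInv (hM : 0 < M) {z : UnitDisc} (hz : (z : ℂ) ≠ 1) :
    stripMap M (stripInv M z) = z := by
  have hM' : (0 : ℝ) < M := by exact_mod_cast hM
  have hpi := Real.pi_pos
  apply Subtype.ext
  have h0 := (stripInv_mem hM z).2
  have h1 : (⟨Real.tan (Real.pi * (stripInv M z).re / M - Real.pi / 2), |(stripInv M z).im|⟩ : ℂ) =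
      Complex.I * (1 + z) / (1 - z) := by
    rw [abs_of_nonneg h0]
    have h2 : Real.pi * (stripInv M z).re / M - Real.pi / 2 =
        Real.arctan (Complex.I * (1 + z) / (1 - z) : ℂ).re := by
      simp only [stripInv]
      field_simp
      ring
    rw [h2, Real.tan_arctan]
    rfl
  simp only [stripMap]
  rw [h1]
  have h2 := one_sub_ne_zero hz
  have h3 := Complex.I_ne_zero
  have h4 : Complex.I * (1 + (z : ℂ)) / (1 - z) + Complex.I ≠ 0 := by
    have : Complex.I * (1 + (z : ℂ)) / (1 - z) + Complex.I = 2 * Complex.I / (1 - z) := by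
      field_simp; ring
    rw [this]
    exact div_ne_zero (mul_ne_zero two_ne_zero h3) h2
  rw [div_eq_iff h4]
  field_simp
  ring

/-- With φ the argument of the tangent, the Cayley transform of tan φ is -exp(2iφ), which turns
through the circle once as φ runs over (-π/2, π/2). -/
theorem stripMap_ofReal (hM : 0 < M) {t : ℝ} (ht : t ∈ Ioo (0 : ℝ) M) :
    stripMap M t = arc M t := by
  apply Subtype.ext
  have hcos := Real.cos_pos_of_mem_Ioo (angle_mem hM ht)
  set φ := Real.pi * t / M - Real.pi / 2 with hφ
  have h1 : (arc M t : ℂ) = -(Complex.exp (φ * Complex.I) * Complex.exp (φ * Complex.I)) := by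
    rw [← Complex.exp_add, ← mul_neg_one, ← Complex.exp_pi_mul_I, ← Complex.exp_add]
    simp only [arc]
    congr 1
    rw [hφ]
    push_cast
    ring
  have h2 : (stripMap M t : ℂ) = (Real.tan φ - Complex.I) / (Real.tan φ + Complex.I) := by
    simp only [stripMap, Complex.ofReal_re, Complex.ofReal_im, abs_zero]
    rfl
  rw [h1, h2, div_eq_iff (add_I_ne_zero (by rw [Complex.ofReal_im])), Real.tan_eq_sin_div_cos,
    Complex.exp_mul_I, ← Complex.ofReal_cos, ← Complex.ofReal_sin, Complex.ofReal_div]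
  have h3 : (Real.cos φ : ℂ) ≠ 0 := Complex.ofReal_ne_zero.2 hcos.ne'
  have h4 : (Real.cos φ : ℂ) ^ 2 + (Real.sin φ : ℂ) ^ 2 = 1 := by
    exact_mod_cast Real.cos_sq_add_sin_sq φ
  have h5 := Complex.I_sq
  generalize (Real.cos φ : ℂ) = c at *
  generalize (Real.sin φ : ℂ) = s at *
  have h6 : (c + s * Complex.I) * (s + c * Complex.I) = Complex.I := by
    linear_combination Complex.I * h4 + s * c * h5
  rw [show s / c - Complex.I = (s - c * Complex.I) / c by field_simp,
    show s / c + Complex.I = (s + c * Complex.I) / c by field_simp]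
  linear_combination (c + s * Complex.I) / c * h6 + s / c * h5

theorem norm_stripMap_lt (M : ℕ) {x : ℂ} (hx : 0 < x.im) : ‖(stripMap M x : ℂ)‖ < 1 := by
  simp only [stripMap]
  rw [norm_div, div_lt_one (norm_pos_iff.2 (add_I_ne_zero (abs_nonneg _))),
    ← sq_lt_sq₀ (norm_nonneg _) (norm_nonneg _), Complex.sq_norm, Complex.sq_norm,
    Complex.normSq_apply, Complex.normSq_apply]
  simp only [Complex.sub_re, Complex.sub_im, Complex.add_re, Complex.add_im, Complex.I_re,
    Complex.I_im]
  nlinarith [abs_pos_of_pos hx]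

theorem injOn_stripMap (hM : 0 < M) : InjOn (stripMap M) (strip M) := fun x hx y hy h => by
  rw [← stripInv_stripMap hM hx, h, stripInv_stripMap hM hy]

theorem isOpen_image_stripMap (hM : 0 < M) {W : Set ℂ} (hW : IsOpen W) :
    IsOpen (stripMap M '' (W ∩ strip M)) := by
  have h1 : stripMap M '' (W ∩ strip M) = {z : UnitDisc | (z : ℂ) ≠ 1} ∩
      (fun z : UnitDisc => stripInv M z) ⁻¹' W := by
    ext z
    constructor
    · rintro ⟨x, ⟨hxW, hx⟩, rfl⟩
      refine ⟨stripMap_ne_one M x, ?_⟩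
      simp only [mem_preimage]
      rwa [stripInv_stripMap hM hx]
    · rintro ⟨hz, hzW⟩
      exact ⟨stripInv M z, ⟨hzW, stripInv_mem hM z⟩, stripMap_stripInv hM hz⟩
  rw [h1]
  exact (continuousOn_stripInv M).isOpen_inter_preimage
    (isOpen_ne_fun continuous_subtype_val continuous_const) hW

variable {X : Type*} [TopologicalSpace X] {ν : ℕ → ℕ} {V : Prop} {q : UnitDisc → X}

/-- In strip coordinates the identification of a side with its partner is the point reflection z ↦ n
+ ν n + 1 - z, an element of the affine group. -/
theorem IsPolygonGluing.stripMap_eq_iff (h : IsPolygonGluing M ν V q) {n : ℕ} (hn : n < M) {x : ℂ}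
    (hre : x.re ∈ Ioo (n : ℝ) (n + 1)) (him : 0 ≤ x.im) (w : UnitDisc) :
    q (stripMap M x) = q w ↔
      stripMap M x = w ∨ x.im = 0 ∧ stripMap M (n + ν n + 1 - x) = w := by
  have hn' : (n : ℝ) + 1 ≤ M := by exact_mod_cast hn
  have hn0 : (0 : ℝ) ≤ n := n.cast_nonneg
  have hν : (ν n : ℝ) + 1 ≤ M := by exact_mod_cast h.lt n hn
  have hν0 : (0 : ℝ) ≤ ν n := (ν n).cast_nonneg
  rcases him.eq_or_lt with h0 | h0
  · obtain ⟨t, rfl⟩ : ∃ t : ℝ, x = t := ⟨x.re, by apply Complex.ext <;> simp [← h0]⟩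
    rw [Complex.ofReal_re] at hre
    have h1 : ((n : ℂ) + ν n + 1 - t) = ((n + ν n + 1 - t : ℝ) : ℂ) := by push_cast; rfl
    rw [h1, stripMap_ofReal h.pos ⟨by linarith [hre.1], by linarith [hre.2]⟩,
      stripMap_ofReal h.pos ⟨by linarith [hre.2], by linarith [hre.1]⟩, h.arc_eq_iff hn hre]
    simp
  · constructor
    · intro heq
      exact Or.inl (h.eq_of_norm_lt (norm_stripMap_lt M h0) heq)
    · rintro (rfl | ⟨h1, -⟩)
      · rfl
      · exact absurd h1 h0.ne'

theorem norm_ofReal_mul_le {r : ℝ} (hr : 0 < r) {ζ : ℂ} (hζ : ‖ζ‖ ≤ 1) : |(r * ζ : ℂ).re| ≤ r ∧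
    |(r * ζ : ℂ).im| ≤ r := by
  have h1 : ‖(r * ζ : ℂ)‖ ≤ r := by
    rw [norm_mul, Complex.norm_of_nonneg hr.le]
    nlinarith
  exact ⟨(Complex.abs_re_le_norm _).trans h1, (Complex.abs_im_le_norm _).trans h1⟩

theorem image_ball_affine {r : ℝ} (hr : 0 < r) (x₀ : ℂ) :
    (fun ζ : ℂ => x₀ + r * ζ) '' Metric.ball 0 1 = Metric.ball x₀ r := by
  ext x
  constructor
  · rintro ⟨ζ, hζ, rfl⟩
    rw [mem_ball_zero_iff] at hζ
    rw [mem_ball_iff_norm, add_sub_cancel_left, norm_mul, Complex.norm_of_nonneg hr.le]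
    nlinarith
  · intro hx
    have hrC : (r : ℂ) ≠ 0 := Complex.ofReal_ne_zero.2 hr.ne'
    refine ⟨(x - x₀) / r, ?_, by simp only; field_simp; ring⟩
    rw [mem_ball_iff_norm] at hx
    rw [mem_ball_zero_iff, norm_div, Complex.norm_of_nonneg hr.le, div_lt_one hr]
    exact hx

theorem IsPolygonGluing.isDiscChart_interior (h : IsPolygonGluing M ν V q) {x₀ : ℂ} {r : ℝ}
    (hr : 0 < r) (hre : r < x₀.re) (hre' : x₀.re + r < M) (him : r < x₀.im) :
    IsDiscChart fun ζ => q (stripMap M (x₀ + r * ζ)) := by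
  have hmem : ∀ ζ : ℂ, ζ ∈ Metric.closedBall (0 : ℂ) 1 →
      x₀ + r * ζ ∈ strip M ∧ 0 < (x₀ + r * ζ).im := by
    intro ζ hζ
    obtain ⟨h1, h2⟩ := norm_ofReal_mul_le hr (mem_closedBall_zero_iff.1 hζ)
    rw [abs_le] at h1 h2
    simp only [strip, mem_ofPred_eq, Complex.add_re, Complex.add_im]
    refine ⟨⟨⟨?_, ?_⟩, ?_⟩, ?_⟩ <;> linarith
  have hrC : (r : ℂ) ≠ 0 := Complex.ofReal_ne_zero.2 hr.ne'
  refine ⟨?_, ?_, ?_⟩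
  · exact h.isQuotientMap.continuous.comp_continuousOn ((continuousOn_stripMap h.pos).comp
      (by fun_prop) fun ζ hζ => (hmem ζ hζ).1.1)
  · intro ζ hζ ζ' hζ' heq
    have h1 := injOn_stripMap h.pos (hmem ζ hζ).1 (hmem ζ' hζ').1
      (h.eq_of_norm_lt (norm_stripMap_lt M (hmem ζ hζ).2) heq)
    exact mul_left_cancel₀ hrC (add_left_cancel h1)
  · rw [← h.isQuotientMap.isOpen_preimage]
    convert isOpen_image_stripMap h.pos (Metric.isOpen_ball (x := x₀) (ε := r)) using 1
    ext w
    constructor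
    · rintro ⟨ζ, hζ, hw⟩
      have hζ' := hmem ζ (Metric.ball_subset_closedBall hζ)
      refine ⟨x₀ + r * ζ, ⟨?_, hζ'.1⟩, h.eq_of_norm_lt (norm_stripMap_lt M hζ'.2) hw⟩
      rw [← image_ball_affine hr]
      exact ⟨ζ, hζ, rfl⟩
    · rintro ⟨x, ⟨hx, -⟩, rfl⟩
      rw [← image_ball_affine hr] at hx
      obtain ⟨ζ, hζ, rfl⟩ := hx
      exact ⟨ζ, hζ, rfl⟩

/-- The chart at the point with parameter `t₀` of the side `n` of the polygon. -/
def edgeChart (M : ℕ) (c : ℝ) (q : UnitDisc → X) (t₀ r : ℝ) (ζ : ℂ) : X :=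
  open Classical in
  if 0 ≤ ζ.im then q (stripMap M (t₀ + r * ζ)) else q (stripMap M (c - (t₀ + r * ζ)))

/-- The reflection z ↦ c - z exchanges the half planes and restricts to the side pairing, so the
half discs at a point and at its partner fit together along the diameter. They lie over different
sides because `ν n ≠ n`, which gives injectivity. -/
theorem IsPolygonGluing.isDiscChart_edge (h : IsPolygonGluing M ν V q) {n : ℕ} (hn : n < M)
    {t₀ r : ℝ} (hr : 0 < r) (h1 : n < t₀ - r) (h2 : t₀ + r < n + 1) :
    IsDiscChart (edgeChart M (n + ν n + 1) q t₀ r) := by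
  have hn' : (n : ℝ) + 1 ≤ M := by exact_mod_cast hn
  have hn0 : (0 : ℝ) ≤ n := n.cast_nonneg
  have hν : (ν n : ℝ) + 1 ≤ M := by exact_mod_cast h.lt n hn
  have hν0 : (0 : ℝ) ≤ ν n := (ν n).cast_nonneg
  have hrC : (r : ℂ) ≠ 0 := Complex.ofReal_ne_zero.2 hr.ne'
  set c : ℝ := n + ν n + 1 with hc
  have hcC : (c : ℂ) = n + ν n + 1 := by rw [hc]; push_cast; rfl
  have hcC' : (c : ℂ) = ν n + ν (ν n) + 1 := by rw [hcC, h.invol n hn]; ring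
  have hre : ∀ ζ : ℂ, ‖ζ‖ ≤ 1 → (t₀ + r * ζ : ℂ).re ∈ Ioo (n : ℝ) (n + 1) := by
    intro ζ hζ
    obtain ⟨h3, -⟩ := norm_ofReal_mul_le hr hζ
    rw [abs_le] at h3
    simp only [Complex.add_re, Complex.ofReal_re]
    constructor <;> linarith
  have hre' : ∀ ζ : ℂ, ‖ζ‖ ≤ 1 → (c - (t₀ + r * ζ) : ℂ).re ∈ Ioo (ν n : ℝ) (ν n + 1) := by
    intro ζ hζ
    have := hre ζ hζ
    rw [Complex.sub_re, Complex.ofReal_re]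
    constructor <;> linarith [this.1, this.2]
  have him : ∀ ζ : ℂ, (t₀ + r * ζ : ℂ).im = r * ζ.im := fun ζ => by
    rw [Complex.add_im, Complex.ofReal_im, zero_add, Complex.im_ofReal_mul]
  have him' : ∀ ζ : ℂ, (c - (t₀ + r * ζ) : ℂ).im = -(r * ζ.im) := fun ζ => by
    rw [Complex.sub_im, Complex.ofReal_im, him, zero_sub]
  have hup : ∀ ζ : ℂ, ‖ζ‖ ≤ 1 → 0 ≤ ζ.im → (t₀ + r * ζ : ℂ) ∈ strip M := by
    intro ζ hζ hi
    have := hre ζ hζ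
    exact ⟨⟨by linarith [this.1], by linarith [this.2]⟩, by rw [him]; positivity⟩
  have hlo : ∀ ζ : ℂ, ‖ζ‖ ≤ 1 → ζ.im ≤ 0 → (c - (t₀ + r * ζ) : ℂ) ∈ strip M := by
    intro ζ hζ hi
    have := hre' ζ hζ
    exact ⟨⟨by linarith [this.1], by linarith [this.2]⟩, by rw [him']; nlinarith⟩
  have heq : ∀ ζ : ℂ, ‖ζ‖ ≤ 1 → ζ.im = 0 →
      q (stripMap M (t₀ + r * ζ)) = q (stripMap M (c - (t₀ + r * ζ))) := by
    intro ζ hζ hi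
    rw [h.stripMap_eq_iff hn (hre ζ hζ) (by rw [him, hi, mul_zero]), hcC]
    exact Or.inr ⟨by rw [him, hi, mul_zero], rfl⟩
  have hEup : ∀ ζ : ℂ, 0 ≤ ζ.im → edgeChart M c q t₀ r ζ = q (stripMap M (t₀ + r * ζ)) :=
    fun ζ hi => if_pos hi
  have hElo : ∀ ζ : ℂ, ‖ζ‖ ≤ 1 → ζ.im ≤ 0 →
      edgeChart M c q t₀ r ζ = q (stripMap M (c - (t₀ + r * ζ))) := by
    intro ζ hζ hi
    rcases hi.eq_or_lt with h0 | h0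
    · rw [hEup ζ h0.ge, heq ζ hζ h0]
    · exact if_neg h0.not_ge
  have hne : (n : ℤ) ≠ ν n := by exact_mod_cast (h.ne n hn).symm
  have hdisj : ∀ a ∈ Ioo (n : ℝ) (n + 1), a ∉ Ioo (ν n : ℝ) (ν n + 1) := by
    rintro a ⟨h3, h4⟩ ⟨h5, h6⟩
    have h7 : (n : ℝ) < ν n + 1 := h3.trans h6
    have h8 : (ν n : ℝ) < n + 1 := h5.trans h4
    have h9 : (n : ℤ) < ν n + 1 := by exact_mod_cast h7
    have h10 : (ν n : ℤ) < n + 1 := by exact_mod_cast h8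
    lia
  refine ⟨?_, ?_, ?_⟩
  · have h3 : Metric.closedBall (0 : ℂ) 1 = (Metric.closedBall 0 1 ∩ {ζ | 0 ≤ ζ.im}) ∪
        (Metric.closedBall 0 1 ∩ {ζ | ζ.im ≤ 0}) := by
      rw [← inter_union_distrib_left]
      refine (inter_eq_left.2 fun ζ _ => ?_).symm
      exact le_total 0 ζ.im
    rw [h3]
    refine ContinuousOn.union_of_isClosed ?_ ?_
      (Metric.isClosed_closedBall.inter (isClosed_le continuous_const Complex.continuous_im))
      (Metric.isClosed_closedBall.inter (isClosed_le Complex.continuous_im continuous_const))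
    · refine ContinuousOn.congr (f := fun ζ => q (stripMap M (t₀ + r * ζ))) ?_
        fun ζ hζ => hEup ζ hζ.2
      exact h.isQuotientMap.continuous.comp_continuousOn ((continuousOn_stripMap h.pos).comp
        (by fun_prop) fun ζ hζ => (hup ζ (mem_closedBall_zero_iff.1 hζ.1) hζ.2).1)
    · refine ContinuousOn.congr (f := fun ζ => q (stripMap M (c - (t₀ + r * ζ)))) ?_
        fun ζ hζ => hElo ζ (mem_closedBall_zero_iff.1 hζ.1) hζ.2
      exact h.isQuotientMap.continuous.comp_continuousOn ((continuousOn_stripMap h.pos).comp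
        (by fun_prop) fun ζ hζ => (hlo ζ (mem_closedBall_zero_iff.1 hζ.1) hζ.2).1)
  · have hmixed : ∀ ζ ζ' : ℂ, ‖ζ‖ ≤ 1 → ‖ζ'‖ ≤ 1 → 0 ≤ ζ.im → ζ'.im < 0 →
        q (stripMap M (t₀ + r * ζ)) ≠ q (stripMap M (c - (t₀ + r * ζ'))) := by
      intro ζ ζ' hζ hζ' hi hi' heq'
      have hs' := hlo ζ' hζ' hi'.le
      rw [eq_comm, h.stripMap_eq_iff (h.lt n hn) (hre' ζ' hζ') hs'.2] at heq'
      rcases heq' with h3 | ⟨h3, -⟩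
      · have h4 := injOn_stripMap h.pos hs' (hup ζ hζ hi) h3
        exact hdisj _ (hre ζ hζ) (h4 ▸ hre' ζ' hζ')
      · rw [him'] at h3
        nlinarith
    intro ζ hζ ζ' hζ' heq'
    rw [mem_closedBall_zero_iff] at hζ hζ'
    rcases le_or_gt 0 ζ.im with hi | hi <;> rcases le_or_gt 0 ζ'.im with hi' | hi'
    · rw [hEup ζ hi, hEup ζ' hi', h.stripMap_eq_iff hn (hre ζ hζ) (hup ζ hζ hi).2] at heq'
      rcases heq' with h3 | ⟨h3, h4⟩
      · exact mul_left_cancel₀ hrC (add_left_cancel (injOn_stripMap h.pos (hup ζ hζ hi) (hup ζ' hζ' hi') h3))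
      · rw [← hcC] at h4
        rw [him] at h3
        have h0 : ζ.im = 0 := by nlinarith
        have h5 := injOn_stripMap h.pos (hlo ζ hζ h0.le) (hup ζ' hζ' hi') h4
        exact absurd (h5 ▸ hre' ζ hζ) (hdisj _ (hre ζ' hζ'))
    · rw [hEup ζ hi, hElo ζ' hζ' hi'.le] at heq'
      exact absurd heq' (hmixed ζ ζ' hζ hζ' hi hi')
    · rw [hElo ζ hζ hi.le, hEup ζ' hi'] at heq'
      exact absurd heq'.symm (hmixed ζ' ζ hζ' hζ hi' hi)
    · rw [hElo ζ hζ hi.le, hElo ζ' hζ' hi'.le] at heq'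
      have h3 := h.eq_of_norm_lt (norm_stripMap_lt M (by rw [him']; nlinarith)) heq'
      have h4 := injOn_stripMap h.pos (hlo ζ hζ hi.le) (hlo ζ' hζ' hi'.le) h3
      exact mul_left_cancel₀ hrC (add_left_cancel (sub_right_injective h4))
  · rw [← h.isQuotientMap.isOpen_preimage]
    convert (isOpen_image_stripMap h.pos (Metric.isOpen_ball (x := (t₀ : ℂ)) (ε := r))).union
      (isOpen_image_stripMap h.pos (Metric.isOpen_ball (x := ((c - t₀ : ℝ) : ℂ)) (ε := r))) using 1
    have hball : ∀ ζ : ℂ, ‖ζ‖ < 1 → (t₀ + r * ζ : ℂ) ∈ Metric.ball (t₀ : ℂ) r := fun ζ hζ => by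
      rw [← image_ball_affine hr]
      exact ⟨ζ, mem_ball_zero_iff.2 hζ, rfl⟩
    have hball' : ∀ ζ : ℂ, ‖ζ‖ < 1 →
        (c - (t₀ + r * ζ) : ℂ) ∈ Metric.ball ((c - t₀ : ℝ) : ℂ) r := fun ζ hζ => by
      rw [← image_ball_affine hr]
      refine ⟨-ζ, mem_ball_zero_iff.2 (by rwa [norm_neg]), ?_⟩
      push_cast
      ring
    ext w
    constructor
    · rintro ⟨ζ, hζ, hw⟩
      rw [mem_ball_zero_iff] at hζ
      rcases le_or_gt 0 ζ.im with hi | hi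
      · rw [hEup ζ hi, h.stripMap_eq_iff hn (hre ζ hζ.le) (hup ζ hζ.le hi).2, ← hcC] at hw
        rcases hw with rfl | ⟨h3, rfl⟩
        · exact Or.inl ⟨_, ⟨hball ζ hζ, hup ζ hζ.le hi⟩, rfl⟩
        · rw [him] at h3
          exact Or.inr ⟨_, ⟨hball' ζ hζ, hlo ζ hζ.le (by nlinarith)⟩, rfl⟩
      · rw [hElo ζ hζ.le hi.le] at hw
        have h3 := h.eq_of_norm_lt (norm_stripMap_lt M (by rw [him']; nlinarith)) hw
        exact Or.inr ⟨_, ⟨hball' ζ hζ, hlo ζ hζ.le hi.le⟩, h3⟩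
    · rintro (⟨x, ⟨hx, hxs⟩, rfl⟩ | ⟨x, ⟨hx, hxs⟩, rfl⟩)
      · rw [← image_ball_affine hr] at hx
        obtain ⟨ζ, hζ, rfl⟩ := hx
        refine ⟨ζ, hζ, hEup ζ ?_⟩
        have := hxs.2
        rw [him] at this
        exact nonneg_of_mul_nonneg_right this hr
      · rw [← image_ball_affine hr] at hx
        obtain ⟨ζ, hζ, rfl⟩ := hx
        have h3 : ((c - t₀ : ℝ) : ℂ) + r * ζ = c - (t₀ + r * -ζ) := by push_cast; ring
        rw [mem_ball_zero_iff] at hζ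
        simp only at hxs ⊢
        rw [h3] at hxs ⊢
        have h4 := hxs.2
        rw [him'] at h4
        refine ⟨-ζ, mem_ball_zero_iff.2 (by rwa [norm_neg]), hElo _ (by rw [norm_neg]; exact hζ.le) ?_⟩
        by_contra! h5
        nlinarith

end

/-! ### Disc charts everywhere; moving the punctures to the boundary -/

section

variable {X : Type*} [TopologicalSpace X] {M : ℕ} {ν : ℕ → ℕ} {V : Prop} {q : UnitDisc → X}

theorem IsPolygonGluing.isVertex_of_eq (h : IsPolygonGluing M ν V q) {z w : UnitDisc}
    (hz : IsVertex M z) (hzw : q z = q w) : IsVertex M w := by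
  rcases (h.eq_iff z w).1 hzw with rfl | ⟨n, hn, t, ht, rfl, rfl⟩ | ⟨-, -, hw⟩
  · exact hz
  · obtain ⟨k, rfl⟩ := (isVertex_arc_iff h.pos).1 hz
    exact (isVertex_arc_iff h.pos).2 ⟨n + ν n + 1 - k, by push_cast; rfl⟩
  · exact hw

theorem IsPolygonGluing.exists_isDiscChart (h : IsPolygonGluing M ν V q)
    (hv : ∀ n < M, ∃ V : ℂ → X, IsDiscChart V ∧ V 0 = q (arc M n)) (x : X) :
    ∃ V : ℂ → X, IsDiscChart V ∧ V 0 = x := by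
  obtain ⟨z, rfl⟩ := h.isQuotientMap.surjective x
  have hM : (0 : ℝ) < M := by exact_mod_cast h.pos
  rcases (mem_closedBall_zero_iff.1 z.2).eq_or_lt with hz | hz
  · by_cases hz' : IsVertex M z
    · obtain ⟨n, hn, rfl⟩ := IsVertex.exists_lt h.pos hz'
      exact hv n hn
    obtain ⟨t, ht, rfl⟩ := exists_arc h.pos hz
    have h1 := Nat.floor_le ht.1
    have h2 := Nat.lt_floor_add_one t
    have hn : ⌊t⌋₊ < M := (Nat.floor_lt ht.1).2 ht.2
    have h3 : (⌊t⌋₊ : ℝ) ≠ t := fun h3 => hz' ⟨⌊t⌋₊, by rw [h3]⟩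
    have h4 : (⌊t⌋₊ : ℝ) < t := lt_of_le_of_ne h1 h3
    obtain ⟨r, hr, hr1, hr2⟩ : ∃ r : ℝ, 0 < r ∧ ⌊t⌋₊ < t - r ∧ t + r < ⌊t⌋₊ + 1 := by
      refine ⟨min (t - ⌊t⌋₊) (⌊t⌋₊ + 1 - t) / 2, ?_, ?_, ?_⟩
      · have := lt_min (sub_pos.2 h4) (sub_pos.2 h2)
        positivity
      · linarith [min_le_left (t - ⌊t⌋₊) (⌊t⌋₊ + 1 - t)]
      · linarith [min_le_right (t - ⌊t⌋₊) (⌊t⌋₊ + 1 - t)]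
    refine ⟨_, h.isDiscChart_edge hn hr hr1 hr2, ?_⟩
    rw [edgeChart, Complex.zero_im, if_pos le_rfl, mul_zero, add_zero,
      stripMap_ofReal h.pos ⟨(Nat.cast_nonneg _).trans_lt h4, ht.2⟩]
  · have hz1 : (z : ℂ) ≠ 1 := by
      intro h1
      rw [h1, norm_one] at hz
      exact lt_irrefl _ hz
    obtain ⟨⟨h1, h2⟩, h3⟩ := stripInv_mem h.pos z
    have h4 : stripMap M (stripInv M z) = z := stripMap_stripInv h.pos hz1
    have h5 : 0 < (stripInv M z).im := by
      refine lt_of_le_of_ne h3 fun h0 => ?_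
      have h6 : stripInv M z = ((stripInv M z).re : ℂ) := by apply Complex.ext <;> simp [← h0]
      rw [h6, stripMap_ofReal h.pos ⟨h1, h2⟩] at h4
      rw [← h4, norm_arc] at hz
      exact lt_irrefl _ hz
    obtain ⟨r, hr, hr1, hr2, hr3⟩ : ∃ r : ℝ, 0 < r ∧ r < (stripInv M z).re ∧
        (stripInv M z).re + r < M ∧ r < (stripInv M z).im := by
      have h6 := min_le_left (stripInv M z).re (min (M - (stripInv M z).re) (stripInv M z).im)
      have h7 := min_le_right (stripInv M z).re (min (M - (stripInv M z).re) (stripInv M z).im)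
      have h8 := min_le_left (M - (stripInv M z).re) (stripInv M z).im
      have h9 := min_le_right (M - (stripInv M z).re) (stripInv M z).im
      have h10 : 0 < min (stripInv M z).re (min (M - (stripInv M z).re) (stripInv M z).im) :=
        lt_min h1 (lt_min (sub_pos.2 h2) h5)
      exact ⟨_, half_pos h10, by linarith, by linarith, by linarith⟩
    refine ⟨_, h.isDiscChart_interior hr hr1 hr2 hr3, ?_⟩
    simp only [mul_zero, add_zero]
    rw [h4]

/-- A single corner meets each vertex of the bigon: `ν n + 1 = 2 - n` is congruent to `n` modulo 2,
so the cycle of corners closes after one step. -/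
theorem exists_isDiscChart_zero (n : ℕ) (hn : n < 2) : ∃ V : ℂ → ClosedSurface 0, IsDiscChart V ∧
    V 0 = Quot.mk (SideGluing 0) (arc 2 n) := by
  refine isPolygonGluing_zero.exists_isDiscChart_vertex one_pos (e := fun _ => n) (fun _ _ => hn)
    (fun m hm m' hm' _ => by lia) (fun m _ => ⟨n - 1, ?_⟩) ⟨0, by simp⟩ fun m _ w hw => ⟨0, one_pos, ?_⟩
  · interval_cases n <;> norm_num
  · rcases (isPolygonGluing_zero.eq_iff _ _).1 hw with h | ⟨l, hl, t, ht, h1, rfl⟩ | ⟨h, -⟩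
    · exact h.symm
    · obtain ⟨k, hk⟩ := (arc_eq_arc_iff two_pos).1 h1
      refine (arc_eq_arc_iff two_pos).2 ⟨1 - n + k, ?_⟩
      have h2 : (l : ℝ) + ((1 - l : ℕ) : ℝ) = 1 := by
        rw [← Nat.cast_add]
        have : l + (1 - l) = 1 := by lia
        rw [this, Nat.cast_one]
      rw [h2]
      push_cast at hk ⊢
      linarith
    · exact h.elim

/-- The order in which the corners of the standard polygon are arranged around its vertex. -/
def corner (m : ℕ) : ℕ := if m % 4 = 1 then m + 2 else if m % 4 = 3 then m - 2 else m

/-- All `4 * g` corners form one cycle, in the order 0, 3, 2, 1, 4, 7, 6, 5, and so on. The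
enumeration `corner` is an involution, which gives both injectivity and surjectivity. -/
theorem exists_isDiscChart_pos {g : ℕ} (hg : 0 < g) (n : ℕ) :
    ∃ V : ℂ → ClosedSurface g, IsDiscChart V ∧ V 0 = Quot.mk (SideGluing g) (arc (4 * g) n) := by
  have h := isPolygonGluing_pos hg
  have h0 : (Quot.mk (SideGluing g) (arc (4 * g) n) : ClosedSurface g) =
      Quot.mk (SideGluing g) (arc (4 * g) (corner 0 : ℕ)) :=
    (h.eq_iff _ _).2 (Or.inr (Or.inr ⟨trivial, ⟨n, rfl⟩, ⟨corner 0, rfl⟩⟩))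
  rw [h0]
  refine h.exists_isDiscChart_vertex (N := 4 * g) h.pos (e := corner) ?_ ?_ ?_ ?_ ?_
  · intro m hm; unfold corner; split_ifs <;> lia
  · intro m hm m' hm'; unfold corner; split_ifs <;> lia
  · intro m hm
    refine ⟨0, ?_⟩
    have : corner (m + 1) = partner (corner m) + 1 := by
      unfold corner partner; split_ifs <;> lia
    rw [this]; simp
  · refine ⟨1, ?_⟩
    have h1 : corner (4 * g) = 4 * g := by unfold corner; split_ifs <;> lia
    rw [h1]; simp [corner]
  · intro m hm w hw
    obtain ⟨l, hl, rfl⟩ := IsVertex.exists_lt h.pos (h.isVertex_of_eq ⟨corner m, rfl⟩ hw)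
    refine ⟨corner l, ?_, ?_⟩
    · unfold corner; split_ifs <;> lia
    · have : corner (corner l) = l := by unfold corner; split_ifs <;> lia
      rw [this]

/-- The closed surface is obtained from a polygon; it is locally homeomorphic to the plane, and
has at most one vertex, or two if the genus is zero. -/
theorem exists_isPolygonGluing (g : ℕ) : ∃ (M : ℕ) (ν : ℕ → ℕ) (V : Prop) (q : UnitDisc → ClosedSurface g),
    IsPolygonGluing M ν V q ∧ (∀ x, ∃ V : ℂ → ClosedSurface g, IsDiscChart V ∧ V 0 = x) ∧
    (q '' {z | IsVertex M z}).encard ≤ if g = 0 then 2 else 1 := by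
  rcases g.eq_zero_or_pos with rfl | hg
  · refine ⟨_, _, _, _, isPolygonGluing_zero,
      isPolygonGluing_zero.exists_isDiscChart exists_isDiscChart_zero, ?_⟩
    rw [if_pos rfl]
    refine (encard_image_le _ _).trans ((encard_le_encard (t := {arc 2 0, arc 2 1}) ?_).trans
      ((encard_insert_le _ _).trans (by rw [encard_singleton, one_add_one_eq_two])))
    intro z hz
    obtain ⟨n, hn, rfl⟩ := IsVertex.exists_lt two_pos hz
    interval_cases n <;> simp
  · have h := isPolygonGluing_pos hg
    refine ⟨_, _, _, _, h, h.exists_isDiscChart fun n _ => exists_isDiscChart_pos hg n, ?_⟩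
    rw [if_neg hg.ne', encard_le_one_iff]
    rintro _ _ ⟨z, hz, rfl⟩ ⟨w, hw, rfl⟩
    exact (h.eq_iff _ _).2 (Or.inr (Or.inr ⟨trivial, hz, hw⟩))

/-- The surface with punctures `P` is also the complement of a finite set that contains all
vertices and lies on the boundary of the polygon. -/
theorem IsPolygonGluing.exists_isOpenEmbedding (h : IsPolygonGluing M ν V q)
    (hch : ∀ x, ∃ V : ℂ → X, IsDiscChart V ∧ V 0 = x) {S : Type*} [TopologicalSpace S] {P : Set X}
    (hP : P.Finite) (hcard : (q '' {z | IsVertex M z}).encard ≤ P.encard) (f : S ≃ₜ ↥Pᶜ) :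
    ∃ (P' : Set X) (ι : S → X), P'.Finite ∧ P' ⊆ q '' {z | ‖(z : ℂ)‖ = 1} ∧
      q '' {z | IsVertex M z} ⊆ P' ∧ IsOpenEmbedding ι ∧ range ι = P'ᶜ := by
  have := h.t2Space
  have hM : (0 : ℝ) < M := by exact_mod_cast h.pos
  have hM1 : (1 : ℝ) ≤ M := by exact_mod_cast h.pos
  -- The boundary supplies as many further points as there are punctures. Half a side suffices: even
  -- if its partner is adjacent, no two of its points are identified.
  have hinf : (q '' {z | ‖(z : ℂ)‖ = 1}).Infinite := by
    have h1 : ((fun t : ℝ => q (arc M t)) '' Ioo (0 : ℝ) (1 / 2)).Infinite := by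
      refine (Ioo_infinite (by norm_num)).image fun t ht s hs hts => ?_
      have hν : (ν 0 : ℝ) + 1 ≤ M := by exact_mod_cast h.lt 0 h.pos
      have hν0 : (0 : ℝ) ≤ ν 0 := (ν 0).cast_nonneg
      have hlt : ∀ k : ℤ, ∀ x : ℝ, x = k * M → -1 < x → x < M → k = 0 := by
        intro k x hx h1 h2
        have h5 : (-1 : ℝ) < k := by nlinarith
        have h6 : (k : ℝ) < 1 := by nlinarith
        have h7 : (-1 : ℤ) < k := by exact_mod_cast h5
        have h8 : k < (1 : ℤ) := by exact_mod_cast h6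
        lia
      rcases (h.arc_eq_iff h.pos (t := t) ⟨by simpa using ht.1, by
        push_cast; linarith [ht.2]⟩ _).1 hts with h1 | h1
      · obtain ⟨k, hk⟩ := (arc_eq_arc_iff h.pos).1 h1
        have := hlt k (t - s) (by linarith) (by linarith [ht.1, hs.2]) (by linarith [ht.2, hs.1])
        rw [hk, this]
        simp
      · obtain ⟨k, hk⟩ := (arc_eq_arc_iff h.pos).1 h1
        push_cast at hk
        have := hlt k (ν 0 + 1 - t - s) (by linarith) (by linarith [ht.2, hs.2])
          (by linarith [ht.1, hs.1])
        rw [this] at hk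
        simp only [Int.cast_zero, zero_mul, add_zero, zero_add] at hk
        linarith [ht.2, hs.2]
    exact h1.mono (by rintro _ ⟨t, -, rfl⟩; exact ⟨_, norm_arc M t, rfl⟩)
  obtain ⟨P', h1, h2, h3⟩ := exists_superset_subset_encard_eq (s := q '' {z | IsVertex M z})
    (t := q '' {z | ‖(z : ℂ)‖ = 1}) (k := P.encard)
    (image_mono fun z ⟨n, hn⟩ => by rw [hn]; exact norm_arc M n) hcard
    (by rw [hinf.encard_eq]; exact le_top)
  -- The set `P'` lies between the vertices and the boundary and has as many points as `P`, so a
  -- homeomorphism of the closed surface takes `P` to `P'`.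
  obtain ⟨H, hH⟩ := exists_homeomorph_image_finite hch (fun F hF => h.isPreconnected_compl hF) hP h3.symm
  refine ⟨P', fun s => H (f s), finite_of_encard_eq_coe (k := P.ncard) ?_, h2, h1, ?_, ?_⟩
  · rw [h3, hP.cast_ncard_eq]
  · exact H.isOpenEmbedding.comp ((hP.isClosed.isOpen_compl.isOpenEmbedding_subtypeVal).comp
      f.isOpenEmbedding)
  · rw [← hH, ← image_compl_eq H.bijective]
    ext x
    constructor
    · rintro ⟨s, rfl⟩
      exact ⟨_, (f s).2, rfl⟩
    · rintro ⟨y, hy, rfl⟩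
      exact ⟨f.symm ⟨y, hy⟩, by simp⟩

end

/-! ### Lifting the polygon to the universal cover and prescribing the germs at its sides -/

section

variable {S E X : Type*} [TopologicalSpace S] [TopologicalSpace E] [TopologicalSpace X] {p : E → S}

/-- Maps on star-convex sets lift to covering spaces. -/
theorem IsCoveringMap.exists_lift_starConvex (hp : IsCoveringMap p) {T : Set ℂ} {c : ℂ}
    (hT : StarConvex ℝ c T) {π : ℂ → S} (hπ : ContinuousOn π T) {e : E}
    (he : p e = π c) : ∃ f : ℂ → E, ContinuousOn f T ∧ ∀ x ∈ T, p (f x) = π x := by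
  have hmem : ∀ (t : unitInterval) (x : T), c + (t : ℝ) • ((x : ℂ) - c) ∈ T := fun t x =>
    hT.add_smul_sub_mem x.2 t.2.1 t.2.2
  -- The radial homotopy from the constant map at `π c` to `π`; its lift at time 1 is the desired
  -- map.
  let H : C(unitInterval × T, S) := ⟨fun a => π (c + (a.1 : ℝ) • ((a.2 : ℂ) - c)),
    hπ.comp_continuous (by fun_prop) fun a => hmem a.1 a.2⟩
  have H0 : ∀ a : T, H (0, a) = p ((ContinuousMap.const T e) a) := fun a => by
    simp [H, he]
  let L := hp.liftHomotopy H (ContinuousMap.const T e) H0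
  have hL : ∀ a, p (L a) = H a := fun a => congrFun (hp.liftHomotopy_lifts H _ H0) a
  classical
  refine ⟨fun x => if hx : x ∈ T then L (1, ⟨x, hx⟩) else e, ?_, ?_⟩
  · rw [continuousOn_iff_continuous_domRestrict]
    have h1 : Continuous fun x : T => L (1, x) := L.continuous.comp (by fun_prop)
    convert h1 using 2 with x
    simp [domRestrict]
  · intro x hx
    simp only [dif_pos hx, hL]
    simp [H]

theorem IsDiscChart.exists_openPartialHomeomorph [T2Space X] {D : ℂ → X} (hD : IsDiscChart D) :
    ∃ δ : OpenPartialHomeomorph ℂ X, δ.source = Metric.ball 0 1 ∧ ∀ z, δ z = D z := by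
  let e : PartialEquiv ℂ X := (hD.injOn.mono Metric.ball_subset_closedBall).toPartialEquiv D
    (Metric.ball 0 1)
  have ho : IsOpenMap (e.source.domRestrict e) := by
    intro U hU
    obtain ⟨W, hW, rfl⟩ := hU
    have : e.source.domRestrict e '' (Subtype.val ⁻¹' W) = D '' (W ∩ Metric.ball 0 1) := by
      ext x
      constructor
      · rintro ⟨z, hz, rfl⟩
        exact ⟨z, ⟨hz, z.2⟩, rfl⟩
      · rintro ⟨z, hz, rfl⟩
        exact ⟨⟨z, hz.2⟩, hz.1, rfl⟩
    rw [this]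
    exact hD.isOpen_image (hW.inter Metric.isOpen_ball) inter_subset_right
  exact ⟨OpenPartialHomeomorph.ofContinuousOpenRestrict e
    (hD.continuousOn.mono Metric.ball_subset_closedBall) ho Metric.isOpen_ball, rfl, fun z => rfl⟩

/-- Disc charts lift along local homeomorphisms. -/
theorem IsDiscChart.exists_lift [T2Space X] {D : ℂ → X} (hD : IsDiscChart D) {Φ : E → X}
    (hΦ : IsLocalHomeomorph Φ) {e : E} (he : Φ e = D 0) :
    ∃ γ : OpenPartialHomeomorph ℂ E, ∃ ε : ℝ, 0 < ε ∧ Metric.ball 0 ε ⊆ γ.source ∧ γ 0 = e ∧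
      ∀ ζ ∈ γ.source, ζ ∈ Metric.ball (0 : ℂ) 1 ∧ Φ (γ ζ) = D ζ := by
  obtain ⟨δ, hδ, hδD⟩ := hD.exists_openPartialHomeomorph
  obtain ⟨u, hu, rfl⟩ := hΦ e
  have h0 : (0 : ℂ) ∈ (δ.trans u.symm).source := by
    rw [OpenPartialHomeomorph.trans_source, hδ]
    refine ⟨Metric.mem_ball_self one_pos, ?_⟩
    rw [mem_preimage, hδD, ← he]
    exact u.map_source hu
  obtain ⟨ε, hε, hεs⟩ := Metric.isOpen_iff.1 (δ.trans u.symm).open_source 0 h0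
  refine ⟨δ.trans u.symm, ε, hε, hεs, ?_, fun ζ hζ => ?_⟩
  · rw [OpenPartialHomeomorph.coe_trans, Function.comp_apply, hδD, ← he, u.left_inv hu]
  · rw [OpenPartialHomeomorph.trans_source, hδ] at hζ
    refine ⟨hζ.1, ?_⟩
    rw [OpenPartialHomeomorph.coe_trans, Function.comp_apply, ← hδD]
    exact u.right_inv hζ.2

/-- In the chart `γ` the map `dev` is `d` between two affine isomorphisms, hence a local
homeomorphism. -/
theorem exists_openPartialHomeomorph_of_lift (γ : OpenPartialHomeomorph ℂ E) (h0 : 0 ∈ γ.source)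
    {dev : E → ℂ} {A : AffC} {d : OpenPartialHomeomorph ℂ ℂ} {x : ℂ} {r : ℝ} (hr : 0 < r)
    (hx : x ∈ d.source) (hdev : ∀ᶠ ζ in 𝓝 (0 : ℂ), dev (γ ζ) = A (d (x + r * ζ))) :
    ∃ d' : OpenPartialHomeomorph E ℂ, γ 0 ∈ d'.source ∧ EqOn dev d' d'.source := by
  have hrC : (r : ℂ) ≠ 0 := Complex.ofReal_ne_zero.2 hr.ne'
  let τ : ℂ ≃ₜ ℂ := (Homeomorph.mulLeft₀ (r : ℂ) hrC).trans (Homeomorph.addLeft x)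
  let ψ : OpenPartialHomeomorph ℂ ℂ := (τ.transOpenPartialHomeomorph d).transHomeomorph
    A.toContinuousAffineEquiv.toHomeomorph
  have hψ : ∀ ζ, ψ ζ = A (d (x + r * ζ)) := fun ζ => rfl
  have h0ψ : (0 : ℂ) ∈ ψ.source := by
    change x + r * 0 ∈ d.source
    rwa [mul_zero, add_zero]
  obtain ⟨W, hW, hWo, h0W⟩ := eventually_nhds_iff.1 hdev
  let γ' := γ.restrOpen W hWo
  refine ⟨γ'.symm.trans ψ, ?_, ?_⟩
  · have h1 : (0 : ℂ) ∈ γ'.source := ⟨h0, h0W⟩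
    have h2 : γ'.symm (γ 0) = 0 := γ'.left_inv h1
    refine ⟨γ'.map_source h1, ?_⟩
    change γ'.symm (γ 0) ∈ ψ.source
    rw [h2]
    exact h0ψ
  · rintro e ⟨he, -⟩
    have h1 := γ'.map_target he
    have h2 : γ (γ'.symm e) = e := γ'.right_inv he
    rw [OpenPartialHomeomorph.coe_trans, Function.comp_apply, hψ, ← hW _ h1.2, h2]

variable {M : ℕ} {ν : ℕ → ℕ} {V : Prop} {q : UnitDisc → X}

theorem IsPolygonGluing.finite_preimage (h : IsPolygonGluing M ν V q) {P : Set X} (hP : P.Finite) :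
    (q ⁻¹' P).Finite := by
  refine hP.preimage' fun x _ => ?_
  obtain ⟨z, rfl⟩ := h.isQuotientMap.surjective x
  rcases (mem_closedBall_zero_iff.1 z.2).eq_or_lt with hz | hz
  · by_cases hz' : IsVertex M z
    · exact (finite_isVertex h.pos).subset fun w hw => h.isVertex_of_eq hz' (Eq.symm hw)
    obtain ⟨t, ht, rfl⟩ := exists_arc h.pos hz
    have h1 := Nat.floor_le ht.1
    have h3 : (⌊t⌋₊ : ℝ) ≠ t := fun h3 => hz' ⟨⌊t⌋₊, by rw [h3]⟩
    refine (toFinite {arc M t, arc M (⌊t⌋₊ + ν ⌊t⌋₊ + 1 - t)}).subset fun w hw => ?_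
    rcases (h.arc_eq_iff ((Nat.floor_lt ht.1).2 ht.2)
      ⟨lt_of_le_of_ne h1 h3, Nat.lt_floor_add_one t⟩ w).1 (Eq.symm hw) with h4 | h4
    · exact Or.inl h4.symm
    · exact Or.inr h4.symm
  · exact (finite_singleton z).subset fun w hw => (h.eq_of_norm_lt hz (Eq.symm hw)).symm

/-- The parameters in `[0, M]` of the points of `P` on the boundary of the polygon. -/
def cuts (M : ℕ) (q : UnitDisc → X) (P : Set X) : Set ℝ := {t | t ∈ Icc (0 : ℝ) M ∧ q (arc M t) ∈ P}

/-- The part of the strip that corresponds to the complement of `P`. -/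
def puncturedStrip (M : ℕ) (q : UnitDisc → X) (P : Set X) : Set ℂ :=
  {x | x ∈ strip M ∧ q (stripMap M x) ∉ P}

theorem IsPolygonGluing.finite_cuts (h : IsPolygonGluing M ν V q) {P : Set X} (hP : P.Finite) :
    (cuts M q P).Finite := by
  have hinj : InjOn (arc M) (Ico (0 : ℝ) M) := by
    intro t ht s hs hts
    have hM : (0 : ℝ) < M := by exact_mod_cast h.pos
    obtain ⟨k, hk⟩ := (arc_eq_arc_iff h.pos).1 hts
    have h5 : (-1 : ℝ) < k := by nlinarith [ht.1, hs.2]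
    have h6 : (k : ℝ) < 1 := by nlinarith [ht.2, hs.1]
    have h7 : (-1 : ℤ) < k := by exact_mod_cast h5
    have h8 : k < (1 : ℤ) := by exact_mod_cast h6
    have h9 : k = 0 := by lia
    rw [hk, h9]; simp
  have h1 : (Ico (0 : ℝ) M ∩ arc M ⁻¹' (q ⁻¹' P)).Finite := by
    refine Finite.of_finite_image ((h.finite_preimage hP).subset ?_) (hinj.mono inter_subset_left)
    rintro _ ⟨t, ht, rfl⟩
    exact ht.2
  refine (h1.insert (M : ℝ)).subset ?_
  rintro t ⟨ht, htP⟩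
  rcases ht.2.eq_or_lt with h2 | h2
  · exact Or.inl h2
  · exact Or.inr ⟨⟨ht.1, h2⟩, htP⟩

theorem IsPolygonGluing.mem_puncturedStrip_of_im_pos (h : IsPolygonGluing M ν V q) {P : Set X}
    (hPb : P ⊆ q '' {z | ‖(z : ℂ)‖ = 1}) {x : ℂ} (hre : x.re ∈ Ioo (0 : ℝ) M)
    (him : 0 < x.im) : x ∈ puncturedStrip M q P := by
  refine ⟨⟨hre, him.le⟩, fun hx => ?_⟩
  obtain ⟨z, hz, hzx⟩ := hPb hx
  have h1 := norm_stripMap_lt M him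
  rw [h.eq_of_norm_lt h1 hzx.symm] at h1
  exact h1.ne hz

theorem ofReal_mem_puncturedStrip_iff {X : Type*} {q : UnitDisc → X} (hM : 0 < M) {P : Set X} {t : ℝ} :
    (t : ℂ) ∈ puncturedStrip M q P ↔ t ∈ Ioo (0 : ℝ) M ∧ q (arc M t) ∉ P := by
  constructor
  · rintro ⟨⟨h1, -⟩, h2⟩
    rw [Complex.ofReal_re] at h1
    rw [stripMap_ofReal hM h1] at h2
    exact ⟨h1, h2⟩
  · rintro ⟨h1, h2⟩
    exact ⟨⟨by rwa [Complex.ofReal_re], by rw [Complex.ofReal_im]⟩, by rwa [stripMap_ofReal hM h1]⟩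

theorem exists_floor_of_mem_puncturedStrip {X : Type*} {q : UnitDisc → X} (hM : 0 < M) {P : Set X}
    (hPv : q '' {z | IsVertex M z} ⊆ P) {t : ℝ} (ht : (t : ℂ) ∈ puncturedStrip M q P) :
    ∃ n < M, t ∈ Ioo (n : ℝ) (n + 1) := by
  obtain ⟨h1, h2⟩ := (ofReal_mem_puncturedStrip_iff hM).1 ht
  refine ⟨⌊t⌋₊, (Nat.floor_lt h1.1.le).2 h1.2, lt_of_le_of_ne (Nat.floor_le h1.1.le) ?_,
    Nat.lt_floor_add_one t⟩
  intro h3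
  exact h2 (hPv ⟨_, ⟨⌊t⌋₊, by rw [h3]⟩, rfl⟩)

theorem IsPolygonGluing.flip_mem_puncturedStrip (h : IsPolygonGluing M ν V q) {P : Set X} {n : ℕ}
    (hn : n < M) {t : ℝ} (ht : t ∈ Ioo (n : ℝ) (n + 1)) (htP : (t : ℂ) ∈ puncturedStrip M q P) :
    ((n + ν n + 1 - t : ℝ) : ℂ) ∈ puncturedStrip M q P := by
  obtain ⟨-, h2⟩ := (ofReal_mem_puncturedStrip_iff h.pos).1 htP
  rw [h.apply_arc hn ⟨ht.1.le, ht.2.le⟩] at h2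
  have hν : (ν n : ℝ) + 1 ≤ M := by exact_mod_cast h.lt n hn
  have hν0 : (0 : ℝ) ≤ ν n := (ν n).cast_nonneg
  exact (ofReal_mem_puncturedStrip_iff h.pos).2
    ⟨⟨by linarith [ht.2], by linarith [ht.1]⟩, h2⟩

/-- Only boundary points are missing from the strip, and every point of a segment to the interior
centre, except possibly the end point `x`, has positive imaginary part. -/
theorem IsPolygonGluing.starConvex_puncturedStrip (h : IsPolygonGluing M ν V q) {P : Set X}
    (hPb : P ⊆ q '' {z | ‖(z : ℂ)‖ = 1}) : StarConvex ℝ (⟨M / 2, 1⟩ : ℂ) (puncturedStrip M q P) := by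
  have hM : (0 : ℝ) < M := by exact_mod_cast h.pos
  intro x hx a b ha hb hab
  rcases ha.eq_or_lt with rfl | ha
  · rw [zero_add] at hab
    simpa [hab] using hx
  · obtain ⟨⟨⟨h1, h2⟩, h3⟩, -⟩ := hx
    apply h.mem_puncturedStrip_of_im_pos hPb
    · simp only [Complex.add_re, Complex.real_smul, Complex.re_ofReal_mul]
      constructor
      · have := mul_nonneg hb h1.le
        positivity
      · nlinarith
    · simp only [Complex.add_im, Complex.real_smul, Complex.im_ofReal_mul]
      have := mul_nonneg hb h3
      linarith

variable {P : Set X} {ι : S → X}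

/-- The map from the punctured strip to the surface lifts to the universal cover. -/
theorem IsPolygonGluing.exists_lift (h : IsPolygonGluing M ν V q)
    (hPb : P ⊆ q '' {z | ‖(z : ℂ)‖ = 1}) (hPv : q '' {z | IsVertex M z} ⊆ P)
    (hι : IsOpenEmbedding ι) (hr : range ι = Pᶜ) (hp : IsCoveringMap p) (e₀ : E) :
    ∃ f : ℂ → E, ContinuousOn f (puncturedStrip M q P) ∧
      (∀ x ∈ puncturedStrip M q P, ι (p (f x)) = q (stripMap M x)) ∧
      ∀ s, ∃ x ∈ puncturedStrip M q P, p (f x) = s := by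
  have hM : (0 : ℝ) < M := by exact_mod_cast h.pos
  have h1 : ∀ x : ℂ, ∃ s, x ∈ puncturedStrip M q P → ι s = q (stripMap M x) := by
    intro x
    by_cases hx : x ∈ puncturedStrip M q P
    · have : q (stripMap M x) ∈ range ι := by rw [hr]; exact hx.2
      obtain ⟨s, hs⟩ := this
      exact ⟨s, fun _ => hs⟩
    · exact ⟨p e₀, fun h => absurd h hx⟩
  choose π hπ using h1
  have hπc : ContinuousOn π (puncturedStrip M q P) := by
    rw [hι.isInducing.continuousOn_iff]
    refine ContinuousOn.congr (f := fun x => q (stripMap M x)) ?_ hπ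
    exact h.isQuotientMap.continuous.comp_continuousOn ((continuousOn_stripMap h.pos).mono
      fun x hx => hx.1.1)
  have hsurj : ∀ s, ∃ x ∈ puncturedStrip M q P, π x = s := by
    intro s
    obtain ⟨z, hz⟩ := h.isQuotientMap.surjective (ι s)
    have hzP : q z ∉ P := by
      have : ι s ∈ range ι := ⟨s, rfl⟩
      rw [hr] at this
      rwa [hz]
    have hz1 : (z : ℂ) ≠ 1 := by
      intro h1
      refine hzP (hPv ⟨z, ⟨0, Subtype.ext ?_⟩, rfl⟩)
      rw [h1]
      simp [arc]
    have hx : stripInv M z ∈ puncturedStrip M q P :=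
      ⟨stripInv_mem h.pos z, by rwa [stripMap_stripInv h.pos hz1]⟩
    refine ⟨_, hx, hι.injective ?_⟩
    rw [hπ _ hx, stripMap_stripInv h.pos hz1, hz]
  obtain ⟨c, hstar⟩ : ∃ c, StarConvex ℝ c (puncturedStrip M q P) :=
    ⟨_, h.starConvex_puncturedStrip hPb⟩
  obtain ⟨a, ha, hae⟩ := hsurj (p e₀)
  have hmem : ∀ t : unitInterval, c + (1 - t : ℝ) • (a - c) ∈ puncturedStrip M q P := fun t =>
    hstar.add_smul_sub_mem ha (sub_nonneg.2 t.2.2) (sub_le_self _ t.2.1)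
  let γ : C(unitInterval, S) := ⟨fun t => π (c + (1 - t : ℝ) • (a - c)),
      hπc.comp_continuous (by fun_prop) hmem⟩
  -- Lifting a path that ends at `π c` gives a point of `E` over the image of the centre, where the
  -- lift of the strip starts.
  obtain ⟨Γ, hΓ, -⟩ := hp.exists_path_lifts γ e₀ (by simp [γ, hae])
  have hΓ1 : p (Γ 1) = π c := by
    have := congrFun hΓ 1
    simpa [γ] using this
  obtain ⟨f, hf, hfp⟩ := hp.exists_lift_starConvex hstar hπc hΓ1
  refine ⟨f, hf, fun x hx => by rw [hfp x hx, hπ x hx], fun s => ?_⟩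
  obtain ⟨x, hx, hxs⟩ := hsurj s
  exact ⟨x, hx, by rw [hfp x hx, hxs]⟩

/-- There is an immersion of the half plane which on both sides of an edge is given by affine maps
that differ by the action of the edge identification. -/
theorem IsPolygonGluing.exists_immersion [SimplyConnectedSpace E] (h : IsPolygonGluing M ν V q)
    (hPf : P.Finite) (hPv : q '' {z | IsVertex M z} ⊆ P) (hι : IsOpenEmbedding ι)
    (hp : IsCoveringMap p) {x₀ : S} (e₀ : p ⁻¹' {x₀}) (ρ : LoopGroup S x₀ →* AffC) {f : ℂ → E}
    (hf : ContinuousOn f (puncturedStrip M q P))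
    (hfι : ∀ x ∈ puncturedStrip M q P, ι (p (f x)) = q (stripMap M x)) :
    ∃ (F : ℂ → ℂ) (B : ℝ → AffC),
      (∀ z, z.re ∈ Ioo (0 : ℝ) M → 0 < z.im → ∃ d : OpenPartialHomeomorph ℂ ℂ, z ∈ d.source ∧
        ∀ᶠ w in 𝓝 z, F w = d w) ∧
      (∀ t : ℝ, (t : ℂ) ∈ puncturedStrip M q P → ∀ᶠ z in 𝓝 (t : ℂ), F z = B t z) ∧
      ∀ n < M, ∀ t ∈ Ioo (n : ℝ) (n + 1), (t : ℂ) ∈ puncturedStrip M q P →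
        ∃ hpf : p (f t) = p (f (n + ν n + 1 - t : ℝ)), ∀ z : ℂ,
          B (n + ν n + 1 - t) (n + ν n + 1 - z) = ρ (loopOf hp e₀ _ _ hpf) (B t z) := by
  classical
  have hM : (0 : ℝ) < M := by exact_mod_cast h.pos
  have hpf : ∀ n < M, ∀ t ∈ Ioo (n : ℝ) (n + 1), (t : ℂ) ∈ puncturedStrip M q P →
      p (f t) = p (f (n + ν n + 1 - t : ℝ)) := by
    intro n hn t ht htP
    have ht' := h.flip_mem_puncturedStrip hn ht htP
    apply hι.injective
    rw [hfι _ htP, hfι _ ht', stripMap_ofReal h.pos ((ofReal_mem_puncturedStrip_iff h.pos).1 htP).1,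
      stripMap_ofReal h.pos ((ofReal_mem_puncturedStrip_iff h.pos).1 ht').1,
      h.apply_arc hn ⟨ht.1.le, ht.2.le⟩]
  let G : E → E → LoopGroup S x₀ := fun e e' => if he : p e = p e' then loopOf hp e₀ e e' he else 1
  have hG : ∀ e e' (he : p e = p e'), G e e' = loopOf hp e₀ e e' he := fun e e' he => dif_pos he
  let c : ℝ → ℝ := fun t => ⌊t⌋₊ + ν ⌊t⌋₊ + 1
  -- The side with the smaller index gets the identity. Its partner gets the reflection to the first
  -- side followed by `ρ` of the class from the lift there to the lift at `t`.
  let B : ℝ → AffC := fun t => if ⌊t⌋₊ < ν ⌊t⌋₊ then 1 else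
    ρ (G (f ((c t - t : ℝ) : ℂ)) (f t)) * AffineEquiv.constVSub ℂ (c t : ℂ)
  have hfloor : ∀ (n : ℕ), ∀ t ∈ Ioo (n : ℝ) (n + 1), ⌊t⌋₊ = n := fun n t ht =>
    (Nat.floor_eq_iff (n.cast_nonneg.trans ht.1.le)).2 ⟨ht.1.le, ht.2⟩
  have hB1 : ∀ n : ℕ, n < ν n → ∀ t ∈ Ioo (n : ℝ) (n + 1), B t = 1 := by
    intro n hn t ht
    simp only [B, hfloor n t ht, if_pos hn]
  have hB2 : ∀ n : ℕ, ¬ n < ν n → ∀ t ∈ Ioo (n : ℝ) (n + 1), B t =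
      ρ (G (f ((n + ν n + 1 - t : ℝ) : ℂ)) (f t)) *
        AffineEquiv.constVSub ℂ ((n + ν n + 1 : ℝ) : ℂ) := by
    intro n hn t ht
    simp only [B, c, hfloor n t ht, if_neg hn]
  have hcut : ∀ t : ℝ, t ∈ Ioo (0 : ℝ) M → t ∉ cuts M q P → (t : ℂ) ∈ puncturedStrip M q P :=
    fun t ht htc => (ofReal_mem_puncturedStrip_iff h.pos).2
      ⟨ht, fun htP => htc ⟨⟨ht.1.le, ht.2.le⟩, htP⟩⟩
  -- A gap contains no integer, because the vertices are cuts, so it lies in one side. Along it the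
  -- class between the two lifts is constant.
  have hconst : ∀ l r, IsGap (cuts M q P) l r → ∀ x ∈ Ioo l r, ∀ y ∈ Ioo l r, B x = B y := by
    rintro l r ⟨hl, hr', hlr, hd⟩ x hx y hy
    have hmemlr : ∀ t ∈ Ioo l r, (t : ℂ) ∈ puncturedStrip M q P := fun t ht =>
      hcut t ⟨hl.1.1.trans_lt ht.1, ht.2.trans_le hr'.1.2⟩ fun h1 => disjoint_left.1 hd h1 ht
    obtain ⟨n, hn, hxn⟩ := exists_floor_of_mem_puncturedStrip h.pos hPv (hmemlr x hx)
    have hnlr : ∀ t ∈ Ioo l r, t ∈ Ioo (n : ℝ) (n + 1) := by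
      have hint : ∀ m : ℕ, m ≤ M → (m : ℝ) ∉ Ioo l r := fun m hm hmlr =>
        disjoint_left.1 hd ⟨⟨m.cast_nonneg, by exact_mod_cast hm⟩, hPv ⟨_, ⟨m, rfl⟩, rfl⟩⟩ hmlr
      have h1 : (n : ℝ) ≤ l := by
        by_contra! h2
        exact hint n hn.le ⟨h2, hxn.1.trans hx.2⟩
      have h2 : r ≤ (n : ℝ) + 1 := by
        by_contra! h2
        exact hint (n + 1) hn ⟨by push_cast; exact hx.1.trans hxn.2, by push_cast; exact h2⟩
      exact fun t ht => ⟨h1.trans_lt ht.1, ht.2.trans_le h2⟩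
    by_cases hlt : n < ν n
    · rw [hB1 n hlt x (hnlr x hx), hB1 n hlt y (hnlr y hy)]
    · have hpl : ∀ t ∈ Ioo l r, p (f ((n + ν n + 1 - t : ℝ) : ℂ)) = p (f t) := fun t ht =>
        (hpf n hn t (hnlr t ht) (hmemlr t ht)).symm
      rw [hB2 n hlt x (hnlr x hx), hB2 n hlt y (hnlr y hy), hG _ _ (hpl x hx), hG _ _ (hpl y hy)]
      congr 2
      refine loopOf_eq_of_continuousOn hp e₀ (U := Ioo l r)
        (f := fun t : ℝ => f ((n + ν n + 1 - t : ℝ) : ℂ)) (f' := fun t : ℝ => f t) ?_ ?_ ?_ hpl hx hy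
      · exact ((convex_Ioo l r).isPathConnected ⟨x, hx⟩)
      · exact hf.comp (by fun_prop) fun t ht =>
          h.flip_mem_puncturedStrip hn (hnlr t ht) (hmemlr t ht)
      · exact hf.comp (by fun_prop) hmemlr
  obtain ⟨F, hF1, hF2⟩ := exists_immersion_halfPlane B hconst (h.finite_cuts hPf)
  have h0 : (0 : ℝ) ∈ cuts M q P := ⟨⟨le_rfl, hM.le⟩, hPv ⟨_, ⟨0, by simp⟩, rfl⟩⟩
  have hM' : (M : ℝ) ∈ cuts M q P := ⟨⟨hM.le, le_rfl⟩, hPv ⟨_, ⟨M, rfl⟩, rfl⟩⟩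
  refine ⟨F, B, fun z hz hz' => hF2 0 h0 M hM' z hz hz', fun t ht => ?_, fun n hn t ht htP => ?_⟩
  · obtain ⟨ht1, ht2⟩ := (ofReal_mem_puncturedStrip_iff h.pos).1 ht
    exact hF1 0 h0 M hM' t ht1 fun htc => ht2 htc.2
  · refine ⟨hpf n hn t ht htP, fun z => ?_⟩
    have ht' : n + ν n + 1 - t ∈ Ioo (ν n : ℝ) (ν n + 1) :=
      ⟨by linarith [ht.2], by linarith [ht.1]⟩
    have hsub : (ν n : ℝ) + ν (ν n) + 1 - (n + ν n + 1 - t) = t := by rw [h.invol n hn]; ring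
    have hne := h.ne n hn
    rcases lt_or_gt_of_ne hne with hlt | hlt
    · rw [hB1 (ν n) (by rwa [h.invol n hn]) _ ht', hB2 n hlt.not_gt t ht,
        hG _ _ (hpf n hn t ht htP).symm]
      have h5 : ρ (loopOf hp e₀ _ _ (hpf n hn t ht htP)) *
          ρ (loopOf hp e₀ _ _ (hpf n hn t ht htP).symm) = 1 := by
        rw [← map_mul, loopOf_mul, loopOf_self, map_one]
      have h6 := congrArg (fun A : AffC => A (n + ν n + 1 - z)) h5
      change (n + ν n + 1 - z : ℂ) = ρ _ (ρ _ (((n + ν n + 1 : ℝ) : ℂ) - z))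
      rw [show ((n + ν n + 1 : ℝ) : ℂ) = n + ν n + 1 by push_cast; rfl]
      exact h6.symm
    · rw [hB1 n hlt t ht, hB2 (ν n) (by rw [h.invol n hn]; exact hlt.not_gt) _ ht', hsub,
        hG _ _ (hpf n hn t ht htP), h.invol n hn]
      simp
      ring_nf
end

/-! ### The equivariant map is a local homeomorphism -/

section

variable {S E X : Type*} [TopologicalSpace S] [TopologicalSpace E] [TopologicalSpace X] {p : E → S}
  {M : ℕ} {ν : ℕ → ℕ} {V : Prop} {q : UnitDisc → X} {P : Set X} {ι : S → X}

theorem isPathConnected_ball_inter {ε : ℝ} (hε : 0 < ε) {H : Set ℂ} (hH : Convex ℝ H)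
    (h0 : (0 : ℂ) ∈ H) : IsPathConnected (Metric.ball (0 : ℂ) ε ∩ H) :=
  ((convex_ball 0 ε).inter hH).isPathConnected ⟨0, Metric.mem_ball_self hε, h0⟩

/-- Every homomorphism from the fundamental group of a punctured surface to the affine group is
the monodromy of an affine structure. -/
theorem IsPolygonGluing.exists_isMonodromy [SimplyConnectedSpace E] (h : IsPolygonGluing M ν V q)
    (hPf : P.Finite) (hPb : P ⊆ q '' {z | ‖(z : ℂ)‖ = 1}) (hPv : q '' {z | IsVertex M z} ⊆ P)
    (hι : IsOpenEmbedding ι) (hr : range ι = Pᶜ) (hp : IsCoveringMap p) {x₀ : S}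
    (e₀ : p ⁻¹' {x₀}) (ρ : LoopGroup S x₀ →* AffC) :
    ∃ σ : ComplexAffineStructure S, IsMonodromy hp e₀ σ ρ := by
  have := h.t2Space
  obtain ⟨f, hf, hfι, hfs⟩ := h.exists_lift hPb hPv hι hr hp e₀.1
  obtain ⟨F, B, hF1, hF2, hFB⟩ := h.exists_immersion hPf hPv hι hp e₀ ρ hf hfι
  have hsurj : Function.Surjective (p ∘ fun x : puncturedStrip M q P => f x) := fun s => by
    obtain ⟨x, hx, hxs⟩ := hfs s
    exact ⟨⟨x, hx⟩, hxs⟩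
  have hq : ∀ x ∈ puncturedStrip M q P, ∀ e, p (f x) = p e ↔ q (stripMap M x) = ι (p e) := by
    intro x hx e
    rw [← hfι x hx, hι.injective.eq_iff]
  have hequiv : ∀ (x x' : puncturedStrip M q P) (hxx : p (f x) = p (f x')),
      F x' = ρ (loopOf hp e₀ _ _ hxx) (F x) := by
    rintro ⟨x, hx⟩ ⟨x', hx'⟩ hxx
    simp only at hxx ⊢
    have h1 := (hq x hx _).1 hxx
    rw [hfι x' hx'] at h1
    have hsame : stripMap M x = stripMap M x' → F x' = ρ (loopOf hp e₀ _ _ hxx) (F x) := by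
      intro h2
      obtain rfl := injOn_stripMap h.pos hx.1 hx'.1 h2
      rw [loopOf_self, map_one]
      rfl
    -- Distinct points of the strip over one point of the surface are partners on the real line, and
    -- there the germs were chosen to match.
    rcases hx.1.2.eq_or_lt with h0 | h0
    · obtain ⟨t, rfl⟩ : ∃ t : ℝ, x = t := ⟨x.re, by apply Complex.ext <;> simp [← h0]⟩
      obtain ⟨n, hn, ht⟩ := exists_floor_of_mem_puncturedStrip h.pos hPv hx
      rcases (h.stripMap_eq_iff hn (by rwa [Complex.ofReal_re]) hx.1.2 _).1 h1 with h2 | ⟨-, h2⟩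
      · exact hsame h2
      · have hflip := h.flip_mem_puncturedStrip hn ht hx
        have h3 : ((n + ν n + 1 - t : ℝ) : ℂ) = n + ν n + 1 - t := by push_cast; rfl
        rw [← h3] at h2
        obtain rfl := injOn_stripMap h.pos hflip.1 hx'.1 h2
        obtain ⟨_, h4⟩ := hFB n hn t ht hx
        rw [(hF2 _ hx').self_of_nhds, (hF2 _ hx).self_of_nhds, ← h4 t, h3]
    · exact hsame (h.eq_of_norm_lt (norm_stripMap_lt M h0) h1)
  obtain ⟨dev, hdev, hdeveq⟩ := exists_equivariant_extension hp e₀ hsurj ρ hequiv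
  refine _root_.exists_isMonodromy hp e₀ (fun s => by obtain ⟨x, -, hx⟩ := hfs s; exact ⟨_, hx⟩)
    (IsLocalHomeomorph.mk _ fun e => ?_) ρ hdeveq
  have hΦ : IsLocalHomeomorph (ι ∘ p) := hι.isLocalHomeomorph.comp hp.isLocalHomeomorph
  obtain ⟨x, hx, hxe⟩ := hfs (p e)
  have hxq := (hq x hx e).1 hxe
  -- In a chart of `E` that lifts a disc chart, `dev` is `F` in strip coordinates followed by one
  -- fixed affine map: over a path connected set the class between `f` and the chart does not vary.
  have hdevγ : ∀ {D : ℂ → X} {γ : OpenPartialHomeomorph ℂ E},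
      (∀ ζ ∈ γ.source, ζ ∈ Metric.ball (0 : ℂ) 1 ∧ (ι ∘ p) (γ ζ) = D ζ) →
      ∀ {U : Set ℂ}, IsPathConnected U → U ⊆ γ.source → 0 ∈ U →
      ∀ {y : ℂ → ℂ}, ContinuousOn y U → (hy : ∀ ζ ∈ U, y ζ ∈ puncturedStrip M q P) →
      (∀ ζ ∈ U, D ζ = q (stripMap M (y ζ))) →
      ∃ h0 : p (f (y 0)) = p (γ 0), ∀ ζ ∈ U,
        dev (γ ζ) = ρ (loopOf hp e₀ (f (y 0)) (γ 0) h0) (F (y ζ)) := by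
    intro D γ hγ U hU hUγ h0U y hyc hy hD
    have h1 : ∀ ζ ∈ U, p (f (y ζ)) = p (γ ζ) := fun ζ hζ => by
      rw [hq _ (hy ζ hζ), ← hD ζ hζ, ← (hγ ζ (hUγ hζ)).2]
      rfl
    refine ⟨h1 0 h0U, fun ζ hζ => ?_⟩
    rw [hdev (γ ζ) ⟨y ζ, hy ζ hζ⟩ (h1 ζ hζ)]
    exact congrArg (fun l => ρ l (F (y ζ))) (loopOf_eq_of_continuousOn hp e₀ hU
      (f := fun ζ => f (y ζ)) (hf.comp hyc hy) (γ.continuousOn.mono hUγ) h1 hζ h0U)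
  rcases hx.1.2.eq_or_lt with h0 | h0
  · obtain ⟨t, rfl⟩ : ∃ t : ℝ, x = t := ⟨x.re, by apply Complex.ext <;> simp [← h0]⟩
    obtain ⟨n, hn, ht⟩ := exists_floor_of_mem_puncturedStrip h.pos hPv hx
    have hflip := h.flip_mem_puncturedStrip hn ht hx
    have htM := ((ofReal_mem_puncturedStrip_iff h.pos).1 hx).1
    obtain ⟨r, hr0, hr1, hr2, hr3⟩ : ∃ r : ℝ, 0 < r ∧ n < t - r ∧ t + r < n + 1 ∧
        ∀ s : ℝ, |s - t| ≤ r → (s : ℂ) ∈ puncturedStrip M q P := by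
      have h1 : (cuts M q P)ᶜ ∩ Ioo (n : ℝ) (n + 1) ∈ 𝓝 t := by
        refine Filter.inter_mem ((h.finite_cuts hPf).isClosed.isOpen_compl.mem_nhds fun htc => ?_)
          (Ioo_mem_nhds ht.1 ht.2)
        exact ((ofReal_mem_puncturedStrip_iff h.pos).1 hx).2 htc.2
      obtain ⟨r, hr, hrs⟩ := Metric.nhds_basis_closedBall.mem_iff.1 h1
      have h2 : ∀ s : ℝ, |s - t| ≤ r → s ∈ (cuts M q P)ᶜ ∩ Ioo (n : ℝ) (n + 1) := fun s hs =>
        hrs (by rwa [Metric.mem_closedBall, Real.dist_eq])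
      refine ⟨r, hr, (h2 (t - r) (by rw [sub_sub_cancel_left, abs_neg, abs_of_pos hr])).2.1,
        (h2 (t + r) (by rw [add_sub_cancel_left, abs_of_pos hr])).2.2, fun s hs => ?_⟩
      obtain ⟨h3, h4⟩ := h2 s hs
      have hn' : (n : ℝ) + 1 ≤ M := by exact_mod_cast hn
      have hs0 : s ∈ Ioo (0 : ℝ) M := ⟨n.cast_nonneg.trans_lt h4.1, h4.2.trans_le hn'⟩
      exact (ofReal_mem_puncturedStrip_iff h.pos).2 ⟨hs0, fun h5 => h3 ⟨⟨hs0.1.le, hs0.2.le⟩, h5⟩⟩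
    have hD := h.isDiscChart_edge hn hr0 hr1 hr2
    have hD0 : (ι ∘ p) e = edgeChart M (n + ν n + 1) q t r 0 := by
      rw [edgeChart, if_pos (by simp), mul_zero, add_zero, hxq]
      rfl
    obtain ⟨γ, ε, hε, hεγ, rfl, hγ⟩ := hD.exists_lift hΦ hD0
    have hre : ∀ ζ ∈ γ.source, |(t + r * ζ : ℂ).re - t| ≤ r := fun ζ hζ => by
      rw [Complex.add_re, Complex.ofReal_re, add_sub_cancel_left]
      exact (norm_ofReal_mul_le hr0 (mem_ball_zero_iff.1 (hγ ζ hζ).1).le).1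
    have him : ∀ ζ : ℂ, (t + r * ζ : ℂ).im = r * ζ.im := fun ζ => by
      rw [Complex.add_im, Complex.ofReal_im, zero_add, Complex.im_ofReal_mul]
    have hup : ∀ ζ ∈ γ.source, 0 ≤ ζ.im → (t + r * ζ : ℂ) ∈ puncturedStrip M q P := by
      intro ζ hζ hi
      have h1 := hr3 _ (hre ζ hζ)
      rcases hi.eq_or_lt with h2 | h2
      · have : ((t + r * ζ : ℂ).re : ℂ) = t + r * ζ := by
          apply Complex.ext
          · rw [Complex.ofReal_re]
          · rw [Complex.ofReal_im, him, ← h2, mul_zero]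
        rwa [← this]
      · exact h.mem_puncturedStrip_of_im_pos hPb ((ofReal_mem_puncturedStrip_iff h.pos).1 h1).1
          (by rw [him]; positivity)
    have hlo : ∀ ζ ∈ γ.source, ζ.im ≤ 0 →
        ((n + ν n + 1 : ℝ) - (t + r * ζ) : ℂ) ∈ puncturedStrip M q P := by
      intro ζ hζ hi
      have h1 := hre ζ hζ
      have h2 : (t + r * ζ : ℂ).re ∈ Ioo (n : ℝ) (n + 1) := by
        rw [abs_le] at h1
        constructor <;> linarith
      have h3 := h.flip_mem_puncturedStrip hn h2 (hr3 _ h1)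
      rcases hi.eq_or_lt with h4 | h4
      · convert h3 using 1
        apply Complex.ext
        · simp
        · rw [Complex.sub_im, him, h4]
          simp
      · apply h.mem_puncturedStrip_of_im_pos hPb
        · have := ((ofReal_mem_puncturedStrip_iff h.pos).1 h3).1
          rwa [Complex.sub_re, Complex.ofReal_re]
        · rw [Complex.sub_im, him, Complex.ofReal_im]
          nlinarith
    have hU := isPathConnected_ball_inter hε (H := {ζ : ℂ | 0 ≤ ζ.im})
      (convex_halfSpace_im_ge 0) (by simp)
    have hL := isPathConnected_ball_inter hε (H := {ζ : ℂ | ζ.im ≤ 0})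
      (convex_halfSpace_im_le 0) (by simp)
    have h0b := Metric.mem_ball_self (x := (0 : ℂ)) hε
    obtain ⟨hU0, hUdev⟩ := hdevγ hγ hU (inter_subset_left.trans hεγ) ⟨h0b, by simp⟩
      (y := fun ζ => t + r * ζ) (by fun_prop) (fun ζ hζ => hup ζ (hεγ hζ.1) hζ.2)
      fun ζ hζ => if_pos hζ.2
    obtain ⟨hL0, hLdev⟩ := hdevγ hγ hL (inter_subset_left.trans hεγ) ⟨h0b, by simp⟩
      (y := fun ζ => (n + ν n + 1 : ℝ) - (t + r * ζ)) (by fun_prop)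
      (fun ζ hζ => hlo ζ (hεγ hζ.1) hζ.2)
      fun ζ hζ => by
        have hi : ζ.im ≤ 0 := hζ.2
        rcases hi.eq_or_lt with h1 | h1
        · rw [edgeChart, if_pos h1.ge]
          have h2 := hre ζ (hεγ hζ.1)
          rw [abs_le] at h2
          refine (h.stripMap_eq_iff hn ⟨by linarith, by linarith⟩ ?_ _).2 (Or.inr ⟨?_, ?_⟩)
          · rw [him, h1, mul_zero]
          · rw [him, h1, mul_zero]
          · push_cast; rfl
        · rw [edgeChart, if_neg h1.not_ge]
    obtain ⟨hpf, hB⟩ := hFB n hn t ht hx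
    -- The affine germ `B t` of the upper half disc also describes `dev` on the lower one: the
    -- cocycle rule merges the class of the lower half with that of the side pairing into the class
    -- of the upper half.
    refine exists_openPartialHomeomorph_of_lift γ (hεγ h0b) (x := t) (r := r)
      (A := ρ (loopOf hp e₀ _ _ hU0))
      (d := (B t).toContinuousAffineEquiv.toHomeomorph.toOpenPartialHomeomorph)
      hr0 (mem_univ _) ?_
    have hcont : Filter.Tendsto (fun ζ : ℂ => (t + r * ζ : ℂ)) (𝓝 0) (𝓝 (t : ℂ)) := by
      have : Continuous fun ζ : ℂ => (t + r * ζ : ℂ) := by fun_prop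
      simpa using this.tendsto 0
    have hcont' : Filter.Tendsto (fun ζ : ℂ => ((n + ν n + 1 : ℝ) - (t + r * ζ) : ℂ)) (𝓝 0)
        (𝓝 ((n + ν n + 1 - t : ℝ) : ℂ)) := by
      have : Continuous fun ζ : ℂ => ((n + ν n + 1 : ℝ) - (t + r * ζ) : ℂ) := by fun_prop
      simpa using this.tendsto 0
    filter_upwards [Metric.ball_mem_nhds 0 hε, hcont.eventually (hF2 t hx),
      hcont'.eventually (hF2 _ hflip)] with ζ hζ h1 h2
    rcases le_total 0 ζ.im with hi | hi
    · rw [hUdev ζ ⟨hζ, hi⟩, h1]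
      rfl
    · rw [hLdev ζ ⟨hζ, hi⟩, h2]
      have h3 := hB (t + r * ζ)
      have h4 : ((n + ν n + 1 : ℝ) : ℂ) - (t + r * ζ) = n + ν n + 1 - (t + r * ζ) := by
        push_cast; rfl
      have h5 : ∀ {a a' b b' : E} (e : E) (_ : a' = a) (_ : b' = b) (h1 : p a = p b)
          (h2 : p b' = p e) (h3 : p a' = p e), loopOf hp e₀ b' e h2 * loopOf hp e₀ a b h1 =
          loopOf hp e₀ a' e h3 := by
        rintro a _ b _ e rfl rfl h1 h2 h3
        exact loopOf_mul hp e₀ _ _ _ h1 h2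
      rw [h4, h3, ← h5 (γ 0) (by simp) (by simp) hpf hL0 hU0, map_mul]
      rfl
  · obtain ⟨d, hxd, hd⟩ := hF1 x hx.1.1 h0
    obtain ⟨r, hr0, hr1, hr2, hr3⟩ : ∃ r : ℝ, 0 < r ∧ r < x.re ∧ x.re + r < M ∧ r < x.im := by
      have h6 := min_le_left x.re (min (M - x.re) x.im)
      have h7 := min_le_right x.re (min (M - x.re) x.im)
      have h8 := min_le_left (M - x.re) x.im
      have h9 := min_le_right (M - x.re) x.im
      have h10 : 0 < min x.re (min (M - x.re) x.im) :=
        lt_min hx.1.1.1 (lt_min (sub_pos.2 hx.1.1.2) h0)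
      exact ⟨_, half_pos h10, by linarith, by linarith, by linarith⟩
    have hD := h.isDiscChart_interior hr0 hr1 hr2 hr3
    obtain ⟨γ, ε, hε, hεγ, rfl, hγ⟩ := hD.exists_lift (e := e) hΦ (by
      rw [mul_zero, add_zero, hxq]; rfl)
    have hmem : ∀ ζ ∈ γ.source, x + r * ζ ∈ puncturedStrip M q P := by
      intro ζ hζ
      obtain ⟨h1, h2⟩ := norm_ofReal_mul_le hr0 (mem_ball_zero_iff.1 (hγ ζ hζ).1).le
      rw [abs_le] at h1 h2
      apply h.mem_puncturedStrip_of_im_pos hPb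
      · rw [Complex.add_re]
        constructor <;> linarith
      · rw [Complex.add_im]
        linarith
    obtain ⟨h1, hAdev⟩ := hdevγ hγ ((convex_ball 0 ε).isPathConnected ⟨0, Metric.mem_ball_self hε⟩)
      hεγ (Metric.mem_ball_self hε) (y := fun ζ => x + r * ζ) (by fun_prop)
      (fun ζ hζ => hmem ζ (hεγ hζ)) fun ζ _ => rfl
    refine exists_openPartialHomeomorph_of_lift γ (hεγ (Metric.mem_ball_self hε)) (x := x) (r := r)
      (A := ρ (loopOf hp e₀ _ _ h1)) (d := d) hr0 hxd ?_
    have hcont : Filter.Tendsto (fun ζ : ℂ => (x + r * ζ : ℂ)) (𝓝 0) (𝓝 x) := by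
      have : Continuous fun ζ : ℂ => (x + r * ζ : ℂ) := by fun_prop
      simpa using this.tendsto 0
    filter_upwards [Metric.ball_mem_nhds 0 hε, hcont.eventually hd] with ζ hζ h2
    rw [hAdev ζ hζ, h2]

end

end

theorem theoremB (g k : ℕ) (hk : 2 ≤ k) (hχ : (2 : ℤ) - 2 * g - k < 0)
    {S : Type*} [TopologicalSpace S] (hS : IsPuncturedSurface g k S)
    {E : Type*} [TopologicalSpace E] [SimplyConnectedSpace E] {p : E → S}
    (hp : IsCoveringMap p) (x₀ : S) (e₀ : p ⁻¹' {x₀}) :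
    (∀ ρ : LoopGroup S x₀ →* AffC, ρ ≠ 1 →
      ∃ σ : ComplexAffineStructure S, IsMonodromy hp e₀ σ ρ) ∧
    (3 ≤ k → ∀ ρ : LoopGroup S x₀ →* AffC,
      ∃ σ : ComplexAffineStructure S, IsMonodromy hp e₀ σ ρ) := by
  have key : ∀ ρ : LoopGroup S x₀ →* AffC,
      ∃ σ : ComplexAffineStructure S, IsMonodromy hp e₀ σ ρ := by
    intro ρ
    obtain ⟨P, hP, ⟨φ⟩⟩ := hS
    obtain ⟨M, ν, V, q, h, hch, hvert⟩ := exists_isPolygonGluing g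
    -- There are enough punctures to cover all vertices; the sphere needs two.
    have hk' : (if g = 0 then 2 else 1 : ℕ∞) ≤ k := by
      split_ifs
      · exact_mod_cast hk
      · exact_mod_cast (by lia : 1 ≤ k)
    obtain ⟨P', ι, hPf, hPb, hPv, hι, hr⟩ := h.exists_isOpenEmbedding hch
      (finite_of_encard_eq_coe hP) (hvert.trans (hk'.trans hP.ge)) φ
    exact h.exists_isMonodromy hPf hPb hPv hι hr hp e₀ ρ
  exact ⟨fun ρ _ => key ρ, fun _ => key⟩
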